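/- Conventions. "Set" means small set. For an ultrafilter $\mu$ on $S$ and ultrafilters $\nu_s$ on $X$ ($s\in S$), $\int_S\nu_s\,d\mu$ is the ultrafilter on $X$ with $B\in\int_S\nu_s\,d\mu\iff\{s: B\in\nu_s\}\in\mu$; $\delta_{x}$ is the principal ultrafilter at $x$. **Ultracategories.** An ultrastructure on a category $A$ consists of functors $\int_X(-)\,d\mu:A^X\to A$ for every set $X$ and ultrafilter $\mu$ on $X$; maps $\Delta_{\mu,\nu_\bullet}:\int_X M_x\,d(\int_S\nu_s\,d\mu)\to\int_S(\int_X M_x\,d\nu_s)\,d\mu$, natural in $M\in A^X$, for all ultrafilters $\mu$ on $S$ and families $(\nu_s)_{s\in S}$ of ultrafilters on $X$; and isomorphisms $\epsilon_{X,x_0}:\int_X M_x\,d\delta_{x_0}\to M_{x_0}$, natural in $M$; such that (A) $\Delta_{\delta_{s_0},\nu_\bullet}$ is inverse to $\epsilon_{S,s_0}:\int_S(\int_X M_x\,d\nu_s)\,d\delta_{s_0}\to\int_X M_x\,d\nu_{s_0}$; (B) $\Delta_{\mu,\delta_{f(\bullet)}}:\int_Y M_y\,d(f\mu)\to\int_X(\int_Y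 M_y\,d\delta_{f(x)})\,d\mu$ is invertible for every injection $f:X\to Y$; (C) for $\lambda$ on $R$, $\mu_r$ on $S$, $\nu_s$ on $X$, one has $\big(\int_R\Delta_{\mu_r,\nu_\bullet}d\lambda\big)\circ\Delta_{\lambda,\int_S\nu_s d\mu_\bullet}=\Delta_{\lambda,\mu_\bullet}\circ\Delta_{\int_R\mu_r d\lambda,\,\nu_\bullet}$. A left ultrafunctor is a functor $F$ with maps $\sigma_\mu:F(\int_X M_x\,d\mu)\to\int_X F(M_x)\,d\mu$, natural in $M\in A^X$, with $\epsilon\circ\sigma_{\delta_{x_0}}=F(\epsilon)$ and $\Delta_{\mu,\nu_\bullet}\circ\sigma_{\int_S\nu_s d\mu}=(\int_S\sigma_{\nu_s}d\mu)\circ\sigma_\mu\circ F(\Delta_{\mu,\nu_\bullet})$; a right ultrafunctor is the dual notion, with maps $\int_X F(M_x)\,d\mu\to F(\int_X M_x\,d\mu)$; an ultrafunctor is a left ultrafunctor with all $\sigma_\mu$ invertible. A natural transformation of left ultrafunctors (or of ultrafunctors) $(F,\sigma)\to(G,\sigma')$ is a natural transformation $\alpha:F\to G$ with $(\int_X\alpha_{M_x}d\mu)\circ\sigma_\mu=\sigma'_\mu\circ\alpha_{\int_X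 M_x d\mu}$; dually for right ultrafunctors. **The ultracompletion.** For a category $A$, let $TA$ be the category whose objects are triples $(X,\mu,(M_x)_{x\in X})$ with $X$ a set, $\mu$ an ultrafilter on $X$ and $M_x\in A$. A morphism $(X,\mu,M)\to(Y,\nu,N)$ is given by a set $Y'\in\nu$, a function $f:Y'\to X$ with $f(\nu|_{Y'})=\mu$, and morphisms $M_{f(y)}\to N_y$ ($y\in Y'$), two such data being identified if they agree on some set belonging to $\nu$. This is a $2$-functor, and a pseudo-monad with unit $\eta_A(M)=(*,*,M)$ and multiplication $\mu_A:T^2A\to TA$, $$\big(S,\mu,(T_s,\nu_s,(M_{s,t})_{t\in T_s})_{s\in S}\big)\mapsto\Big(\coprod_{s} T_s,\ \int_S\iota_s\nu_s\,d\mu,\ (M_{s,t})\Big)$$ ($\iota_s:T_s\to\coprod_s T_s$ the inclusions), and the coherence isomorphisms $\mathrm{id}\cong\mu_A\eta_{TA}$, $\mathrm{id}\cong\mu_A T\eta_A$, $\mu_A\mu_{TA}\cong\mu_A T\mu_A$ induced by the canonical bijections of index sets. **Colax algebras.** A normal colax $T$-algebra structure on $A$ is a functor $m:TA\to A$, a natural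 transformation $a:m\mu_A\to m\,Tm$ and an invertible natural transformation $i:m\eta_A\to\mathrm{id}$ such that, up to the above coherence isomorphisms, $im\circ a\eta_{TA}=\mathrm{id}_m$, $m(Ti)\circ a(T\eta_A)=\mathrm{id}_m$ and $m(Ta)\circ a(T\mu_A)=a(T^2m)\circ a\mu_{TA}$. A lax morphism $(A,m,a,i)\to(B,m',a',i')$ is a functor $F:A\to B$ with a natural transformation $\varphi:Fm\to m'\,TF$ such that $i'F\circ\varphi\eta_A=Fi$ and $a'(T^2F)\circ\varphi\mu_A=m'(T\varphi)\circ\varphi(Tm)\circ Fa$; a colax morphism is a functor with $\varphi:m'\,TF\to Fm$ satisfying the dual equations $Fi\circ\varphi\eta_A=i'F$ and $Fa\circ\varphi\mu_A=\varphi(Tm)\circ m'(T\varphi)\circ a'(T^2F)$; a pseudo-morphism is a lax morphism with $\varphi$ invertible. A $2$-cell $(F,\varphi)\to(G,\psi)$ of lax (or pseudo-) morphisms is a natural transformation $\alpha:F\to G$ with $m'(T\alpha)\circ\varphi=\psi\circ\alpha m$; for colax morphisms the condition is $\alpha m\circ\varphi=\psi\circ m'(T\alpha)$. **Theorem.** Let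 $(m,a,i)$ be a normal colax $T$-algebra structure on a category $A$. The functors $\int_X M_x\,d\mu=m(X,\mu,M)$, the composites $$\Delta_{\mu,\nu_\bullet}:\int_X M_x\,d\Big(\int_S\nu_s\,d\mu\Big)\xrightarrow{\,m(\pi)\,}m\Big(S\times X,\int_S\iota_s\nu_s\,d\mu,(M_x)_{(s,x)}\Big)\xrightarrow{\ a\ }\int_S\Big(\int_X M_x\,d\nu_s\Big)d\mu,$$ with $\pi:S\times X\to X$ the projection, and $$\epsilon_{X,x_0}:\int_X M_x\,d\delta_{x_0}\xrightarrow{\,m(*\mapsto x_0)\,}m(*,*,M_{x_0})\xrightarrow{\ i\ }M_{x_0}$$ form an ultrastructure on $A$, and this defines a bijection between the normal colax $T$-algebra structures on $A$ and the ultrastructures on $A$. If $(F,\varphi)$ is a lax (respectively colax) morphism, then the components $\sigma_\mu=\varphi_{(X,\mu,M)}$ make $F$ a left (respectively right) ultrafunctor between the associated ultracategories, and an ultrafunctor if $(F,\varphi)$ is a pseudo-morphism. Together with the bijection above, and with the identity on underlying categories, functors and natural transformations, these assignments define three strict functors of bicategories that are bijective on $0$-cells, $1$-cells and $2$-cells,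 that is, isomorphisms (in particular equivalences) of bicategories between 1. normal colax $T$-algebras, lax morphisms and their $2$-cells, and ultracategories, left ultrafunctors and their natural transformations; 2. normal colax $T$-algebras, colax morphisms and their $2$-cells, and ultracategories, right ultrafunctors and their natural transformations; 3. normal colax $T$-algebras, pseudo-morphisms and their $2$-cells, and ultracategories, ultrafunctors and their natural transformations. -/

import Mathlib

set_option linter.unusedVariables false
set_option linter.checkUnivs false

open CategoryTheory

universe w v u v' u' v'' u''

/-- An object of the ultracompletion `T A` of a category `A`: a family of objects of `A` indexed by
a set, together with an ultrafilter on the index set. -/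
structure UltraFamily (A : Type u) : Type (max (w + 1) u) where
  idx : Type w
  uf : Ultrafilter idx
  fam : idx → A

namespace UltraFamily

section Hom

variable {A : Type u} [Category.{v} A]

/-- A representative of a morphism `X ⟶ Y` of `T A`: a function `fn` to `X.idx`, defined on a subset
`dom` of `Y.idx` which belongs to `Y.uf`, such that `X.uf` is the image under `fn` of the restriction
of `Y.uf` to `dom`, and morphisms `X.fam (fn y) ⟶ Y.fam y` for `y` in `dom`. -/
structure PreHom (X Y : UltraFamily.{w} A) : Type (max w v) where
  dom : Set Y.idx
  dom_mem : dom ∈ Y.uf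
  fn : ∀ y ∈ dom, X.idx
  map_eq : ∀ U : Set X.idx, U ∈ X.uf ↔ {y | ∃ h : y ∈ dom, fn y h ∈ U} ∈ Y.uf
  hom : ∀ (y : Y.idx) (h : y ∈ dom), X.fam (fn y h) ⟶ Y.fam y

namespace PreHom

variable {X Y Z W : UltraFamily.{w} A}

/-- The value of a representative at `y`: an index `x` and a morphism `X.fam x ⟶ Y.fam y`. -/
def leg (f : PreHom X Y) (y : Y.idx) (h : y ∈ f.dom) : Σ x : X.idx, (X.fam x ⟶ Y.fam y) :=
  ⟨f.fn y h, f.hom y h⟩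

/-- Two representatives are identified if they agree on a set belonging to `Y.uf`. -/
def Rel (f g : PreHom X Y) : Prop :=
  ∀ᶠ y in (Y.uf : Filter Y.idx), ∃ (h : y ∈ f.dom) (h' : y ∈ g.dom), f.leg y h = g.leg y h'

theorem Rel.refl (f : PreHom X Y) : Rel f f :=
  Filter.mem_of_superset f.dom_mem fun _ h => ⟨h, h, rfl⟩

theorem Rel.symm {f g : PreHom X Y} (r : Rel f g) : Rel g f :=
  Filter.Eventually.mono r fun _ ⟨h, h', e⟩ => ⟨h', h, e.symm⟩

theorem Rel.trans {f g k : PreHom X Y} (r : Rel f g) (s : Rel g k) : Rel f k := by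
  filter_upwards [r, s] with y ⟨h, _, e⟩ ⟨_, h', e'⟩
  exact ⟨h, h', e.trans e'⟩

instance setoid (X Y : UltraFamily.{w} A) : Setoid (PreHom X Y) where
  r := Rel
  iseqv := ⟨Rel.refl, Rel.symm, Rel.trans⟩

/-- The total representative given by a function `f` on the whole index set. -/
def ofMap (f : Y.idx → X.idx) (hf : Y.uf.map f = X.uf) (g : ∀ y, X.fam (f y) ⟶ Y.fam y) :
    PreHom X Y where
  dom := Set.univ
  dom_mem := Filter.univ_mem
  fn y _ := f y
  map_eq U := by
    rw [← hf, Ultrafilter.mem_map]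
    have : {y | ∃ _ : y ∈ Set.univ, f y ∈ U} = f ⁻¹' U := by ext; simp
    rw [this]
  hom y _ := g y

/-- Composition of legs. -/
def compLeg {z : Z.idx} (l : Σ y : Y.idx, (Y.fam y ⟶ Z.fam z))
    (k : Σ x : X.idx, (X.fam x ⟶ Y.fam l.1)) : Σ x : X.idx, (X.fam x ⟶ Z.fam z) :=
  ⟨k.1, k.2 ≫ l.2⟩

/-- Composition of representatives, defined wherever it makes sense. -/
def comp (f : PreHom X Y) (g : PreHom Y Z) : PreHom X Z where
  dom := {z | ∃ h : z ∈ g.dom, g.fn z h ∈ f.dom}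
  dom_mem := (g.map_eq f.dom).1 f.dom_mem
  fn z h := f.fn (g.fn z h.1) h.2
  map_eq U := by
    rw [f.map_eq, g.map_eq]
    have : {z | ∃ h : z ∈ g.dom, g.fn z h ∈ {y | ∃ h : y ∈ f.dom, f.fn y h ∈ U}} =
        {z | ∃ h : z ∈ {z | ∃ h : z ∈ g.dom, g.fn z h ∈ f.dom}, f.fn (g.fn z h.1) h.2 ∈ U} := by
      ext z
      exact ⟨fun ⟨h, h', h''⟩ => ⟨⟨h, h'⟩, h''⟩, fun ⟨⟨h, h'⟩, h''⟩ => ⟨h, h', h''⟩⟩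
    rw [this]
  hom z h := f.hom (g.fn z h.1) h.2 ≫ g.hom z h.1

theorem comp_rel {f f' : PreHom X Y} {g g' : PreHom Y Z} (r : Rel f f') (s : Rel g g') :
    Rel (comp f g) (comp f' g') := by
  have r' := (g.map_eq _).1 r
  filter_upwards [r', s] with z ⟨h, hf, hf', e⟩ ⟨_, h', e'⟩
  have key : ∀ (l l' : Σ y : Y.idx, (Y.fam y ⟶ Z.fam z)) (_ : l = l')
      (a : l.1 ∈ f.dom) (a' : l.1 ∈ f'.dom) (_ : f.leg l.1 a = f'.leg l.1 a'),
      ∃ a'' : l'.1 ∈ f'.dom, compLeg l (f.leg l.1 a) = compLeg l' (f'.leg l'.1 a'') := by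
    rintro l _ rfl a a' e
    exact ⟨a', by rw [e]⟩
  obtain ⟨a'', e''⟩ := key _ _ e' hf hf' e
  exact ⟨⟨h, hf⟩, ⟨h', a''⟩, e''⟩

end PreHom

instance : Category.{max w v} (UltraFamily.{w} A) where
  Hom X Y := Quotient (PreHom.setoid X Y)
  id X := Quotient.mk _ (PreHom.ofMap id (Ultrafilter.map_id _) fun _ => 𝟙 _)
  comp f g := Quotient.map₂ PreHom.comp (fun _ _ r _ _ s => PreHom.comp_rel r s) f g
  id_comp f := by
    induction f using Quotient.inductionOn with | _ f
    refine Quotient.sound (Filter.mem_of_superset f.dom_mem fun y h => ⟨⟨h, trivial⟩, h, ?_⟩)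
    exact congrArg (Sigma.mk _) (Category.id_comp _)
  comp_id f := by
    induction f using Quotient.inductionOn with | _ f
    refine Quotient.sound (Filter.mem_of_superset f.dom_mem fun y h => ⟨⟨trivial, h⟩, h, ?_⟩)
    exact congrArg (Sigma.mk _) (Category.comp_id _)
  assoc f g k := by
    induction f using Quotient.inductionOn with | _ f
    induction g using Quotient.inductionOn with | _ g
    induction k using Quotient.inductionOn with | _ k
    refine Quotient.sound (Filter.mem_of_superset (PreHom.comp (PreHom.comp f g) k).dom_mem
      fun y h => ⟨h, ⟨⟨h.1, h.2.1⟩, h.2.2⟩, ?_⟩)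
    exact congrArg (Sigma.mk _) (Category.assoc _ _ _)

/-- The class of a representative. -/
def PreHom.toHom {X Y : UltraFamily.{w} A} (f : PreHom X Y) : X ⟶ Y :=
  Quotient.mk (PreHom.setoid X Y) f

theorem PreHom.toHom_eq {X Y : UltraFamily.{w} A} {f g : PreHom X Y} (r : Rel f g) :
    f.toHom = g.toHom :=
  Quotient.sound r

theorem PreHom.rel_of_toHom_eq {X Y : UltraFamily.{w} A} {f g : PreHom X Y}
    (h : f.toHom = g.toHom) : Rel f g :=
  Quotient.exact h

theorem PreHom.toHom_comp {X Y Z : UltraFamily.{w} A} (f : PreHom X Y) (g : PreHom Y Z) :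
    f.toHom ≫ g.toHom = (f.comp g).toHom :=
  rfl

/-- A chosen representative of a morphism. -/
noncomputable def rep {X Y : UltraFamily.{w} A} (f : X ⟶ Y) : PreHom X Y :=
  Quotient.out (s := PreHom.setoid X Y) f

theorem toHom_rep {X Y : UltraFamily.{w} A} (f : X ⟶ Y) : (rep f).toHom = f :=
  Quotient.out_eq (s := PreHom.setoid X Y) f

/-- The morphism of `T A` given by a function `f` between the index sets and a family of
morphisms. -/
def homOfMap {X Y : UltraFamily.{w} A} (f : Y.idx → X.idx) (hf : Y.uf.map f = X.uf)
    (g : ∀ y, X.fam (f y) ⟶ Y.fam y) : X ⟶ Y :=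
  (PreHom.ofMap f hf g).toHom

theorem homOfMap_comp {X Y Z : UltraFamily.{w} A} (f : Y.idx → X.idx) (hf : Y.uf.map f = X.uf)
    (g : ∀ y, X.fam (f y) ⟶ Y.fam y) (f' : Z.idx → Y.idx) (hf' : Z.uf.map f' = Y.uf)
    (g' : ∀ z, Y.fam (f' z) ⟶ Z.fam z) :
    homOfMap f hf g ≫ homOfMap f' hf' g' =
      homOfMap (f ∘ f') (by rw [← Ultrafilter.map_map, hf', hf]) fun z => g (f' z) ≫ g' z :=
  PreHom.toHom_eq (Filter.univ_mem' fun _ => ⟨⟨trivial, trivial⟩, trivial, rfl⟩)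

theorem homOfMap_id (X : UltraFamily.{w} A) :
    homOfMap id (Ultrafilter.map_id X.uf) (fun x => 𝟙 (X.fam x)) = 𝟙 X :=
  rfl

end Hom

section Functoriality

variable {A : Type u} [Category.{v} A] {B : Type u'} [Category.{v'} B]

/-- The action of a functor on representatives. -/
def PreHom.mapFunctor (F : A ⥤ B) {X Y : UltraFamily.{w} A} (f : PreHom X Y) :
    PreHom (⟨X.idx, X.uf, fun x => F.obj (X.fam x)⟩ : UltraFamily.{w} B)
      ⟨Y.idx, Y.uf, fun y => F.obj (Y.fam y)⟩ where
  dom := f.dom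
  dom_mem := f.dom_mem
  fn := f.fn
  map_eq := f.map_eq
  hom y h := F.map (f.hom y h)

/-- The functor `T F : T A ⥤ T B` induced by a functor `F : A ⥤ B`. -/
def map (F : A ⥤ B) : UltraFamily.{w} A ⥤ UltraFamily.{w} B where
  obj X := ⟨X.idx, X.uf, fun x => F.obj (X.fam x)⟩
  map {X Y} f := Quotient.map (sa := PreHom.setoid X Y) (PreHom.mapFunctor F) (by
    intro f g r
    refine Filter.Eventually.mono r fun y ⟨h, h', e⟩ => ⟨h, h', ?_⟩
    exact congrArg (fun l : Σ x : X.idx, (X.fam x ⟶ Y.fam y) =>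
      (⟨l.1, F.map l.2⟩ : Σ x : X.idx, (F.obj (X.fam x) ⟶ F.obj (Y.fam y)))) e) f
  map_id X := PreHom.toHom_eq (Filter.univ_mem' fun _ =>
    ⟨trivial, trivial, congrArg (Sigma.mk _) (F.map_id _)⟩)
  map_comp {X Y Z} f g := by
    induction f using Quotient.inductionOn with | _ f
    induction g using Quotient.inductionOn with | _ g
    refine Quotient.sound (Filter.mem_of_superset (PreHom.comp f g).dom_mem fun y h =>
      ⟨h, h, ?_⟩)
    exact congrArg (Sigma.mk _) (F.map_comp _ _)

theorem map_homOfMap (F : A ⥤ B) {X Y : UltraFamily.{w} A} (f : Y.idx → X.idx)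
    (hf : Y.uf.map f = X.uf) (g : ∀ y, X.fam (f y) ⟶ Y.fam y) :
    (map F).map (homOfMap f hf g) =
      homOfMap (X := (map F).obj X) (Y := (map F).obj Y) f hf fun y => F.map (g y) :=
  rfl

/-- The natural transformation `T ω : T F ⟶ T G` induced by `ω : F ⟶ G`. -/
def map₂ {F G : A ⥤ B} (ω : F ⟶ G) : map.{w} F ⟶ map.{w} G where
  app X := homOfMap (X := (map F).obj X) (Y := (map G).obj X) id (Ultrafilter.map_id _)
    fun x => ω.app (X.fam x)
  naturality X Y f := by
    induction f using Quotient.inductionOn with | _ f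
    refine Quotient.sound (Filter.mem_of_superset f.dom_mem fun y h =>
      ⟨⟨trivial, h⟩, ⟨h, trivial⟩, ?_⟩)
    exact congrArg (Sigma.mk _) (ω.naturality _)

end Functoriality

section Monad

variable (A : Type u) [Category.{v} A]

/-- The unit `A ⥤ T A` of the ultracompletion: one-point families. -/
def unit : A ⥤ UltraFamily.{w} A where
  obj M := ⟨PUnit, pure PUnit.unit, fun _ => M⟩
  map f := homOfMap id (Ultrafilter.map_id _) fun _ => f
  map_id _ := rfl
  map_comp _ _ := PreHom.toHom_eq (Filter.univ_mem' fun _ => ⟨trivial, ⟨trivial, trivial⟩, rfl⟩)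

variable {A}

/-- The ultrafilter `∫ ι_s ν_s dμ` on `∐ T_s`. -/
def sigmaUf {S : Type w} {T : S → Type w} (μ : Ultrafilter S) (ν : ∀ s, Ultrafilter (T s)) :
    Ultrafilter (Σ s, T s) :=
  μ.bind fun s => (ν s).map (Sigma.mk s)

theorem mem_bind_iff {S T : Type w} (μ : Ultrafilter S) (ν : S → Ultrafilter T) (U : Set T) :
    U ∈ μ.bind ν ↔ {s | U ∈ ν s} ∈ μ :=
  Iff.rfl

theorem mem_sigmaUf_iff {S : Type w} {T : S → Type w} (μ : Ultrafilter S)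
    (ν : ∀ s, Ultrafilter (T s)) (U : Set (Σ s, T s)) :
    U ∈ sigmaUf μ ν ↔ {s | {t | (⟨s, t⟩ : Σ s, T s) ∈ U} ∈ ν s} ∈ μ :=
  Iff.rfl

/-- The multiplication on objects: a family of families is sent to the family indexed by the
disjoint union. -/
abbrev multObj (X : UltraFamily.{w} (UltraFamily.{w} A)) : UltraFamily.{w} A where
  idx := Σ s : X.idx, (X.fam s).idx
  uf := sigmaUf X.uf fun s => (X.fam s).uf
  fam p := (X.fam p.1).fam p.2

/-- The leg over `⟨y, x⟩` of the image of a representative, in terms of the leg over `y` of the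
representative and of the value at `x` of a representative of the second component of that leg. -/
def multLeg {X Y : UltraFamily.{w} (UltraFamily.{w} A)} {y : Y.idx}
    (s : X.idx) (k : PreHom (X.fam s) (Y.fam y)) (x : (Y.fam y).idx) (h : x ∈ k.dom) :
    Σ p : (multObj X).idx, ((multObj X).fam p ⟶ (multObj Y).fam ⟨y, x⟩) :=
  ⟨⟨s, k.fn x h⟩, k.hom x h⟩

/-- The multiplication on representatives, given a choice of representatives for the second
components. -/
def multPre {X Y : UltraFamily.{w} (UltraFamily.{w} A)} (f : PreHom X Y)
    (k : ∀ (y : Y.idx) (h : y ∈ f.dom), PreHom (X.fam (f.fn y h)) (Y.fam y)) :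
    PreHom (multObj X) (multObj Y) where
  dom := {p | ∃ h : p.1 ∈ f.dom, p.2 ∈ (k p.1 h).dom}
  dom_mem := (mem_sigmaUf_iff _ _ _).2 (Filter.mem_of_superset f.dom_mem fun y h =>
    Filter.mem_of_superset (k y h).dom_mem fun x hx => ⟨h, hx⟩)
  fn p h := ⟨f.fn p.1 h.1, (k p.1 h.1).fn p.2 h.2⟩
  map_eq U := by
    refine (mem_sigmaUf_iff _ _ _).trans (((f.map_eq _).trans ?_).trans
      (mem_sigmaUf_iff _ _ _).symm)
    have hd : ∀ {E E' : Set Y.idx}, (∀ y (_ : y ∈ f.dom), y ∈ E ↔ y ∈ E') →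
        (E ∈ Y.uf ↔ E' ∈ Y.uf) := fun he =>
      ⟨fun h => by filter_upwards [h, f.dom_mem] with y a b using (he y b).1 a,
        fun h => by filter_upwards [h, f.dom_mem] with y a b using (he y b).2 a⟩
    refine hd fun y hy => ?_
    change (∃ _, _ ∈ (X.fam _).uf) ↔ _ ∈ (Y.fam y).uf
    rw [exists_prop_of_true hy, (k y hy).map_eq]
    refine iff_of_eq (congrArg (· ∈ (Y.fam y).uf) ?_)
    ext x
    exact ⟨fun ⟨h, h'⟩ => ⟨⟨hy, h⟩, h'⟩, fun ⟨⟨_, h⟩, h'⟩ => ⟨h, h'⟩⟩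
  hom p h := (k p.1 h.1).hom p.2 h.2

theorem multPre_rel {X Y : UltraFamily.{w} (UltraFamily.{w} A)} {f g : PreHom X Y}
    (k : ∀ (y : Y.idx) (h : y ∈ f.dom), PreHom (X.fam (f.fn y h)) (Y.fam y))
    (l : ∀ (y : Y.idx) (h : y ∈ g.dom), PreHom (X.fam (g.fn y h)) (Y.fam y))
    (hk : ∀ y h, (k y h).toHom = f.hom y h) (hl : ∀ y h, (l y h).toHom = g.hom y h)
    (r : PreHom.Rel f g) : PreHom.Rel (multPre f k) (multPre g l) := by
  refine (mem_sigmaUf_iff _ _ _).2 (Filter.Eventually.mono r fun y ⟨h, h', e⟩ => ?_)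
  have key : ∀ (a b : Σ s : X.idx, (X.fam s ⟶ Y.fam y)) (_ : a = b)
      (k : PreHom (X.fam a.1) (Y.fam y)) (l : PreHom (X.fam b.1) (Y.fam y))
      (_ : k.toHom = a.2) (_ : l.toHom = b.2),
      ∀ᶠ x in ((Y.fam y).uf : Filter _), ∃ (h : x ∈ k.dom) (h' : x ∈ l.dom),
        multLeg a.1 k x h = multLeg b.1 l x h' := by
    rintro a _ rfl k l hk hl
    refine Filter.Eventually.mono (PreHom.rel_of_toHom_eq (hk.trans hl.symm))
      fun x ⟨h, h', e⟩ => ⟨h, h', ?_⟩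
    exact congrArg (fun q : Σ t : (X.fam a.1).idx, ((X.fam a.1).fam t ⟶ (Y.fam y).fam x) =>
      (⟨⟨a.1, q.1⟩, q.2⟩ :
        Σ p : (multObj X).idx, ((multObj X).fam p ⟶ (multObj Y).fam ⟨y, x⟩))) e
  refine Filter.Eventually.mono (key _ _ e (k y h) (l y h') (hk y h) (hl y h'))
    fun x ⟨hx, hx', e'⟩ => ⟨⟨h, hx⟩, ⟨h', hx'⟩, e'⟩

/-- The multiplication on morphisms. It does not depend on the chosen representatives of the second
components. -/
noncomputable def multMap {X Y : UltraFamily.{w} (UltraFamily.{w} A)} (f : X ⟶ Y) :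
    multObj X ⟶ multObj Y :=
  Quotient.lift (s := PreHom.setoid X Y)
    (fun f => (multPre f fun y h => rep (f.hom y h)).toHom)
    (fun _ _ r => PreHom.toHom_eq
      (multPre_rel _ _ (fun _ _ => toHom_rep _) (fun _ _ => toHom_rep _) r)) f

theorem multMap_toHom {X Y : UltraFamily.{w} (UltraFamily.{w} A)} (f : PreHom X Y)
    (k : ∀ (y : Y.idx) (h : y ∈ f.dom), PreHom (X.fam (f.fn y h)) (Y.fam y))
    (hk : ∀ y h, (k y h).toHom = f.hom y h) : multMap f.toHom = (multPre f k).toHom :=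
  PreHom.toHom_eq (multPre_rel _ _ (fun _ _ => toHom_rep _) hk (PreHom.Rel.refl f))

theorem multMap_homOfMap {X Y : UltraFamily.{w} (UltraFamily.{w} A)} (f : Y.idx → X.idx)
    (hf : Y.uf.map f = X.uf) (f' : ∀ y, (Y.fam y).idx → (X.fam (f y)).idx)
    (hf' : ∀ y, (Y.fam y).uf.map (f' y) = (X.fam (f y)).uf)
    (hF : (multObj Y).uf.map (fun p => (⟨f p.1, f' p.1 p.2⟩ : (multObj X).idx)) = (multObj X).uf)
    (g : ∀ y x, (X.fam (f y)).fam (f' y x) ⟶ (Y.fam y).fam x) :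
    multMap (homOfMap f hf fun y => homOfMap (f' y) (hf' y) (g y)) =
      homOfMap (X := multObj X) (Y := multObj Y)
        (fun p => ⟨f p.1, f' p.1 p.2⟩) hF fun p => g p.1 p.2 := by
  refine (multMap_toHom _ (fun y _ => PreHom.ofMap (f' y) (hf' y) (g y)) fun _ _ => rfl).trans ?_
  exact PreHom.toHom_eq (Filter.univ_mem' fun p => ⟨⟨trivial, trivial⟩, trivial, rfl⟩)

variable (A) in
/-- The multiplication `T T A ⥤ T A` of the ultracompletion. -/
noncomputable def mult : UltraFamily.{w} (UltraFamily.{w} A) ⥤ UltraFamily.{w} A where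
  obj := multObj
  map := multMap
  map_id X := (multMap_toHom _ (fun y _ => PreHom.ofMap id (Ultrafilter.map_id _) fun _ => 𝟙 _)
    fun _ _ => rfl).trans
      (PreHom.toHom_eq (Filter.univ_mem' fun _ => ⟨⟨trivial, trivial⟩, trivial, rfl⟩))
  map_comp {X Y Z} f g := by
    induction f using Quotient.inductionOn with | _ f
    induction g using Quotient.inductionOn with | _ g
    change multMap (PreHom.comp f g).toHom =
      PreHom.toHom _ ≫ PreHom.toHom _
    rw [PreHom.toHom_comp, multMap_toHom (PreHom.comp f g)
      (fun z h => PreHom.comp (rep (f.hom (g.fn z h.1) h.2)) (rep (g.hom z h.1)))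
      (fun z h => congrArg₂ (· ≫ ·) (toHom_rep (f.hom (g.fn z h.1) h.2))
        (toHom_rep (g.hom z h.1)))]
    refine PreHom.toHom_eq (Filter.mem_of_superset (multPre (PreHom.comp f g) _).dom_mem
      fun p h => ⟨h, ⟨⟨h.1.1, h.2.1⟩, ⟨h.1.2, h.2.2⟩⟩, rfl⟩)


theorem map_snd_sigmaUf {S X : Type w} (μ : Ultrafilter S) (ν : S → Ultrafilter X) :
    (sigmaUf μ ν).map (fun p => p.2) = μ.bind ν :=
  rfl

theorem map_fst_sigmaUf {S : Type w} {T : S → Type w} (μ : Ultrafilter S)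
    (ν : ∀ s, Ultrafilter (T s)) : (sigmaUf μ ν).map Sigma.fst = μ := by
  refine Ultrafilter.ext fun U => ?_
  rw [Ultrafilter.mem_map, mem_sigmaUf_iff]
  have h : {s | {t : T s | (⟨s, t⟩ : Σ s, T s) ∈ Sigma.fst ⁻¹' U} ∈ ν s} = U := by
    ext s
    by_cases hs : s ∈ U
    · have : {t : T s | (⟨s, t⟩ : Σ s, T s) ∈ Sigma.fst ⁻¹' U} = Set.univ := by ext; simpa
      simp only [Set.mem_ofPred_eq, this, hs, iff_true]
      exact Filter.univ_mem
    · have : {t : T s | (⟨s, t⟩ : Σ s, T s) ∈ Sigma.fst ⁻¹' U} = ∅ := by ext; simpa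
      simp only [Set.mem_ofPred_eq, this, hs, iff_false]
      exact Ultrafilter.empty_notMem
  rw [h]

theorem bind_pure_left {S X : Type w} (s : S) (ν : S → Ultrafilter X) :
    ν s = (pure s : Ultrafilter S).bind ν :=
  rfl

theorem bind_bind {R S T : Type w} (l : Ultrafilter R) (μ : R → Ultrafilter S)
    (ν : S → Ultrafilter T) : (l.bind μ).bind ν = l.bind fun r => (μ r).bind ν :=
  rfl

/-- The coherence isomorphism `id ≅ μ_A ∘ η_{T A}`, given by the bijection `∐_{*} X ≃ X`. -/
noncomputable def leftUnit : 𝟭 (UltraFamily.{w} A) ≅ unit (UltraFamily.{w} A) ⋙ mult A :=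
  NatIso.ofComponents
    (fun X =>
      { hom := homOfMap (Y := multObj ((unit _).obj X)) (fun p => p.2) rfl fun _ => 𝟙 _
        inv := homOfMap (X := multObj ((unit _).obj X)) (fun x => ⟨PUnit.unit, x⟩) rfl fun _ => 𝟙 _
        hom_inv_id := PreHom.toHom_eq (Filter.univ_mem' fun _ =>
          ⟨⟨trivial, trivial⟩, trivial, congrArg (Sigma.mk _) (Category.comp_id _)⟩)
        inv_hom_id := PreHom.toHom_eq (Filter.univ_mem' fun _ =>
          ⟨⟨trivial, trivial⟩, trivial, congrArg (Sigma.mk _) (Category.comp_id _)⟩) })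
    (fun {X Y} f => by
      induction f using Quotient.inductionOn with | _ f
      let u : PreHom ((unit (UltraFamily.{w} A)).obj X) ((unit (UltraFamily.{w} A)).obj Y) :=
        PreHom.ofMap id (Ultrafilter.map_id _) fun _ => f.toHom
      have h : multMap ((unit (UltraFamily.{w} A)).map f.toHom) =
          (multPre u fun _ _ => f).toHom :=
        multMap_toHom u (fun _ _ => f) fun _ _ => rfl
      refine Eq.trans ?_ (congrArg (_ ≫ ·) h).symm
      refine PreHom.toHom_eq (Filter.mem_of_superset (multPre u fun _ _ => f).dom_mem
        fun p h => ⟨⟨trivial, h.2⟩, ⟨h, trivial⟩, ?_⟩)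
      exact congrArg (Sigma.mk _) ((Category.comp_id _).trans (Category.id_comp _).symm))

/-- The coherence isomorphism `id ≅ μ_A ∘ T η_A`, given by the bijection `∐_{x ∈ X} * ≃ X`. -/
noncomputable def rightUnit : 𝟭 (UltraFamily.{w} A) ≅ map (unit A) ⋙ mult A :=
  NatIso.ofComponents
    (fun X =>
      { hom := homOfMap (Y := multObj ((map (unit A)).obj X)) (fun p => p.1)
          (map_fst_sigmaUf _ _) fun _ => 𝟙 _
        inv := homOfMap (X := multObj ((map (unit A)).obj X)) (fun x => ⟨x, PUnit.unit⟩)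
          rfl fun _ => 𝟙 _
        hom_inv_id := PreHom.toHom_eq (Filter.univ_mem' fun _ =>
          ⟨⟨trivial, trivial⟩, trivial, congrArg (Sigma.mk _) (Category.comp_id _)⟩)
        inv_hom_id := PreHom.toHom_eq (Filter.univ_mem' fun _ =>
          ⟨⟨trivial, trivial⟩, trivial, congrArg (Sigma.mk _) (Category.comp_id _)⟩) })
    (fun {X Y} f => by
      induction f using Quotient.inductionOn with | _ f
      refine Eq.trans ?_ (congrArg (_ ≫ ·) (multMap_toHom (f.mapFunctor (unit A))
        (fun y h => PreHom.ofMap id (Ultrafilter.map_id _) fun _ => f.hom y h)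
          fun _ _ => rfl)).symm
      refine PreHom.toHom_eq (Filter.mem_of_superset (multPre (f.mapFunctor (unit A))
        fun y h => PreHom.ofMap id (Ultrafilter.map_id _) fun _ => f.hom y h).dom_mem
          fun p h => ⟨⟨trivial, h.1⟩, ⟨h, trivial⟩, ?_⟩)
      exact congrArg (Sigma.mk _) ((Category.comp_id _).trans (Category.id_comp _).symm))

/-- The coherence isomorphism `μ_A ∘ μ_{T A} ≅ μ_A ∘ T μ_A`, given by the bijection
`∐_r ∐_{s ∈ S_r} T_{(r,s)} ≃ ∐_{(r,s)} T_{(r,s)}`. -/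
noncomputable def multAssoc : mult (UltraFamily.{w} A) ⋙ mult A ≅ map (mult A) ⋙ mult A :=
  NatIso.ofComponents
    (fun X =>
      { hom := homOfMap (X := multObj (multObj X)) (Y := multObj ((map (mult A)).obj X))
          (fun p => ⟨⟨p.1, p.2.1⟩, p.2.2⟩) rfl fun _ => 𝟙 _
        inv := homOfMap (X := multObj ((map (mult A)).obj X)) (Y := multObj (multObj X))
          (fun p => ⟨p.1.1, ⟨p.1.2, p.2⟩⟩) rfl fun _ => 𝟙 _
        hom_inv_id := PreHom.toHom_eq (Filter.univ_mem' fun _ =>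
          ⟨⟨trivial, trivial⟩, trivial, congrArg (Sigma.mk _) (Category.comp_id _)⟩)
        inv_hom_id := PreHom.toHom_eq (Filter.univ_mem' fun _ =>
          ⟨⟨trivial, trivial⟩, trivial, congrArg (Sigma.mk _) (Category.comp_id _)⟩) })
    (fun {X Y} f => by
      induction f using Quotient.inductionOn with | _ f
      let k := fun y h => rep (f.hom y h)
      let l := fun (y : Y.idx) (h : y ∈ f.dom) (x : (Y.fam y).idx) (h' : x ∈ (k y h).dom) =>
        rep ((k y h).hom x h')
      have h₁ : multMap (multMap (PreHom.toHom f)) =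
          (multPre (multPre f k) fun p h => l p.1 h.1 p.2 h.2).toHom :=
        (congrArg multMap (multMap_toHom f k fun _ _ => toHom_rep _)).trans
          (multMap_toHom _ _ fun _ _ => toHom_rep _)
      have h₂ : multMap ((map (mult A)).map (PreHom.toHom f)) =
          (multPre (f.mapFunctor (mult A)) fun y h => multPre (k y h) (l y h)).toHom :=
        multMap_toHom (f.mapFunctor (mult A)) _ fun y h =>
          (multMap_toHom (k y h) (l y h) fun _ _ => toHom_rep _).symm.trans
            (congrArg multMap (toHom_rep (f.hom y h)))
      refine (congrArg (· ≫ _) h₁).trans (Eq.trans ?_ (congrArg (_ ≫ ·) h₂).symm)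
      refine PreHom.toHom_eq (Filter.mem_of_superset (multPre (f.mapFunctor (mult A))
        fun y h => multPre (k y h) (l y h)).dom_mem
          fun p h => ⟨⟨trivial, ⟨⟨h.1, h.2.1⟩, h.2.2⟩⟩, ⟨h, trivial⟩, ?_⟩)
      exact congrArg (Sigma.mk _) ((Category.comp_id _).trans (Category.id_comp _).symm))

end Monad
end UltraFamily

/-! ### Bicategories of categories with structure -/

/-- A notion of structure on categories (`Str`), on functors between categories with structure
(`Hom`), and of compatibility of natural transformations with the structures on functors (`Hom₂`),
closed under the operations of the 2-category of categories. -/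
structure CatStructure where
  Str : ∀ (A : Type u) [Category.{v} A], Type u'
  Hom : ∀ {A B : Type u} [Category.{v} A] [Category.{v} B], Str A → Str B → (A ⥤ B) → Type v'
  Hom₂ : ∀ {A B : Type u} [Category.{v} A] [Category.{v} B] {S : Str A} {S' : Str B}
    {F G : A ⥤ B}, Hom S S' F → Hom S S' G → (F ⟶ G) → Prop
  id : ∀ {A : Type u} [Category.{v} A] (S : Str A), Hom S S (𝟭 A)
  comp : ∀ {A B C : Type u} [Category.{v} A] [Category.{v} B] [Category.{v} C] {S : Str A}
    {S' : Str B} {S'' : Str C} {F : A ⥤ B} {G : B ⥤ C},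
    Hom S S' F → Hom S' S'' G → Hom S S'' (F ⋙ G)
  id₂ : ∀ {A B : Type u} [Category.{v} A] [Category.{v} B] {S : Str A} {S' : Str B}
    {F : A ⥤ B} (φ : Hom S S' F), Hom₂ φ φ (𝟙 F)
  comp₂ : ∀ {A B : Type u} [Category.{v} A] [Category.{v} B] {S : Str A} {S' : Str B}
    {F G H : A ⥤ B} {φ : Hom S S' F} {ψ : Hom S S' G} {χ : Hom S S' H} {α : F ⟶ G} {β : G ⟶ H},
    Hom₂ φ ψ α → Hom₂ ψ χ β → Hom₂ φ χ (α ≫ β)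
  whiskerLeft : ∀ {A B C : Type u} [Category.{v} A] [Category.{v} B] [Category.{v} C] {S : Str A}
    {S' : Str B} {S'' : Str C} {F : A ⥤ B} {G H : B ⥤ C} (φ : Hom S S' F) {ψ : Hom S' S'' G}
    {χ : Hom S' S'' H} {α : G ⟶ H},
    Hom₂ ψ χ α → Hom₂ (comp φ ψ) (comp φ χ) (Functor.whiskerLeft F α)
  whiskerRight : ∀ {A B C : Type u} [Category.{v} A] [Category.{v} B] [Category.{v} C] {S : Str A}
    {S' : Str B} {S'' : Str C} {F G : A ⥤ B} {H : B ⥤ C} {φ : Hom S S' F} {ψ : Hom S S' G}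
    (χ : Hom S' S'' H) {α : F ⟶ G},
    Hom₂ φ ψ α → Hom₂ (comp φ χ) (comp ψ χ) (Functor.whiskerRight α H)
  associator : ∀ {A B C D : Type u} [Category.{v} A] [Category.{v} B] [Category.{v} C]
    [Category.{v} D] {S : Str A} {S' : Str B} {S'' : Str C} {S''' : Str D} {F : A ⥤ B} {G : B ⥤ C}
    {H : C ⥤ D} (φ : Hom S S' F) (ψ : Hom S' S'' G) (χ : Hom S'' S''' H),
    Hom₂ (comp (comp φ ψ) χ) (comp φ (comp ψ χ)) (Functor.associator F G H).hom
  associator_inv : ∀ {A B C D : Type u} [Category.{v} A] [Category.{v} B] [Category.{v} C]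
    [Category.{v} D] {S : Str A} {S' : Str B} {S'' : Str C} {S''' : Str D} {F : A ⥤ B} {G : B ⥤ C}
    {H : C ⥤ D} (φ : Hom S S' F) (ψ : Hom S' S'' G) (χ : Hom S'' S''' H),
    Hom₂ (comp φ (comp ψ χ)) (comp (comp φ ψ) χ) (Functor.associator F G H).inv
  leftUnitor : ∀ {A B : Type u} [Category.{v} A] [Category.{v} B] {S : Str A} {S' : Str B}
    {F : A ⥤ B} (φ : Hom S S' F), Hom₂ (comp (id S) φ) φ F.leftUnitor.hom
  leftUnitor_inv : ∀ {A B : Type u} [Category.{v} A] [Category.{v} B] {S : Str A} {S' : Str B}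
    {F : A ⥤ B} (φ : Hom S S' F), Hom₂ φ (comp (id S) φ) F.leftUnitor.inv
  rightUnitor : ∀ {A B : Type u} [Category.{v} A] [Category.{v} B] {S : Str A} {S' : Str B}
    {F : A ⥤ B} (φ : Hom S S' F), Hom₂ (comp φ (id S')) φ F.rightUnitor.hom
  rightUnitor_inv : ∀ {A B : Type u} [Category.{v} A] [Category.{v} B] {S : Str A} {S' : Str B}
    {F : A ⥤ B} (φ : Hom S S' F), Hom₂ φ (comp φ (id S')) F.rightUnitor.inv

namespace CatStructure

/-- A category with a structure: the 0-cells of the bicategory. -/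
structure Obj (D : CatStructure.{v, u, v', u'}) where
  carrier : Type u
  [cat : Category.{v} carrier]
  str : D.Str carrier

attribute [instance] Obj.cat

variable {D : CatStructure.{v, u, v', u'}}

/-- A functor with a structure: the 1-cells of the bicategory. -/
structure Cell₁ (X Y : Obj D) where
  functor : X.carrier ⥤ Y.carrier
  str : D.Hom X.str Y.str functor

/-- A compatible natural transformation: the 2-cells of the bicategory. -/
@[ext]
structure Cell₂ {X Y : Obj D} (f g : Cell₁ X Y) where
  natTrans : f.functor ⟶ g.functor
  compat : D.Hom₂ f.str g.str natTrans

instance (X Y : Obj D) : Category (Cell₁ X Y) where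
  Hom f g := Cell₂ f g
  id _ := ⟨𝟙 _, D.id₂ _⟩
  comp α β := ⟨α.natTrans ≫ β.natTrans, D.comp₂ α.compat β.compat⟩
  id_comp α := Cell₂.ext (Category.id_comp α.natTrans)
  comp_id α := Cell₂.ext (Category.comp_id α.natTrans)
  assoc α β γ := Cell₂.ext (Category.assoc α.natTrans β.natTrans γ.natTrans)

instance : CategoryStruct (Obj D) where
  Hom X Y := Cell₁ X Y
  id X := ⟨𝟭 X.carrier, D.id X.str⟩
  comp f g := ⟨f.functor ⋙ g.functor, D.comp f.str g.str⟩

instance homCategory (X Y : Obj D) : Category (X ⟶ Y) :=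
  inferInstanceAs (Category (Cell₁ X Y))

theorem cell₂_ext {X Y : Obj D} {f g : X ⟶ Y} {α β : f ⟶ g}
    (h : ∀ x, α.natTrans.app x = β.natTrans.app x) : α = β :=
  Cell₂.ext (NatTrans.ext (funext h))

/-- The bicategory of categories with structure, functors with structure and compatible natural
transformations. -/
instance : Bicategory (Obj D) where
  homCategory := homCategory
  whiskerLeft f _ _ α := ⟨Functor.whiskerLeft f.functor α.natTrans, D.whiskerLeft f.str α.compat⟩
  whiskerRight α h := ⟨Functor.whiskerRight α.natTrans h.functor, D.whiskerRight h.str α.compat⟩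
  associator f g h :=
    { hom := ⟨(Functor.associator f.functor g.functor h.functor).hom, D.associator _ _ _⟩
      inv := ⟨(Functor.associator f.functor g.functor h.functor).inv, D.associator_inv _ _ _⟩
      hom_inv_id := Cell₂.ext (Iso.hom_inv_id (Functor.associator _ _ _))
      inv_hom_id := Cell₂.ext (Iso.inv_hom_id (Functor.associator _ _ _)) }
  leftUnitor f :=
    { hom := ⟨f.functor.leftUnitor.hom, D.leftUnitor _⟩
      inv := ⟨f.functor.leftUnitor.inv, D.leftUnitor_inv _⟩
      hom_inv_id := Cell₂.ext (Iso.hom_inv_id (Functor.leftUnitor _))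
      inv_hom_id := Cell₂.ext (Iso.inv_hom_id (Functor.leftUnitor _)) }
  rightUnitor f :=
    { hom := ⟨f.functor.rightUnitor.hom, D.rightUnitor _⟩
      inv := ⟨f.functor.rightUnitor.inv, D.rightUnitor_inv _⟩
      hom_inv_id := Cell₂.ext (Iso.hom_inv_id (Functor.rightUnitor _))
      inv_hom_id := Cell₂.ext (Iso.inv_hom_id (Functor.rightUnitor _)) }
  whiskerLeft_id _ _ := cell₂_ext fun _ => rfl
  whiskerLeft_comp _ _ _ _ _ _ := cell₂_ext fun _ => rfl
  id_whiskerLeft α := cell₂_ext fun x =>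
    ((Category.id_comp _).trans (Category.comp_id (α.natTrans.app x))).symm
  comp_whiskerLeft _ _ _ _ α := cell₂_ext fun _ =>
    ((Category.id_comp _).trans (Category.comp_id (α.natTrans.app _))).symm
  id_whiskerRight _ g := cell₂_ext fun _ => g.functor.map_id _
  comp_whiskerRight _ _ i := cell₂_ext fun _ => i.functor.map_comp _ _
  whiskerRight_id α := cell₂_ext fun x =>
    ((Category.id_comp _).trans (Category.comp_id (α.natTrans.app x))).symm
  whiskerRight_comp α g h := cell₂_ext fun x =>
    ((Category.id_comp _).trans (Category.comp_id
      (h.functor.map (g.functor.map (α.natTrans.app x))))).symm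
  whisker_assoc f _ _ α h := cell₂_ext fun x =>
    ((Category.id_comp _).trans (Category.comp_id
      (h.functor.map (α.natTrans.app (f.functor.obj x))))).symm
  whisker_exchange α β := cell₂_ext fun x => (β.natTrans.naturality (α.natTrans.app x)).symm
  pentagon _ _ _ i := cell₂_ext fun _ => by
    refine (congrArg (· ≫ _) (i.functor.map_id _)).trans ?_
    exact (Category.id_comp _)
  triangle f g := cell₂_ext fun _ => by
    exact (Category.id_comp _).trans (g.functor.map_id _).symm

/-- The notion of structure obtained by restricting to those structures on functors which satisfy a
property that is stable under composition. -/
def restrict (D : CatStructure.{v, u, v', u'})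
    (P : ∀ {A B : Type u} [Category.{v} A] [Category.{v} B] {S : D.Str A} {S' : D.Str B}
      {F : A ⥤ B}, D.Hom S S' F → Prop)
    (hid : ∀ {A : Type u} [Category.{v} A] (S : D.Str A), P (D.id S))
    (hcomp : ∀ {A B C : Type u} [Category.{v} A] [Category.{v} B] [Category.{v} C] {S : D.Str A}
      {S' : D.Str B} {S'' : D.Str C} {F : A ⥤ B} {G : B ⥤ C} (φ : D.Hom S S' F)
      (ψ : D.Hom S' S'' G), P φ → P ψ → P (D.comp φ ψ)) : CatStructure.{v, u, v', u'} where
  Str := D.Str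
  Hom S S' F := {φ : D.Hom S S' F // P φ}
  Hom₂ φ ψ α := D.Hom₂ φ.1 ψ.1 α
  id S := ⟨D.id S, hid S⟩
  comp φ ψ := ⟨D.comp φ.1 ψ.1, hcomp φ.1 ψ.1 φ.2 ψ.2⟩
  id₂ φ := D.id₂ φ.1
  comp₂ h k := D.comp₂ h k
  whiskerLeft φ _ _ _ h := D.whiskerLeft φ.1 h
  whiskerRight χ _ h := D.whiskerRight χ.1 h
  associator φ ψ χ := D.associator φ.1 ψ.1 χ.1
  associator_inv φ ψ χ := D.associator_inv φ.1 ψ.1 χ.1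
  leftUnitor φ := D.leftUnitor φ.1
  leftUnitor_inv φ := D.leftUnitor_inv φ.1
  rightUnitor φ := D.rightUnitor φ.1
  rightUnitor_inv φ := D.rightUnitor_inv φ.1

/-- A map of notions of structure, which is the identity on the underlying categories, functors and
natural transformations. -/
structure Map (D : CatStructure.{v, u, v', u'}) (E : CatStructure.{v, u, v'', u''}) where
  str : ∀ {A : Type u} [Category.{v} A], D.Str A → E.Str A
  hom : ∀ {A B : Type u} [Category.{v} A] [Category.{v} B] {S : D.Str A} {S' : D.Str B} {F : A ⥤ B},
    D.Hom S S' F → E.Hom (str S) (str S') F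
  hom₂ : ∀ {A B : Type u} [Category.{v} A] [Category.{v} B] {S : D.Str A} {S' : D.Str B}
    {F G : A ⥤ B} {φ : D.Hom S S' F} {ψ : D.Hom S S' G} {α : F ⟶ G},
    D.Hom₂ φ ψ α → E.Hom₂ (hom φ) (hom ψ) α
  hom_id : ∀ {A : Type u} [Category.{v} A] (S : D.Str A), hom (D.id S) = E.id (str S)
  hom_comp : ∀ {A B C : Type u} [Category.{v} A] [Category.{v} B] [Category.{v} C] {S : D.Str A}
    {S' : D.Str B} {S'' : D.Str C} {F : A ⥤ B} {G : B ⥤ C} (φ : D.Hom S S' F)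
    (ψ : D.Hom S' S'' G), hom (D.comp φ ψ) = E.comp (hom φ) (hom ψ)

theorem eqToHom_natTrans_app {X Y : Obj D} {F : X.carrier ⥤ Y.carrier}
    {s t : D.Hom X.str Y.str F} (h : (Cell₁.mk F s : X ⟶ Y) = Cell₁.mk F t) (x : X.carrier) :
    (eqToHom h : (Cell₁.mk F s : X ⟶ Y) ⟶ Cell₁.mk F t).natTrans.app x = 𝟙 (F.obj x) := by
  obtain rfl : s = t := by simpa using h
  rfl

theorem natTrans_comp_app {X Y : Obj D} {f g h : X ⟶ Y} (α : f ⟶ g) (β : g ⟶ h)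
    (x : X.carrier) : (α ≫ β).natTrans.app x = α.natTrans.app x ≫ β.natTrans.app x :=
  rfl

/-- The strict functor of bicategories induced by a map of notions of structure. -/
noncomputable def Map.toStrictPseudofunctor {E : CatStructure.{v, u, v'', u''}} (M : Map D E) :
    StrictPseudofunctor (Obj D) (Obj E) :=
  StrictPseudofunctor.mk'
    { obj := fun X => ⟨X.carrier, M.str X.str⟩
      map := fun f => ⟨f.functor, M.hom f.str⟩
      map₂ := fun α => ⟨α.natTrans, M.hom₂ α.compat⟩
      map₂_id := fun _ => rfl
      map₂_comp := fun _ _ => rfl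
      map_id := fun X => congrArg (Cell₁.mk _) (M.hom_id X.str)
      map_comp := fun f g => congrArg (Cell₁.mk _) (M.hom_comp f.str g.str)
      map₂_whisker_left := fun {_ _ _} _ {_ _} _ => cell₂_ext fun _ => by
        rw [natTrans_comp_app, natTrans_comp_app]
        refine Eq.symm (Eq.trans (congrArg₂ (· ≫ ·) (eqToHom_natTrans_app _ _)
          (congrArg (_ ≫ ·) (eqToHom_natTrans_app _ _))) ?_)
        exact (Category.id_comp _).trans (Category.comp_id _)
      map₂_whisker_right := fun {_ _ _ _ _} _ _ => cell₂_ext fun _ => by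
        rw [natTrans_comp_app, natTrans_comp_app]
        refine Eq.symm (Eq.trans (congrArg₂ (· ≫ ·) (eqToHom_natTrans_app _ _)
          (congrArg (_ ≫ ·) (eqToHom_natTrans_app _ _))) ?_)
        exact (Category.id_comp _).trans (Category.comp_id _)
      map₂_left_unitor := fun _ => cell₂_ext fun _ => by
        rw [natTrans_comp_app]
        exact Eq.symm (Eq.trans (congrArg (· ≫ _) (eqToHom_natTrans_app _ _))
          (Category.id_comp _))
      map₂_right_unitor := fun _ => cell₂_ext fun _ => by
        rw [natTrans_comp_app]
        exact Eq.symm (Eq.trans (congrArg (· ≫ _) (eqToHom_natTrans_app _ _))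
          (Category.id_comp _))
      map₂_associator := fun _ _ _ => cell₂_ext fun _ => by
        rw [natTrans_comp_app, natTrans_comp_app]
        refine Eq.symm (Eq.trans (congrArg₂ (· ≫ ·) (eqToHom_natTrans_app _ _)
          (congrArg (_ ≫ ·) (eqToHom_natTrans_app _ _))) ?_)
        exact (Category.id_comp _).trans (Category.comp_id _) }

end CatStructure

/-- A strict functor of bicategories is an isomorphism if it is bijective on 0-cells, on 1-cells and
on 2-cells. -/
def CategoryTheory.StrictPseudofunctor.IsIsomorphism {B : Type*} [Bicategory B] {C : Type*}
    [Bicategory C] (Φ : StrictPseudofunctor B C) : Prop :=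
  Function.Bijective Φ.obj ∧
    (∀ X Y : B, Function.Bijective fun f : X ⟶ Y => Φ.map f) ∧
    ∀ (X Y : B) (f g : X ⟶ Y), Function.Bijective fun α : f ⟶ g => Φ.map₂ α

/-! ### Colax algebras for the ultracompletion -/

section Algebras

variable {A : Type u} [Category.{v} A] {B : Type u} [Category.{v} B] {C : Type u} [Category.{v} C]

/-- A normal colax algebra structure on `A` for the pseudo-monad `T`: an action `m : T A ⥤ A`, an
associator `a : m ∘ μ_A ⟶ m ∘ T m` and an invertible unitor `i : m ∘ η_A ⟶ id`, subject to two unit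
axioms and one associativity axiom. -/
structure NormalColaxAlgebra (A : Type u) [Category.{v} A] where
  m : UltraFamily.{w} A ⥤ A
  a : UltraFamily.mult A ⋙ m ⟶ UltraFamily.map m ⋙ m
  i : UltraFamily.unit A ⋙ m ⟶ 𝟭 A
  isIso_i : IsIso i
  unit_left : ∀ x : UltraFamily.{w} A,
    m.map (UltraFamily.leftUnit.hom.app x) ≫ a.app ((UltraFamily.unit _).obj x) ≫
      i.app (m.obj x) = 𝟙 (m.obj x)
  unit_right : ∀ x : UltraFamily.{w} A,
    m.map (UltraFamily.rightUnit.hom.app x) ≫ a.app ((UltraFamily.map (UltraFamily.unit A)).obj x) ≫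
      m.map ((UltraFamily.map₂ i).app x) = 𝟙 (m.obj x)
  assoc : ∀ x : UltraFamily.{w} (UltraFamily.{w} (UltraFamily.{w} A)),
    m.map (UltraFamily.multAssoc.hom.app x) ≫
        a.app ((UltraFamily.map (UltraFamily.mult A)).obj x) ≫
          m.map ((UltraFamily.map₂ a).app x) =
      a.app ((UltraFamily.mult (UltraFamily A)).obj x) ≫
        a.app ((UltraFamily.map (UltraFamily.map m)).obj x)

/-- A lax morphism structure on a functor `F` between normal colax algebras: a natural transformation
`φ : F ∘ m ⟶ m' ∘ T F` compatible with the unitors and the associators. -/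
@[ext]
structure LaxMorphism (S : NormalColaxAlgebra.{w} A) (S' : NormalColaxAlgebra.{w} B) (F : A ⥤ B) where
  φ : S.m ⋙ F ⟶ UltraFamily.map F ⋙ S'.m
  unit : ∀ x : A, φ.app ((UltraFamily.unit A).obj x) ≫ S'.i.app (F.obj x) = F.map (S.i.app x)
  assoc : ∀ x : UltraFamily.{w} (UltraFamily.{w} A),
    φ.app ((UltraFamily.mult A).obj x) ≫
        S'.a.app ((UltraFamily.map (UltraFamily.map F)).obj x) =
      F.map (S.a.app x) ≫ φ.app ((UltraFamily.map S.m).obj x) ≫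
        S'.m.map ((UltraFamily.map₂ φ).app x)

/-- A colax morphism structure on a functor `F` between normal colax algebras: a natural
transformation `φ : m' ∘ T F ⟶ F ∘ m` compatible with the unitors and the associators. -/
@[ext]
structure ColaxMorphism (S : NormalColaxAlgebra.{w} A) (S' : NormalColaxAlgebra.{w} B) (F : A ⥤ B) where
  φ : UltraFamily.map F ⋙ S'.m ⟶ S.m ⋙ F
  unit : ∀ x : A, φ.app ((UltraFamily.unit A).obj x) ≫ F.map (S.i.app x) = S'.i.app (F.obj x)
  assoc : ∀ x : UltraFamily.{w} (UltraFamily.{w} A),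
    φ.app ((UltraFamily.mult A).obj x) ≫ F.map (S.a.app x) =
      S'.a.app ((UltraFamily.map (UltraFamily.map F)).obj x) ≫
        S'.m.map ((UltraFamily.map₂ φ).app x) ≫ φ.app ((UltraFamily.map S.m).obj x)

variable {S : NormalColaxAlgebra.{w} A} {S' : NormalColaxAlgebra.{w} B}
  {S'' : NormalColaxAlgebra.{w} C}

/-- The algebra 2-cells between lax morphisms. -/
def LaxMorphism.IsTwoCell {F G : A ⥤ B} (f : LaxMorphism S S' F) (g : LaxMorphism S S' G)
    (α : F ⟶ G) : Prop :=
  ∀ x : UltraFamily.{w} A,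
    f.φ.app x ≫ S'.m.map ((UltraFamily.map₂ α).app x) = α.app (S.m.obj x) ≫ g.φ.app x

/-- The algebra 2-cells between colax morphisms. -/
def ColaxMorphism.IsTwoCell {F G : A ⥤ B} (f : ColaxMorphism S S' F) (g : ColaxMorphism S S' G)
    (α : F ⟶ G) : Prop :=
  ∀ x : UltraFamily.{w} A,
    f.φ.app x ≫ α.app (S.m.obj x) = S'.m.map ((UltraFamily.map₂ α).app x) ≫ g.φ.app x

theorem UltraFamily.homOfMap_comp_id {I : Type w} {μ : Ultrafilter I} {X Y Z : I → A}
    (f : ∀ x, X x ⟶ Y x) (g : ∀ x, Y x ⟶ Z x) :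
    UltraFamily.homOfMap (X := ⟨I, μ, X⟩) (Y := ⟨I, μ, Z⟩) id (Ultrafilter.map_id _)
        (fun x => f x ≫ g x) =
      UltraFamily.homOfMap (X := ⟨I, μ, X⟩) (Y := ⟨I, μ, Y⟩) id (Ultrafilter.map_id _) f ≫
        UltraFamily.homOfMap (X := ⟨I, μ, Y⟩) (Y := ⟨I, μ, Z⟩) id (Ultrafilter.map_id _) g :=
  UltraFamily.PreHom.toHom_eq (Filter.univ_mem' fun _ => ⟨trivial, ⟨trivial, trivial⟩, rfl⟩)

theorem UltraFamily.action_comp (S : NormalColaxAlgebra.{w} A) {I : Type w} {μ : Ultrafilter I}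
    {X Y Z : I → A} (f : ∀ x, X x ⟶ Y x) (g : ∀ x, Y x ⟶ Z x) :
    S.m.map (UltraFamily.homOfMap (X := ⟨I, μ, X⟩) (Y := ⟨I, μ, Z⟩) id (Ultrafilter.map_id _)
        (fun x => f x ≫ g x)) =
      S.m.map (UltraFamily.homOfMap (X := ⟨I, μ, X⟩) (Y := ⟨I, μ, Y⟩) id (Ultrafilter.map_id _) f) ≫
        S.m.map (UltraFamily.homOfMap (X := ⟨I, μ, Y⟩) (Y := ⟨I, μ, Z⟩) id
          (Ultrafilter.map_id _) g) :=
  (congrArg S.m.map (UltraFamily.homOfMap_comp_id f g)).trans (S.m.map_comp _ _)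

theorem lax_comp_aux {X₀ X₁ X₂ X₃ Y₂ Y₃ Z₁ Z₂ W : A} {p : X₀ ⟶ X₁} {q : X₁ ⟶ X₂} {r : X₂ ⟶ X₃}
    {s : X₁ ⟶ Y₂} {t : Y₂ ⟶ Y₃} {t' : Y₃ ⟶ X₃} {k : X₀ ⟶ Z₁} {k' : Z₁ ⟶ Z₂} {k'' : Z₂ ⟶ Y₂}
    {n : Z₂ ⟶ W} {n' : W ⟶ Y₃} {l : W ⟶ X₃} (h₁ : q ≫ r = s ≫ t ≫ t')
    (h₂ : p ≫ s = k ≫ k' ≫ k'') (h₃ : k'' ≫ t = n ≫ n') (h₄ : l = n' ≫ t') :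
    (p ≫ q) ≫ r = k ≫ (k' ≫ n) ≫ l := by
  rw [Category.assoc, h₁, reassoc_of% h₂, reassoc_of% h₃, h₄]
  simp only [Category.assoc]

theorem colax_comp_aux {X₀ X₁ X₂ X₃ Y₁ Y₂ Z₁ Z₂ W : A} {q : X₀ ⟶ X₁} {p : X₁ ⟶ X₂} {k : X₂ ⟶ X₃}
    {s : X₁ ⟶ Y₁} {a : X₀ ⟶ Z₁} {b : Z₁ ⟶ Z₂} {c : Z₂ ⟶ Y₁} {d : Y₁ ⟶ Y₂} {e : Y₂ ⟶ X₃}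
    {n' : Z₂ ⟶ W} {n : W ⟶ Y₂} {l : Z₁ ⟶ W} (h₁ : q ≫ s = a ≫ b ≫ c)
    (h₂ : p ≫ k = s ≫ d ≫ e) (h₃ : c ≫ d = n' ≫ n) (h₄ : l = b ≫ n') :
    (q ≫ p) ≫ k = a ≫ l ≫ n ≫ e := by
  rw [Category.assoc, h₂, reassoc_of% h₁, reassoc_of% h₃, h₄]
  simp only [Category.assoc]

theorem unit_comp_aux {X₀ X₁ X₂ X₃ : A} {p : X₀ ⟶ X₁} {q : X₁ ⟶ X₂} {r : X₂ ⟶ X₃} {s : X₁ ⟶ X₃}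
    {t : X₀ ⟶ X₃} (h₁ : q ≫ r = s) (h₂ : p ≫ s = t) : (p ≫ q) ≫ r = t := by
  rw [Category.assoc, h₁, h₂]

theorem square_comp_aux {X₀ X₁ X₂ Y₀ Y₁ Y₂ : A} {f₀ : X₀ ⟶ Y₀} {f₁ : X₁ ⟶ Y₁} {f₂ : X₂ ⟶ Y₂}
    {p : X₀ ⟶ X₁} {q : X₁ ⟶ X₂} {p' : Y₀ ⟶ Y₁} {q' : Y₁ ⟶ Y₂}
    (h₁ : f₀ ≫ p' = p ≫ f₁) (h₂ : f₁ ≫ q' = q ≫ f₂) : f₀ ≫ p' ≫ q' = (p ≫ q) ≫ f₂ := by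
  rw [reassoc_of% h₁, h₂, Category.assoc]

/-- The identity lax morphism. -/
def LaxMorphism.id (S : NormalColaxAlgebra.{w} A) : LaxMorphism S S (𝟭 A) where
  φ :=
    { app := fun x => 𝟙 (S.m.obj x)
      naturality := fun x y f => by
        induction f using Quotient.inductionOn with | _ f
        exact (Category.comp_id _).trans (Category.id_comp _).symm }
  unit _ := Category.id_comp _
  assoc x := by
    refine (Category.id_comp _).trans (Eq.symm ?_)
    refine (congrArg (_ ≫ ·) ((Category.id_comp _).trans
      (S.m.map_id ((UltraFamily.map S.m).obj x)))).trans ?_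
    exact Category.comp_id _

/-- Composition of lax morphisms. -/
def LaxMorphism.comp {F : A ⥤ B} {G : B ⥤ C} (f : LaxMorphism S S' F) (g : LaxMorphism S' S'' G) :
    LaxMorphism S S'' (F ⋙ G) where
  φ :=
    { app := fun x => G.map (f.φ.app x) ≫ g.φ.app ((UltraFamily.map F).obj x)
      naturality := fun x y k => by
        induction k using Quotient.inductionOn with | _ k
        refine square_comp_aux ((G.map_comp _ _).symm.trans ((congrArg G.map
          (f.φ.naturality (UltraFamily.PreHom.toHom k))).trans (G.map_comp _ _))) ?_
        exact g.φ.naturality ((UltraFamily.map F).map (UltraFamily.PreHom.toHom k)) }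
  unit x := unit_comp_aux (g.unit (F.obj x))
    ((G.map_comp _ _).symm.trans (congrArg G.map (f.unit x)))
  assoc x := lax_comp_aux (g.assoc ((UltraFamily.map (UltraFamily.map F)).obj x))
    ((G.map_comp _ _).symm.trans ((congrArg G.map (f.assoc x)).trans
      ((G.map_comp _ _).trans (congrArg (_ ≫ ·) (G.map_comp _ _)))))
    (g.φ.naturality ((UltraFamily.map₂ f.φ).app x))
    (UltraFamily.action_comp S'' (fun s => G.map (f.φ.app (x.fam s)))
      fun s => g.φ.app ((UltraFamily.map F).obj (x.fam s)))

/-- The identity colax morphism. -/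
def ColaxMorphism.id (S : NormalColaxAlgebra.{w} A) : ColaxMorphism S S (𝟭 A) where
  φ :=
    { app := fun x => 𝟙 (S.m.obj x)
      naturality := fun x y f => by
        induction f using Quotient.inductionOn with | _ f
        exact (Category.comp_id _).trans (Category.id_comp _).symm }
  unit _ := Category.id_comp _
  assoc x := by
    refine (Category.id_comp _).trans (Eq.symm ?_)
    refine (congrArg (_ ≫ ·) ((Category.comp_id _).trans
      (S.m.map_id ((UltraFamily.map S.m).obj x)))).trans ?_
    exact Category.comp_id _

/-- Composition of colax morphisms. -/
def ColaxMorphism.comp {F : A ⥤ B} {G : B ⥤ C} (f : ColaxMorphism S S' F)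
    (g : ColaxMorphism S' S'' G) : ColaxMorphism S S'' (F ⋙ G) where
  φ :=
    { app := fun x => g.φ.app ((UltraFamily.map F).obj x) ≫ G.map (f.φ.app x)
      naturality := fun x y k => by
        induction k using Quotient.inductionOn with | _ k
        refine square_comp_aux
          (g.φ.naturality ((UltraFamily.map F).map (UltraFamily.PreHom.toHom k)))
          ((G.map_comp _ _).symm.trans ((congrArg G.map
          (f.φ.naturality (UltraFamily.PreHom.toHom k))).trans (G.map_comp _ _))) }
  unit x := unit_comp_aux ((G.map_comp _ _).symm.trans (congrArg G.map (f.unit x)))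
    (g.unit (F.obj x))
  assoc x := colax_comp_aux (g.assoc ((UltraFamily.map (UltraFamily.map F)).obj x))
    ((G.map_comp _ _).symm.trans ((congrArg G.map (f.assoc x)).trans
      ((G.map_comp _ _).trans (congrArg (_ ≫ ·) (G.map_comp _ _)))))
    (g.φ.naturality ((UltraFamily.map₂ f.φ).app x)).symm
    (UltraFamily.action_comp S'' (fun s => g.φ.app ((UltraFamily.map F).obj (x.fam s)))
      fun s => G.map (f.φ.app (x.fam s)))

theorem square_id_aux {X Y : A} {p q : X ⟶ Y} (h : p = q) {r : Y ⟶ Y} (hr : r = 𝟙 Y) :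
    p ≫ r = 𝟙 X ≫ q := by
  rw [h, hr, Category.comp_id, Category.id_comp]

theorem square_id_aux' {X Y : A} {p q : X ⟶ Y} (h : p = q) {r : X ⟶ X} (hr : r = 𝟙 X) :
    p ≫ 𝟙 Y = r ≫ q := by
  rw [h, hr, Category.comp_id, Category.id_comp]

theorem square_stack_aux {X₀ X₁ X₂ Y₀ Y₁ Y₂ : A} {f : X₀ ⟶ Y₀} {g : X₁ ⟶ Y₁} {k : X₂ ⟶ Y₂}
    {p : X₀ ⟶ X₁} {q : X₁ ⟶ X₂} {p' : Y₀ ⟶ Y₁} {q' : Y₁ ⟶ Y₂} {r' : Y₀ ⟶ Y₂}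
    (h₁ : f ≫ p' = p ≫ g) (h₂ : g ≫ q' = q ≫ k) (h₃ : r' = p' ≫ q') :
    f ≫ r' = (p ≫ q) ≫ k := by
  rw [h₃, reassoc_of% h₁, h₂, Category.assoc]

end Algebras

/-- Normal colax `T`-algebras with lax morphisms and algebra 2-cells. -/
def laxStructure : CatStructure.{v, u, _, _} where
  Str A _ := NormalColaxAlgebra.{w} A
  Hom S S' F := LaxMorphism S S' F
  Hom₂ f g α := f.IsTwoCell g α
  id S := LaxMorphism.id S
  comp f g := f.comp g
  id₂ {_ _ _ _ _ S' F} f x :=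
    (square_id_aux rfl (S'.m.map_id ((UltraFamily.map F).obj x)) :
      f.φ.app x ≫ _ = 𝟙 _ ≫ f.φ.app x)
  comp₂ {_ _ _ _ _ S' _ _ _ _ _ _ α β} h k x :=
    square_stack_aux (h x) (k x) (UltraFamily.action_comp S' (fun s => α.app (x.fam s))
      fun s => β.app (x.fam s))
  whiskerLeft {_ _ _ _ _ _ _ _ _ F G H} f g k α h x := by
    refine Eq.symm (square_comp_aux (α.naturality (f.φ.app x)).symm ?_)
    exact (h ((UltraFamily.map F).obj x)).symm
  whiskerRight {_ _ _ _ _ _ _ _ _ F G H} f g k α h x := by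
    refine Eq.symm (square_comp_aux ((H.map_comp _ _).symm.trans
      ((congrArg H.map (h x).symm).trans (H.map_comp _ _))) ?_)
    exact k.φ.naturality ((UltraFamily.map₂ α).app x)
  associator {_ _ _ _ _ _ _ _ _ _ _ S F G H} f g k x :=
    square_id_aux ((congrArg (· ≫ _) (H.map_comp _ _)).trans (Category.assoc _ _ _))
      (S.m.map_id ((UltraFamily.map (F ⋙ G ⋙ H)).obj x))
  associator_inv {_ _ _ _ _ _ _ _ _ _ _ S F G H} f g k x :=
    square_id_aux ((congrArg (· ≫ _) (H.map_comp _ _)).trans (Category.assoc _ _ _)).symm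
      (S.m.map_id ((UltraFamily.map (F ⋙ G ⋙ H)).obj x))
  leftUnitor {_ _ _ _ _ S F} f x :=
    square_id_aux ((congrArg (· ≫ _) (F.map_id _)).trans (Category.id_comp (f.φ.app x)))
      (S.m.map_id ((UltraFamily.map F).obj x))
  leftUnitor_inv {_ _ _ _ _ S F} f x :=
    square_id_aux ((congrArg (· ≫ _) (F.map_id _)).trans (Category.id_comp (f.φ.app x))).symm
      (S.m.map_id ((UltraFamily.map F).obj x))
  rightUnitor {_ _ _ _ _ S F} f x :=
    square_id_aux (Category.comp_id (f.φ.app x)) (S.m.map_id ((UltraFamily.map F).obj x))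
  rightUnitor_inv {_ _ _ _ _ S F} f x :=
    square_id_aux (Category.comp_id (f.φ.app x)).symm (S.m.map_id ((UltraFamily.map F).obj x))

/-- Normal colax `T`-algebras with colax morphisms and algebra 2-cells. -/
def colaxStructure : CatStructure.{v, u, _, _} where
  Str A _ := NormalColaxAlgebra.{w} A
  Hom S S' F := ColaxMorphism S S' F
  Hom₂ f g α := f.IsTwoCell g α
  id S := ColaxMorphism.id S
  comp f g := f.comp g
  id₂ {_ _ _ _ _ S' F} f x :=
    (square_id_aux' rfl (S'.m.map_id ((UltraFamily.map F).obj x)) :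
      f.φ.app x ≫ 𝟙 _ = _ ≫ f.φ.app x)
  comp₂ {_ _ _ _ _ S' _ _ _ _ _ _ α β} h k x :=
    (square_comp_aux (h x) (k x)).trans (congrArg (· ≫ _)
      (UltraFamily.action_comp S' (fun s => α.app (x.fam s)) fun s => β.app (x.fam s)).symm)
  whiskerLeft {_ _ _ _ _ _ _ _ _ F G H} f g k α h x := by
    refine Eq.symm (square_comp_aux ?_ (α.naturality (f.φ.app x)).symm)
    exact (h ((UltraFamily.map F).obj x)).symm
  whiskerRight {_ _ _ _ _ _ _ _ _ F G H} f g k α h x := by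
    refine Eq.symm (square_comp_aux ?_ ((H.map_comp _ _).symm.trans
      ((congrArg H.map (h x).symm).trans (H.map_comp _ _))))
    exact k.φ.naturality ((UltraFamily.map₂ α).app x)
  associator {_ _ _ _ _ _ _ _ _ _ _ S F G H} f g k x :=
    square_id_aux' ((congrArg (_ ≫ ·) (H.map_comp _ _)).trans (Category.assoc _ _ _).symm)
      (S.m.map_id ((UltraFamily.map (F ⋙ G ⋙ H)).obj x))
  associator_inv {_ _ _ _ _ _ _ _ _ _ _ S F G H} f g k x :=
    square_id_aux' ((congrArg (_ ≫ ·) (H.map_comp _ _)).trans (Category.assoc _ _ _).symm).symm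
      (S.m.map_id ((UltraFamily.map (F ⋙ G ⋙ H)).obj x))
  leftUnitor {_ _ _ _ _ S F} f x :=
    square_id_aux' ((congrArg (_ ≫ ·) (F.map_id _)).trans (Category.comp_id (f.φ.app x)))
      (S.m.map_id ((UltraFamily.map F).obj x))
  leftUnitor_inv {_ _ _ _ _ S F} f x :=
    square_id_aux' ((congrArg (_ ≫ ·) (F.map_id _)).trans (Category.comp_id (f.φ.app x))).symm
      (S.m.map_id ((UltraFamily.map F).obj x))
  rightUnitor {_ _ _ _ _ S F} f x :=
    square_id_aux' (Category.id_comp (f.φ.app x)) (S.m.map_id ((UltraFamily.map F).obj x))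
  rightUnitor_inv {_ _ _ _ _ S F} f x :=
    square_id_aux' (Category.id_comp (f.φ.app x)).symm (S.m.map_id ((UltraFamily.map F).obj x))

/-- Normal colax `T`-algebras with pseudo-morphisms, that is, lax morphisms whose structure
transformation is invertible, and algebra 2-cells. -/
def pseudoStructure : CatStructure.{v, u, _, _} :=
  laxStructure.{w, v, u}.restrict (fun f => ∀ x, IsIso (f.φ.app x))
    (fun S x => inferInstanceAs (IsIso (𝟙 (S.m.obj x))))
    (fun {_ _ _ _ _ _ _ _ _ F G} f g hf hg x => by
      have := hf x
      have := hg ((UltraFamily.map F).obj x)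
      exact inferInstanceAs (IsIso (G.map (f.φ.app x) ≫ g.φ.app ((UltraFamily.map F).obj x))))

/-! ### Ultracategories -/

theorem UltraFamily.map_eq_bind {S X : Type w} (f : S → X) (μ : Ultrafilter S) :
    μ.map f = μ.bind fun s => pure (f s) :=
  rfl

/-- The data of an ultrastructure on a category `A`: the ultraproduct functors `∫_X (-) dμ`, the
Fubini transforms `Δ_{μ,ν} : ∫_X M dρ ⟶ ∫_S (∫_X M dν_s) dμ` for `ρ = ∫_S ν_s dμ`, and the maps
`ε_{X,x₀} : ∫_X M dδ_{x₀} ⟶ M_{x₀}`, all natural in the family `M`. -/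
structure UltraData (A : Type u) [Category.{v} A] where
  prod : ∀ {X : Type w}, Ultrafilter X → ((X → A) ⥤ A)
  fubini : ∀ {S X : Type w} (μ : Ultrafilter S) (ν : S → Ultrafilter X) (ρ : Ultrafilter X),
    ρ = μ.bind ν → (prod ρ ⟶ Functor.pi' (fun s => prod (ν s)) ⋙ prod μ)
  ε : ∀ {X : Type w} (x₀ : X), prod (pure x₀) ⟶ Pi.eval (fun _ => A) x₀

/-- The axioms of an ultrastructure. -/
structure UltraData.IsUltrastructure {A : Type u} [Category.{v} A] (D : UltraData.{w} A) : Prop where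
  isIso_ε : ∀ {X : Type w} (x₀ : X), IsIso (D.ε x₀)
  /-- `Δ_{δ_{s₀},ν}` is the inverse of the isomorphism `ε_{S,s₀}`. -/
  fubini_pure : ∀ {S X : Type w} (s₀ : S) (ν : S → Ultrafilter X) (M : X → A),
    (D.fubini (pure s₀) ν (ν s₀) (UltraFamily.bind_pure_left s₀ ν)).app M ≫
      (D.ε s₀).app (fun s => (D.prod (ν s)).obj M) = 𝟙 ((D.prod (ν s₀)).obj M)
  isIso_fubini : ∀ {X Y : Type w} (f : X → Y), Function.Injective f → ∀ (μ : Ultrafilter X)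
    (M : Y → A), IsIso ((D.fubini μ (fun x => pure (f x)) (μ.map f)
      (UltraFamily.map_eq_bind f μ)).app M)
  fubini_fubini : ∀ {R S X : Type w} (l : Ultrafilter R) (μ : R → Ultrafilter S)
    (ν : S → Ultrafilter X) (M : X → A),
    (D.fubini l (fun r => (μ r).bind ν) ((l.bind μ).bind ν) (UltraFamily.bind_bind l μ ν)).app M ≫
        (D.prod l).map (fun r => (D.fubini (μ r) ν _ rfl).app M) =
      (D.fubini (l.bind μ) ν _ rfl).app M ≫
        (D.fubini l μ _ rfl).app (fun s => (D.prod (ν s)).obj M)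

/-- An ultrastructure on a category. -/
structure Ultrastructure (A : Type u) [Category.{v} A] where
  data : UltraData.{w} A
  isUltrastructure : data.IsUltrastructure

section Ultrafunctors

variable {A : Type u} [Category.{v} A] {B : Type u} [Category.{v} B] {C : Type u} [Category.{v} C]

/-- A family of maps `σ_μ : F (∫_X M dμ) ⟶ ∫_X F(M) dμ`. -/
def LeftFamily (D : UltraData.{w} A) (D' : UltraData.{w} B) (F : A ⥤ B) :=
  ∀ {X : Type w} (μ : Ultrafilter X) (M : X → A),
    F.obj ((D.prod μ).obj M) ⟶ (D'.prod μ).obj fun x => F.obj (M x)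

/-- A family of maps `σ_μ : ∫_X F(M) dμ ⟶ F (∫_X M dμ)`. -/
def RightFamily (D : UltraData.{w} A) (D' : UltraData.{w} B) (F : A ⥤ B) :=
  ∀ {X : Type w} (μ : Ultrafilter X) (M : X → A),
    ((D'.prod μ).obj fun x => F.obj (M x)) ⟶ F.obj ((D.prod μ).obj M)

/-- The axioms of a left ultrastructure on a functor. -/
structure IsLeftUltrastructure (D : UltraData.{w} A) (D' : UltraData.{w} B) (F : A ⥤ B)
    (σ : LeftFamily D D' F) : Prop where
  naturality : ∀ {X : Type w} (μ : Ultrafilter X) {M N : X → A} (ψ : M ⟶ N),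
    σ μ M ≫ (D'.prod μ).map (fun x => F.map (ψ x)) = F.map ((D.prod μ).map ψ) ≫ σ μ N
  pure : ∀ {X : Type w} (x₀ : X) (M : X → A),
    σ (pure x₀) M ≫ (D'.ε x₀).app (fun x => F.obj (M x)) = F.map ((D.ε x₀).app M)
  bind : ∀ {S X : Type w} (μ : Ultrafilter S) (ν : S → Ultrafilter X) (M : X → A),
    σ (μ.bind ν) M ≫ (D'.fubini μ ν _ rfl).app (fun x => F.obj (M x)) =
      F.map ((D.fubini μ ν _ rfl).app M) ≫ σ μ (fun s => (D.prod (ν s)).obj M) ≫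
        (D'.prod μ).map (fun s => σ (ν s) M)

/-- The axioms of a right ultrastructure on a functor. -/
structure IsRightUltrastructure (D : UltraData.{w} A) (D' : UltraData.{w} B) (F : A ⥤ B)
    (σ : RightFamily D D' F) : Prop where
  naturality : ∀ {X : Type w} (μ : Ultrafilter X) {M N : X → A} (ψ : M ⟶ N),
    σ μ M ≫ F.map ((D.prod μ).map ψ) = (D'.prod μ).map (fun x => F.map (ψ x)) ≫ σ μ N
  pure : ∀ {X : Type w} (x₀ : X) (M : X → A),
    σ (pure x₀) M ≫ F.map ((D.ε x₀).app M) = (D'.ε x₀).app (fun x => F.obj (M x))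
  bind : ∀ {S X : Type w} (μ : Ultrafilter S) (ν : S → Ultrafilter X) (M : X → A),
    σ (μ.bind ν) M ≫ F.map ((D.fubini μ ν _ rfl).app M) =
      (D'.fubini μ ν _ rfl).app (fun x => F.obj (M x)) ≫
        (D'.prod μ).map (fun s => σ (ν s) M) ≫ σ μ (fun s => (D.prod (ν s)).obj M)

/-- A left ultrastructure on a functor `F`. -/
structure LeftUltrastructure (D : UltraData.{w} A) (D' : UltraData.{w} B) (F : A ⥤ B) where
  σ : LeftFamily D D' F
  isLeft : IsLeftUltrastructure D D' F σ

/-- A right ultrastructure on a functor `F`. -/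
structure RightUltrastructure (D : UltraData.{w} A) (D' : UltraData.{w} B) (F : A ⥤ B) where
  σ : RightFamily D D' F
  isRight : IsRightUltrastructure D D' F σ

variable {D : UltraData.{w} A} {D' : UltraData.{w} B} {D'' : UltraData.{w} C}

/-- Natural transformations of left ultrafunctors. -/
def LeftUltrastructure.IsNatTrans {F G : A ⥤ B} (f : LeftUltrastructure D D' F)
    (g : LeftUltrastructure D D' G) (α : F ⟶ G) : Prop :=
  ∀ {X : Type w} (μ : Ultrafilter X) (M : X → A),
    f.σ μ M ≫ (D'.prod μ).map (fun x => α.app (M x)) = α.app ((D.prod μ).obj M) ≫ g.σ μ M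

/-- Natural transformations of right ultrafunctors. -/
def RightUltrastructure.IsNatTrans {F G : A ⥤ B} (f : RightUltrastructure D D' F)
    (g : RightUltrastructure D D' G) (α : F ⟶ G) : Prop :=
  ∀ {X : Type w} (μ : Ultrafilter X) (M : X → A),
    f.σ μ M ≫ α.app ((D.prod μ).obj M) = (D'.prod μ).map (fun x => α.app (M x)) ≫ g.σ μ M

/-- The identity left ultrafunctor. -/
def LeftUltrastructure.id (D : UltraData.{w} A) : LeftUltrastructure D D (𝟭 A) where
  σ _ _ := 𝟙 _
  isLeft :=
    { naturality := fun _ _ _ _ => (Category.id_comp _).trans (Category.comp_id _).symm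
      pure := fun _ _ => Category.id_comp _
      bind := fun μ ν M => by
        refine (Category.id_comp _).trans (Eq.symm ?_)
        refine (congrArg (_ ≫ ·) ((Category.id_comp _).trans ((D.prod μ).map_id _))).trans ?_
        exact Category.comp_id _ }

/-- Composition of left ultrafunctors. -/
def LeftUltrastructure.comp {F : A ⥤ B} {G : B ⥤ C} (f : LeftUltrastructure D D' F)
    (g : LeftUltrastructure D' D'' G) : LeftUltrastructure D D'' (F ⋙ G) where
  σ μ M := G.map (f.σ μ M) ≫ g.σ μ fun x => F.obj (M x)
  isLeft :=
    { naturality := fun μ M N ψ => Eq.symm <| square_comp_aux ((G.map_comp _ _).symm.trans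
        ((congrArg G.map (f.isLeft.naturality μ ψ).symm).trans (G.map_comp _ _)))
          (g.isLeft.naturality μ _).symm
      pure := fun x₀ M => unit_comp_aux (g.isLeft.pure x₀ _)
        ((G.map_comp _ _).symm.trans (congrArg G.map (f.isLeft.pure x₀ M)))
      bind := fun μ ν M => lax_comp_aux (g.isLeft.bind μ ν _)
        ((G.map_comp _ _).symm.trans ((congrArg G.map (f.isLeft.bind μ ν M)).trans
          ((G.map_comp _ _).trans (congrArg (_ ≫ ·) (G.map_comp _ _)))))
        (g.isLeft.naturality μ _).symm ((D''.prod μ).map_comp _ _) }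

/-- The identity right ultrafunctor. -/
def RightUltrastructure.id (D : UltraData.{w} A) : RightUltrastructure D D (𝟭 A) where
  σ _ _ := 𝟙 _
  isRight :=
    { naturality := fun _ _ _ _ => (Category.id_comp _).trans (Category.comp_id _).symm
      pure := fun _ _ => Category.id_comp _
      bind := fun μ ν M => by
        refine (Category.id_comp _).trans (Eq.symm ?_)
        refine (congrArg (_ ≫ ·) ((Category.comp_id _).trans ((D.prod μ).map_id _))).trans ?_
        exact Category.comp_id _ }

/-- Composition of right ultrafunctors. -/
def RightUltrastructure.comp {F : A ⥤ B} {G : B ⥤ C} (f : RightUltrastructure D D' F)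
    (g : RightUltrastructure D' D'' G) : RightUltrastructure D D'' (F ⋙ G) where
  σ μ M := (g.σ μ fun x => F.obj (M x)) ≫ G.map (f.σ μ M)
  isRight :=
    { naturality := fun μ M N ψ => Eq.symm <| square_comp_aux (g.isRight.naturality μ _).symm
        ((G.map_comp _ _).symm.trans
          ((congrArg G.map (f.isRight.naturality μ ψ).symm).trans (G.map_comp _ _)))
      pure := fun x₀ M => unit_comp_aux
        ((G.map_comp _ _).symm.trans (congrArg G.map (f.isRight.pure x₀ M)))
        (g.isRight.pure x₀ _)
      bind := fun μ ν M => colax_comp_aux (g.isRight.bind μ ν _)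
        ((G.map_comp _ _).symm.trans ((congrArg G.map (f.isRight.bind μ ν M)).trans
          ((G.map_comp _ _).trans (congrArg (_ ≫ ·) (G.map_comp _ _)))))
        (g.isRight.naturality μ _) ((D''.prod μ).map_comp _ _) }

end Ultrafunctors

/-- Ultracategories with left ultrafunctors and natural transformations of left ultrafunctors. -/
def leftUltraStructure : CatStructure.{v, u, _, _} where
  Str A _ := Ultrastructure.{w} A
  Hom S S' F := LeftUltrastructure S.data S'.data F
  Hom₂ f g α := f.IsNatTrans g α
  id S := LeftUltrastructure.id S.data
  comp f g := f.comp g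
  id₂ {_ _ _ _ _ S' F} f _ μ M :=
    square_id_aux rfl ((S'.data.prod μ).map_id _)
  comp₂ {_ _ _ _ _ S' _ _ _ _ _ _ α β} h k _ μ M :=
    square_stack_aux (h μ M) (k μ M) ((S'.data.prod μ).map_comp _ _)
  whiskerLeft {_ _ _ _ _ _ _ _ _ F G H} f g k α h _ μ M :=
    Eq.symm (square_comp_aux (α.naturality (f.σ μ M)).symm (h μ _).symm)
  whiskerRight {_ _ _ _ _ _ _ _ _ F G H} f g k α h _ μ M :=
    Eq.symm (square_comp_aux ((H.map_comp _ _).symm.trans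
      ((congrArg H.map (h μ M).symm).trans (H.map_comp _ _))) (k.isLeft.naturality μ _).symm)
  associator {_ _ _ _ _ _ _ _ _ _ _ S F G H} f g k _ μ M :=
    square_id_aux ((congrArg (· ≫ _) (H.map_comp _ _)).trans (Category.assoc _ _ _))
      ((S.data.prod μ).map_id _)
  associator_inv {_ _ _ _ _ _ _ _ _ _ _ S F G H} f g k _ μ M :=
    square_id_aux ((congrArg (· ≫ _) (H.map_comp _ _)).trans (Category.assoc _ _ _)).symm
      ((S.data.prod μ).map_id _)
  leftUnitor {_ _ _ _ _ S F} f _ μ M :=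
    square_id_aux ((congrArg (· ≫ _) (F.map_id _)).trans (Category.id_comp (f.σ μ M)))
      ((S.data.prod μ).map_id _)
  leftUnitor_inv {_ _ _ _ _ S F} f _ μ M :=
    square_id_aux ((congrArg (· ≫ _) (F.map_id _)).trans (Category.id_comp (f.σ μ M))).symm
      ((S.data.prod μ).map_id _)
  rightUnitor {_ _ _ _ _ S F} f _ μ M :=
    square_id_aux (Category.comp_id (f.σ μ M)) ((S.data.prod μ).map_id _)
  rightUnitor_inv {_ _ _ _ _ S F} f _ μ M :=
    square_id_aux (Category.comp_id (f.σ μ M)).symm ((S.data.prod μ).map_id _)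

/-- Ultracategories with right ultrafunctors and natural transformations of right ultrafunctors. -/
def rightUltraStructure : CatStructure.{v, u, _, _} where
  Str A _ := Ultrastructure.{w} A
  Hom S S' F := RightUltrastructure S.data S'.data F
  Hom₂ f g α := f.IsNatTrans g α
  id S := RightUltrastructure.id S.data
  comp f g := f.comp g
  id₂ {_ _ _ _ _ S' F} f _ μ M :=
    square_id_aux' rfl ((S'.data.prod μ).map_id _)
  comp₂ {_ _ _ _ _ S' _ _ _ _ _ _ α β} h k _ μ M :=
    (square_comp_aux (h μ M) (k μ M)).trans
      (congrArg (· ≫ _) ((S'.data.prod μ).map_comp _ _).symm)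
  whiskerLeft {_ _ _ _ _ _ _ _ _ F G H} f g k α h _ μ M :=
    Eq.symm (square_comp_aux (h μ _).symm (α.naturality (f.σ μ M)).symm)
  whiskerRight {_ _ _ _ _ _ _ _ _ F G H} f g k α h _ μ M :=
    Eq.symm (square_comp_aux (k.isRight.naturality μ _).symm ((H.map_comp _ _).symm.trans
      ((congrArg H.map (h μ M).symm).trans (H.map_comp _ _))))
  associator {_ _ _ _ _ _ _ _ _ _ _ S F G H} f g k _ μ M :=
    square_id_aux' ((congrArg (_ ≫ ·) (H.map_comp _ _)).trans (Category.assoc _ _ _).symm)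
      ((S.data.prod μ).map_id _)
  associator_inv {_ _ _ _ _ _ _ _ _ _ _ S F G H} f g k _ μ M :=
    square_id_aux' ((congrArg (_ ≫ ·) (H.map_comp _ _)).trans (Category.assoc _ _ _).symm).symm
      ((S.data.prod μ).map_id _)
  leftUnitor {_ _ _ _ _ S F} f _ μ M :=
    square_id_aux' ((congrArg (_ ≫ ·) (F.map_id _)).trans (Category.comp_id (f.σ μ M)))
      ((S.data.prod μ).map_id _)
  leftUnitor_inv {_ _ _ _ _ S F} f _ μ M :=
    square_id_aux' ((congrArg (_ ≫ ·) (F.map_id _)).trans (Category.comp_id (f.σ μ M))).symm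
      ((S.data.prod μ).map_id _)
  rightUnitor {_ _ _ _ _ S F} f _ μ M :=
    square_id_aux' (Category.id_comp (f.σ μ M)) ((S.data.prod μ).map_id _)
  rightUnitor_inv {_ _ _ _ _ S F} f _ μ M :=
    square_id_aux' (Category.id_comp (f.σ μ M)).symm ((S.data.prod μ).map_id _)

/-- Ultracategories with ultrafunctors, that is, left ultrafunctors all of whose structure maps are
invertible, and natural transformations of left ultrafunctors. -/
def ultraStructure : CatStructure.{v, u, _, _} :=
  leftUltraStructure.{w, v, u}.restrict
    (fun f => ∀ {X : Type w} (μ : Ultrafilter X) M, IsIso (f.σ μ M))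
    (fun S _ μ M => inferInstanceAs (IsIso (𝟙 ((S.data.prod μ).obj M))))
    (fun {_ _ _ _ _ _ _ _ _ F G} f g hf hg _ μ M => by
      have := hf μ M
      have := hg μ fun x => F.obj (M x)
      exact inferInstanceAs (IsIso (G.map (f.σ μ M) ≫ g.σ μ fun x => F.obj (M x))))

/-! ### From colax algebras to ultracategories -/

namespace UltraFamily

variable {A : Type u} [Category.{v} A]

/-- The functor `A^X ⥤ T A` sending a family `M` to `(X, μ, M)`. -/
def ofFamily {X : Type w} (μ : Ultrafilter X) : (X → A) ⥤ UltraFamily.{w} A where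
  obj M := ⟨X, μ, M⟩
  map {M N} f := homOfMap (X := ⟨X, μ, M⟩) (Y := ⟨X, μ, N⟩) id (Ultrafilter.map_id _) f
  map_id _ := rfl
  map_comp f g := homOfMap_comp_id f g

/-- The natural morphism `(X, δ_{x₀}, M) ⟶ (*, *, M_{x₀})` of `T A` given by `* ↦ x₀`. -/
def ofPoint {X : Type w} (x₀ : X) :
    ofFamily (pure x₀) ⟶ Pi.eval (fun _ : X => A) x₀ ⋙ unit.{w} A where
  app M := homOfMap (X := ⟨X, pure x₀, M⟩) (Y := ⟨PUnit, pure PUnit.unit, fun _ => M x₀⟩)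
    (fun _ => x₀) (Ultrafilter.map_pure _ _) fun _ => 𝟙 _
  naturality M N f := PreHom.toHom_eq (Filter.univ_mem' fun _ => ⟨⟨trivial, trivial⟩,
    ⟨trivial, trivial⟩, congrArg (Sigma.mk x₀) ((Category.comp_id _).trans
      (Category.id_comp _).symm)⟩)

/-- The natural morphism `(X, ∫_S ν_s dμ, M) ⟶ (S × X, ∫_S ι_s ν_s dμ, M ∘ π)` of `T A` given by the
projection `π : S × X → X`, where `S × X` is the disjoint union of `S` copies of `X`. -/
noncomputable def ofProj {S X : Type w} (μ : Ultrafilter S) (ν : S → Ultrafilter X) (ρ : Ultrafilter X)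
    (h : ρ = μ.bind ν) :
    ofFamily (A := A) ρ ⟶
      Functor.pi' (fun s => ofFamily (A := A) (ν s)) ⋙ ofFamily μ ⋙ mult.{w} A where
  app M := homOfMap (X := ⟨X, ρ, M⟩) (Y := multObj ⟨S, μ, fun s => ⟨X, ν s, M⟩⟩)
    (fun p => p.2) (h ▸ rfl) fun _ => 𝟙 _
  naturality M N f := by
    refine Eq.trans ?_ (congrArg (_ ≫ ·) (multMap_homOfMap
      (X := ⟨S, μ, fun s => ⟨X, ν s, M⟩⟩) (Y := ⟨S, μ, fun s => ⟨X, ν s, N⟩⟩)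
      id (Ultrafilter.map_id _) (fun _ => id) (fun _ => Ultrafilter.map_id _)
      (Ultrafilter.map_id _) fun _ x => f x)).symm
    exact PreHom.toHom_eq (Filter.univ_mem' fun p => ⟨⟨trivial, trivial⟩,
      ⟨trivial, trivial⟩, congrArg (Sigma.mk p.2) ((Category.comp_id _).trans
        (Category.id_comp _).symm)⟩)

end UltraFamily

/-- The ultrastructure data associated with a normal colax algebra: the ultraproduct of a family `M`
is the value of the action at `(X, μ, M)`; the Fubini transform is the action of the projection
`S × X → X` followed by the associator; `ε` is the action of `* ↦ x₀` followed by the unitor. -/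
noncomputable def NormalColaxAlgebra.ultraData {A : Type u} [Category.{v} A]
    (S : NormalColaxAlgebra.{w} A) : UltraData.{w} A where
  prod μ := UltraFamily.ofFamily μ ⋙ S.m
  fubini {I X} μ ν ρ h :=
    { app := fun M => S.m.map ((UltraFamily.ofProj μ ν ρ h).app M) ≫
        S.a.app ⟨I, μ, fun s => ⟨X, ν s, M⟩⟩
      naturality := fun M N f =>
        square_comp_aux
          ((S.m.map_comp _ _).symm.trans ((congrArg S.m.map
            ((UltraFamily.ofProj μ ν ρ h).naturality f)).trans (S.m.map_comp _ _)))
          (S.a.naturality (X := ⟨I, μ, fun s => ⟨X, ν s, M⟩⟩) (Y := ⟨I, μ, fun s => ⟨X, ν s, N⟩⟩)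
            (UltraFamily.homOfMap id (Ultrafilter.map_id _)
              fun s => (UltraFamily.ofFamily (ν s)).map f)) }
  ε x₀ :=
    { app := fun M => S.m.map ((UltraFamily.ofPoint x₀).app M) ≫ S.i.app (M x₀)
      naturality := fun M N f =>
        square_comp_aux
          ((S.m.map_comp _ _).symm.trans ((congrArg S.m.map
            ((UltraFamily.ofPoint x₀).naturality f)).trans (S.m.map_comp _ _)))
          (S.i.naturality (f x₀)) }

/-- The maps `σ_μ : F (∫_X M dμ) ⟶ ∫_X F(M) dμ` given by a lax morphism. -/
def LaxMorphism.leftFamily {A B : Type u} [Category.{v} A] [Category.{v} B]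
    {S : NormalColaxAlgebra.{w} A} {S' : NormalColaxAlgebra.{w} B} {F : A ⥤ B}
    (f : LaxMorphism S S' F) : LeftFamily S.ultraData S'.ultraData F :=
  fun {X} μ M => f.φ.app ⟨X, μ, M⟩

/-- The maps `σ_μ : ∫_X F(M) dμ ⟶ F (∫_X M dμ)` given by a colax morphism. -/
def ColaxMorphism.rightFamily {A B : Type u} [Category.{v} A] [Category.{v} B]
    {S : NormalColaxAlgebra.{w} A} {S' : NormalColaxAlgebra.{w} B} {F : A ⥤ B}
    (f : ColaxMorphism S S' F) : RightFamily S.ultraData S'.ultraData F :=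
  fun {X} μ M => f.φ.app ⟨X, μ, M⟩

section Comparison

variable
  (h₀ : ∀ (A : Type u) [Category.{v} A] (S : NormalColaxAlgebra.{w} A), S.ultraData.IsUltrastructure)
  (h₁ : ∀ (A B : Type u) [Category.{v} A] [Category.{v} B] (S : NormalColaxAlgebra.{w} A)
    (S' : NormalColaxAlgebra.{w} B) (F : A ⥤ B) (f : LaxMorphism S S' F),
    IsLeftUltrastructure S.ultraData S'.ultraData F f.leftFamily)
  (h₂ : ∀ (A B : Type u) [Category.{v} A] [Category.{v} B] (S : NormalColaxAlgebra.{w} A)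
    (S' : NormalColaxAlgebra.{w} B) (F : A ⥤ B) (f : ColaxMorphism S S' F),
    IsRightUltrastructure S.ultraData S'.ultraData F f.rightFamily)

/-- The assignment from colax algebras and lax morphisms to ultracategories and left
ultrafunctors, once it is known to be well defined. -/
noncomputable def laxToLeft :
    CatStructure.Map laxStructure.{w, v, u} leftUltraStructure.{w, v, u} where
  str S := ⟨S.ultraData, h₀ _ S⟩
  hom f := ⟨f.leftFamily, h₁ _ _ _ _ _ f⟩
  hom₂ h X μ M := h ⟨X, μ, M⟩
  hom_id _ := rfl
  hom_comp _ _ := rfl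

/-- The assignment from colax algebras and colax morphisms to ultracategories and right
ultrafunctors, once it is known to be well defined. -/
noncomputable def colaxToRight :
    CatStructure.Map colaxStructure.{w, v, u} rightUltraStructure.{w, v, u} where
  str S := ⟨S.ultraData, h₀ _ S⟩
  hom f := ⟨f.rightFamily, h₂ _ _ _ _ _ f⟩
  hom₂ h X μ M := h ⟨X, μ, M⟩
  hom_id _ := rfl
  hom_comp _ _ := rfl

/-- The assignment from colax algebras and pseudo-morphisms to ultracategories and ultrafunctors,
once it is known to be well defined. -/
noncomputable def pseudoToUltra :
    CatStructure.Map pseudoStructure.{w, v, u} ultraStructure.{w, v, u} where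
  str S := ⟨S.ultraData, h₀ _ S⟩
  hom f := ⟨⟨f.1.leftFamily, h₁ _ _ _ _ _ f.1⟩, fun {X} μ M => f.2 ⟨X, μ, M⟩⟩
  hom₂ h X μ M := h ⟨X, μ, M⟩
  hom_id _ := rfl
  hom_comp _ _ := rfl

end Comparison

/-!
The point of the proof is that both kinds of structure are determined by, and can be computed from,
restriction maps along functions of index sets.

In an ultracategory a function `f : X → Y` gives a restriction `∫_Y M d(fμ) ⟶ ∫_X (M ∘ f) dμ`
(`UltraData.pull`): the Fubini transform for the principal ultrafilters `δ_{f x}`, followed by the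
maps `ε`. The axioms make restriction functorial, natural in `M`, and compatible with `ε` and with
both variables of the Fubini transform (`delta_pull`, `pull_delta`). Restriction along an injection
is invertible by `isIso_fubini`, and restriction along an identity, being idempotent and invertible, is
the identity.

From an ultrastructure one obtains an action of `T A` as follows. A morphism of `T A` with partial
function `f : Y' → X` acts by restricting along `f`, applying the given morphisms, and undoing the
restriction along the inclusion `Y' ⊆ Y`. That this respects the identification of representatives
and composition follows from `actPre_pull`. The associator at a family indexed by `∐ T_s` is the
Fubini transform for the ultrafilters `ι_s ν_s` followed by the restrictions along the inclusions
`ι_s` (`UltraData.assocMap`). Its naturality and the algebra axioms reduce to `pull_assocMap`, which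
says that precomposing it with the restriction along a function out of `∐ T_s` gives a Fubini
transform followed by restrictions. The reduction uses that every morphism of `T A` becomes total
after composition with an isomorphism, so that naturality needs checking on total morphisms only
(`naturality_of_total`, `naturality_of_total_total`).

From a normal colax algebra, the right unit axiom shows that the restriction along `f` in the
associated ultrastructure is the action of the morphism of `T A` given by `f` and identities
(`ultraData_pull`). The ultracategory axioms are then instances of the algebra axioms, naturality of
the associator, and identities between morphisms of `T A`. The same description of restriction shows
that the two constructions are mutually inverse.

For functors, a lax or colax morphism and the corresponding left or right ultrafunctor have the same
components. A family of components compatible with `Δ` and `ε` is compatible with restriction, hence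
natural for all morphisms of `T A` and compatible with the associators; the converse is naturality.
-/

/-! ### Calculus of ultraproducts -/

theorem UltraFamily.bind_map_mk {S : Type w} {T : S → Type w} (μ : Ultrafilter S)
    (ν : ∀ s, Ultrafilter (T s)) :
    (μ.bind fun s => (ν s).map (Sigma.mk s)) = UltraFamily.sigmaUf μ ν :=
  rfl

namespace UltraData

variable {A : Type u} [Category.{v} A] (D : UltraData.{w} A)

/-- The map of ultraproducts `∫_X M dμ ⟶ ∫_X N dμ` induced by a family of maps `M x ⟶ N x`. -/
def mapFam {X : Type w} (μ : Ultrafilter X) {M N : X → A} (g : ∀ x, M x ⟶ N x) :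
    (D.prod μ).obj M ⟶ (D.prod μ).obj N :=
  (D.prod μ).map g

theorem mapFam_id {X : Type w} (μ : Ultrafilter X) (M : X → A) :
    D.mapFam μ (fun x => 𝟙 (M x)) = 𝟙 _ :=
  (D.prod μ).map_id M

theorem mapFam_comp {X : Type w} (μ : Ultrafilter X) {M N P : X → A} (g : ∀ x, M x ⟶ N x)
    (h : ∀ x, N x ⟶ P x) : D.mapFam μ g ≫ D.mapFam μ h = D.mapFam μ fun x => g x ≫ h x :=
  ((D.prod μ).map_comp g h).symm

theorem isIso_mapFam {X : Type w} (μ : Ultrafilter X) {M N : X → A} (g : ∀ x, M x ⟶ N x)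
    (hg : ∀ x, IsIso (g x)) : IsIso (D.mapFam μ g) :=
  ⟨D.mapFam μ fun x => inv (g x), by simp [mapFam_comp, mapFam_id], by
    simp [mapFam_comp, mapFam_id]⟩

/-- The component at `M` of the Fubini transform. -/
def delta {S X : Type w} (μ : Ultrafilter S) (ν : S → Ultrafilter X) {ρ : Ultrafilter X}
    (h : μ.bind ν = ρ) (M : X → A) :
    (D.prod ρ).obj M ⟶ (D.prod μ).obj fun s => (D.prod (ν s)).obj M :=
  (D.fubini μ ν ρ h.symm).app M

theorem delta_naturality {S X : Type w} (μ : Ultrafilter S) (ν : S → Ultrafilter X)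
    {ρ : Ultrafilter X} (h : μ.bind ν = ρ) {M N : X → A} (g : ∀ x, M x ⟶ N x) :
    D.mapFam ρ g ≫ D.delta μ ν h N =
      D.delta μ ν h M ≫ D.mapFam μ fun s => D.mapFam (ν s) g :=
  (D.fubini μ ν ρ h.symm).naturality g

/-- The component at `M` of the map `ε`. -/
def eps {X : Type w} (x₀ : X) (M : X → A) : (D.prod (pure x₀)).obj M ⟶ M x₀ :=
  (D.ε x₀).app M

theorem eps_naturality {X : Type w} (x₀ : X) {M N : X → A} (g : ∀ x, M x ⟶ N x) :
    D.mapFam (pure x₀) g ≫ D.eps x₀ N = D.eps x₀ M ≫ g x₀ :=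
  (D.ε x₀).naturality g

/-- Restriction along a function `f : X → Y`: the map `∫_Y M d(fμ) ⟶ ∫_X (M ∘ f) dμ` obtained from
the Fubini transform for the family of principal ultrafilters `δ_{f x}`. -/
def pull {X Y : Type w} (f : X → Y) (μ : Ultrafilter X) {ρ : Ultrafilter Y} (h : μ.map f = ρ)
    (M : Y → A) : (D.prod ρ).obj M ⟶ (D.prod μ).obj fun x => M (f x) :=
  D.delta μ (fun x => pure (f x)) ((UltraFamily.map_eq_bind f μ).symm.trans h) M ≫
    D.mapFam μ fun x => D.eps (f x) M

theorem pull_naturality {X Y : Type w} (f : X → Y) (μ : Ultrafilter X) {ρ : Ultrafilter Y}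
    (h : μ.map f = ρ) {M N : Y → A} (g : ∀ y, M y ⟶ N y) :
    D.mapFam ρ g ≫ D.pull f μ h N = D.pull f μ h M ≫ D.mapFam μ fun x => g (f x) := by
  simp only [pull, Category.assoc, mapFam_comp, ← eps_naturality]
  simp only [← mapFam_comp]
  rw [← Category.assoc, delta_naturality, Category.assoc]

/-- Equal legs give equal maps, although the target indices are only propositionally equal. -/
theorem pull_mapFam_congr {X Y : Type w} {μ : Ultrafilter X} {ρ : Ultrafilter Y} {M : Y → A}
    {N : X → A} {f f' : X → Y} {g : ∀ x, M (f x) ⟶ N x} {g' : ∀ x, M (f' x) ⟶ N x}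
    (e : ∀ x, (⟨f x, g x⟩ : Σ y, (M y ⟶ N x)) = ⟨f' x, g' x⟩) (h : μ.map f = ρ)
    (h' : μ.map f' = ρ) : D.pull f μ h M ≫ D.mapFam μ g = D.pull f' μ h' M ≫ D.mapFam μ g' := by
  obtain rfl : f = f' := funext fun x => congrArg Sigma.fst (e x)
  obtain rfl : g = g' := funext fun x => eq_of_heq (Sigma.mk.inj (e x)).2
  rfl

/-- The structure maps of the colax algebra associated with an ultracategory: the Fubini transform
on the disjoint union, followed by the restrictions along the inclusions of its parts. -/
def assocMap {S : Type w} {T : S → Type w} (μ : Ultrafilter S) (ν : ∀ s, Ultrafilter (T s))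
    (M : (Σ s, T s) → A) : (D.prod (UltraFamily.sigmaUf μ ν)).obj M ⟶
      (D.prod μ).obj fun s => (D.prod (ν s)).obj fun t => M ⟨s, t⟩ :=
  D.delta μ (fun s => (ν s).map (Sigma.mk s)) (UltraFamily.bind_map_mk μ ν) M ≫
    D.mapFam μ fun s => D.pull (Sigma.mk s) (ν s) rfl M

theorem assocMap_naturality {S : Type w} {T : S → Type w} (μ : Ultrafilter S)
    (ν : ∀ s, Ultrafilter (T s)) {M N : (Σ s, T s) → A} (g : ∀ p, M p ⟶ N p) :
    D.mapFam (UltraFamily.sigmaUf μ ν) g ≫ D.assocMap μ ν N =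
      D.assocMap μ ν M ≫ D.mapFam μ fun s => D.mapFam (ν s) fun t => g ⟨s, t⟩ := by
  simp only [assocMap, Category.assoc, mapFam_comp, ← pull_naturality]
  simp only [← mapFam_comp]
  rw [← Category.assoc, delta_naturality, Category.assoc]

variable {D}

namespace IsUltrastructure

theorem isIso_eps (hD : D.IsUltrastructure) {X : Type w} (x₀ : X) (M : X → A) :
    IsIso (D.eps x₀ M) :=
  have := hD.isIso_ε x₀
  inferInstanceAs (IsIso ((D.ε x₀).app M))

theorem delta_pure (hD : D.IsUltrastructure) {S X : Type w} (s₀ : S) (ν : S → Ultrafilter X)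
    (M : X → A) (h : (pure s₀ : Ultrafilter S).bind ν = ν s₀) :
    D.delta (pure s₀) ν h M ≫ D.eps s₀ (fun s => (D.prod (ν s)).obj M) = 𝟙 _ :=
  hD.fubini_pure s₀ ν M

/-- The axiom `fubini_fubini`. The composite ultrafilters are variables, so that it applies when they are equal but
not syntactically equal to the ones in the axiom. -/
theorem delta_delta (hD : D.IsUltrastructure) {R S X : Type w} (l : Ultrafilter R)
    (μ : R → Ultrafilter S) (ν : S → Ultrafilter X) {κ : R → Ultrafilter X} {ρ : Ultrafilter X}
    {ω : Ultrafilter S} (hκ : ∀ r, (μ r).bind ν = κ r) (hρ : l.bind κ = ρ) (hω : l.bind μ = ω)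
    (hρ' : ω.bind ν = ρ) (M : X → A) :
    D.delta l κ hρ M ≫ D.mapFam l (fun r => D.delta (μ r) ν (hκ r) M) =
      D.delta ω ν hρ' M ≫ D.delta l μ hω (fun s => (D.prod (ν s)).obj M) := by
  obtain rfl : (fun r => (μ r).bind ν) = κ := funext hκ
  subst hω hρ'
  exact hD.fubini_fubini l μ ν M

/-- Restricting the outer index of a Fubini transform. -/
theorem delta_pull (hD : D.IsUltrastructure) {S S' X : Type w} (f : S' → S) (μ : Ultrafilter S')
    {μ' : Ultrafilter S} (h : μ.map f = μ') (ν : S → Ultrafilter X) {ρ : Ultrafilter X}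
    (hρ : μ'.bind ν = ρ) (hρ' : μ.bind (fun s => ν (f s)) = ρ) (M : X → A) :
    D.delta μ' ν hρ M ≫ D.pull f μ h (fun s => (D.prod (ν s)).obj M) =
      D.delta μ (fun s => ν (f s)) hρ' M := by
  rw [pull, ← Category.assoc, ← hD.delta_delta μ (fun s => pure (f s)) ν
    (fun s => UltraFamily.bind_pure_left (f s) ν |>.symm) hρ' _ hρ M, Category.assoc, mapFam_comp]
  simp only [hD.delta_pure, mapFam_id, Category.comp_id]

/-- Restricting the inner index of a Fubini transform. -/
theorem pull_delta (hD : D.IsUltrastructure) {S X Y : Type w} (f : Y → X) (μ : Ultrafilter S)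
    (ν : S → Ultrafilter Y) {κ : S → Ultrafilter X} {ρ : Ultrafilter Y} {ρ' : Ultrafilter X}
    (hκ : ∀ s, (ν s).map f = κ s) (hρ : μ.bind ν = ρ) (hρ' : μ.bind κ = ρ') (h : ρ.map f = ρ')
    (M : X → A) :
    D.pull f ρ h M ≫ D.delta μ ν hρ (fun y => M (f y)) =
      D.delta μ κ hρ' M ≫ D.mapFam μ fun s => D.pull f (ν s) (hκ s) M := by
  simp only [pull, Category.assoc, delta_naturality]
  rw [← Category.assoc, ← hD.delta_delta μ ν (fun y => pure (f y))
    (fun s => (UltraFamily.map_eq_bind f (ν s)).symm.trans (hκ s)) hρ' hρ, Category.assoc,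
    mapFam_comp]

theorem pull_pull (hD : D.IsUltrastructure) {X Y Z : Type w} (f : X → Y) (g : Y → Z)
    (μ : Ultrafilter X) {ν : Ultrafilter Y} {ρ : Ultrafilter Z} (h : μ.map f = ν)
    (h' : ν.map g = ρ) (h'' : μ.map (fun x => g (f x)) = ρ) (M : Z → A) :
    D.pull g ν h' M ≫ D.pull f μ h (fun y => M (g y)) = D.pull (fun x => g (f x)) μ h'' M := by
  rw [pull, Category.assoc, pull_naturality, ← Category.assoc,
    hD.delta_pull f μ h (fun y => pure (g y)) _ ((UltraFamily.map_eq_bind _ μ).symm.trans h''), ← pull]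

theorem isIso_pull (hD : D.IsUltrastructure) {X Y : Type w} (f : X → Y)
    (hf : Function.Injective f) (μ : Ultrafilter X) {ρ : Ultrafilter Y} (h : μ.map f = ρ)
    (M : Y → A) : IsIso (D.pull f μ h M) := by
  subst h
  have : IsIso (D.delta μ (fun x => pure (f x)) (UltraFamily.map_eq_bind f μ).symm M) :=
    hD.isIso_fubini f hf μ M
  have := D.isIso_mapFam μ (fun x => D.eps (f x) M) fun x => hD.isIso_eps _ _
  rw [pull]
  infer_instance

/-- Restriction along an identity is idempotent by functoriality and invertible by the axiom on
injections, hence the identity. -/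
theorem pull_id (hD : D.IsUltrastructure) {X : Type w} (μ : Ultrafilter X)
    (h : μ.map (fun x => x) = μ) (M : X → A) : D.pull (fun x => x) μ h M = 𝟙 _ := by
  have := hD.isIso_pull (fun x => x) (fun _ _ h => h) μ h M
  rw [← cancel_epi (D.pull (fun x => x) μ h M), hD.pull_pull _ _ _ _ _ h, Category.comp_id]

/-- Restriction is compatible with `ε`: this is `fubini_pure` for the principal ultrafilter at `x₀`. -/
theorem pull_eps (hD : D.IsUltrastructure) {X Y : Type w} (f : X → Y) (x₀ : X)
    (h : (pure x₀ : Ultrafilter X).map f = pure (f x₀)) (M : Y → A) :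
    D.pull f (pure x₀) h M ≫ D.eps x₀ (fun x => M (f x)) = D.eps (f x₀) M := by
  rw [pull, Category.assoc, eps_naturality, ← Category.assoc]
  exact (congrArg (· ≫ _) (hD.delta_pure x₀ (fun x => pure (f x)) M _)).trans (Category.id_comp _)

/-- A family of functions `g s : T s → X` amounts to a function on the disjoint union. Restricting
along the latter and applying the structure map is the same as applying the Fubini transform and
restricting along each `g s`. -/
theorem pull_assocMap (hD : D.IsUltrastructure) {S X : Type w} {T : S → Type w}
    (g : ∀ s, T s → X) (μ : Ultrafilter S) (ν : ∀ s, Ultrafilter (T s)) {κ : S → Ultrafilter X}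
    {ρ : Ultrafilter X} (hκ : ∀ s, (ν s).map (g s) = κ s) (hρ : μ.bind κ = ρ)
    (h : (UltraFamily.sigmaUf μ ν).map (fun p => g p.1 p.2) = ρ) (M : X → A) :
    D.pull (fun p : Σ s, T s => g p.1 p.2) (UltraFamily.sigmaUf μ ν) h M ≫
        D.assocMap μ ν (fun p => M (g p.1 p.2)) =
      D.delta μ κ hρ M ≫ D.mapFam μ fun s => D.pull (g s) (ν s) (hκ s) M := by
  rw [assocMap, ← Category.assoc, hD.pull_delta (fun p : Σ s, T s => g p.1 p.2) μ
    (fun s => (ν s).map (Sigma.mk s)) (κ := κ) hκ _ hρ h, Category.assoc, mapFam_comp]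
  refine congrArg (_ ≫ ·) (congrArg (D.mapFam μ) (funext fun s => ?_))
  exact hD.pull_pull (Sigma.mk s) (fun p : Σ s, T s => g p.1 p.2) (ν s) rfl (hκ s) (hκ s) M

end IsUltrastructure
end UltraData

/-! ### Morphisms of the ultracompletion -/

namespace UltraFamily

theorem map_sigmaUf_sigmaUf {S S' : Type w} {T : S → Type w} {T' : S' → Type w}
    {μ : Ultrafilter S} {μ' : Ultrafilter S'} {ν : ∀ s, Ultrafilter (T s)}
    {ν' : ∀ s, Ultrafilter (T' s)} (f : S' → S) (hf : μ'.map f = μ) (f' : ∀ s, T' s → T (f s))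
    (hf' : ∀ s, (ν' s).map (f' s) = ν (f s)) :
    (sigmaUf μ' ν').map (fun p => (⟨f p.1, f' p.1 p.2⟩ : Σ s, T s)) = sigmaUf μ ν := by
  refine Ultrafilter.ext fun U => ?_
  rw [Ultrafilter.mem_map, mem_sigmaUf_iff, mem_sigmaUf_iff, ← hf, Ultrafilter.mem_map]
  refine iff_of_eq (congrArg (· ∈ μ') (Set.ext fun s => ?_))
  refine Iff.trans ?_ (iff_of_eq (congrArg (fun ω : Ultrafilter (T (f s)) =>
    {t | (⟨f s, t⟩ : Σ s, T s) ∈ U} ∈ ω) (hf' s)))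
  rfl

theorem map_multObj {C : Type u'}
    {X Y : UltraFamily.{w} (UltraFamily.{w} C)} (f : Y.idx → X.idx)
    (hf : Y.uf.map f = X.uf) (f' : ∀ y, (Y.fam y).idx → (X.fam (f y)).idx)
    (hf' : ∀ y, (Y.fam y).uf.map (f' y) = (X.fam (f y)).uf) :
    (multObj Y).uf.map (fun p => (⟨f p.1, f' p.1 p.2⟩ : (multObj X).idx)) = (multObj X).uf :=
  map_sigmaUf_sigmaUf (T := fun x => (X.fam x).idx) (T' := fun y => (Y.fam y).idx)
    (ν := fun x => (X.fam x).uf) (ν' := fun y => (Y.fam y).uf) f hf f' hf'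

section

variable {C : Type u'} [Category.{v'} C]

theorem homOfMap_congr {X Y : UltraFamily.{w} C} {f f' : Y.idx → X.idx}
    {hf : Y.uf.map f = X.uf} {hf' : Y.uf.map f' = X.uf} {g : ∀ y, X.fam (f y) ⟶ Y.fam y}
    {g' : ∀ y, X.fam (f' y) ⟶ Y.fam y}
    (e : ∀ y, (⟨f y, g y⟩ : Σ x, (X.fam x ⟶ Y.fam y)) = ⟨f' y, g' y⟩) :
    homOfMap f hf g = homOfMap f' hf' g' :=
  PreHom.toHom_eq (Filter.univ_mem' fun y => ⟨trivial, trivial, e y⟩)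

/-- Equality of total morphisms, with the components compared heterogeneously as they lie over
indices that are only propositionally equal. -/
theorem homOfMap_congr_of_eq {X Y : UltraFamily.{w} C} {f f' : Y.idx → X.idx}
    {hf : Y.uf.map f = X.uf} {hf' : Y.uf.map f' = X.uf} {g : ∀ y, X.fam (f y) ⟶ Y.fam y}
    {g' : ∀ y, X.fam (f' y) ⟶ Y.fam y} (e : ∀ y, f y = f' y) (e' : ∀ y, HEq (g y) (g' y)) :
    homOfMap f hf g = homOfMap f' hf' g' :=
  homOfMap_congr fun y => Sigma.ext (e y) (e' y)

/-- The inverse of the morphism given by an injection `j : I → Y` is defined on the range of `j`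
only. -/
theorem isIso_homOfMap_of_injective {I : Type w} (ζ : Ultrafilter I) (Y : UltraFamily.{w} C)
    (j : I → Y.idx) (hj : ζ.map j = Y.uf) (inj : Function.Injective j) :
    IsIso (homOfMap (X := Y) (Y := ⟨I, ζ, fun i => Y.fam (j i)⟩) j hj fun _ => 𝟙 _) := by
  have hr : Set.range j ∈ Y.uf := by
    rw [← hj, Ultrafilter.mem_map]
    exact Filter.univ_mem' fun i => ⟨i, rfl⟩
  have hv : ∀ (U : Set I) (y : Y.idx) (h : y ∈ Set.range j), h.choose ∈ U ↔ y ∈ j '' U := by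
    rintro U y h
    constructor
    · exact fun hU => ⟨_, hU, h.choose_spec⟩
    · rintro ⟨i, hi, rfl⟩
      rwa [inj h.choose_spec]
  -- the value at `y ∈ range j` is the preimage of `y`, and the morphism there is a transport
  let k : PreHom (⟨I, ζ, fun i => Y.fam (j i)⟩ : UltraFamily.{w} C) Y :=
    { dom := Set.range j
      dom_mem := hr
      fn := fun y h => h.choose
      map_eq := fun U => by
        have : {y | ∃ h : y ∈ Set.range j, h.choose ∈ U} = j '' U := by
          ext y
          exact ⟨fun ⟨h, h'⟩ => (hv U y h).1 h', fun h =>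
            ⟨Set.image_subset_range j U h, (hv U y _).2 h⟩⟩
        rw [this, ← hj, Ultrafilter.mem_map, Set.preimage_image_eq U inj]
      hom := fun y h => eqToHom (congrArg Y.fam h.choose_spec) }
  refine ⟨k.toHom, ?_, ?_⟩
  · refine PreHom.toHom_eq (Filter.mem_of_superset hr fun y h => ⟨⟨h, trivial⟩, trivial, ?_⟩)
    refine Sigma.ext h.choose_spec ?_
    have : ∀ (z : Y.idx) (e : z = y), HEq (𝟙 (Y.fam z) ≫ eqToHom (congrArg Y.fam e))
        (𝟙 (Y.fam y)) := by
      rintro z rfl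
      simp
    exact this _ h.choose_spec
  · refine PreHom.toHom_eq (Filter.univ_mem' fun i => ⟨⟨trivial, ⟨i, rfl⟩⟩, trivial, ?_⟩)
    have h : j i ∈ Set.range j := ⟨i, rfl⟩
    have : ∀ (i' : I) (e : i' = i), (⟨i', eqToHom (congrArg (fun i => Y.fam (j i)) e) ≫ 𝟙 _⟩ :
        Σ x : I, (Y.fam (j x) ⟶ Y.fam (j i))) = ⟨i, 𝟙 _⟩ := by
      rintro i' rfl
      simp
    exact this _ (inj h.choose_spec)

/-- The restriction of an ultrafilter to one of its members. -/
noncomputable def restrictUf {I : Type w} (μ : Ultrafilter I) (E : Set I) (hE : E ∈ μ) :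
    Ultrafilter E :=
  μ.comap Subtype.val_injective (by rwa [Subtype.range_coe])

theorem mem_restrictUf_iff {I : Type w} (μ : Ultrafilter I) (E : Set I) (hE : E ∈ μ) (U : Set E) :
    U ∈ restrictUf μ E hE ↔ Subtype.val '' U ∈ μ :=
  Ultrafilter.mem_comap _ _ _

theorem map_val_restrictUf {I : Type w} (μ : Ultrafilter I) (E : Set I) (hE : E ∈ μ) :
    (restrictUf μ E hE).map Subtype.val = μ := by
  refine Ultrafilter.ext fun U => ?_
  rw [Ultrafilter.mem_map, mem_restrictUf_iff, Subtype.image_preimage_coe]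
  exact ⟨fun h => Filter.mem_of_superset h Set.inter_subset_right,
    fun h => Filter.inter_mem hE h⟩

theorem map_injective_of_injective {I J : Type w} {j : I → J} (inj : Function.Injective j) :
    Function.Injective (Ultrafilter.map j) := fun _ _ h =>
  Ultrafilter.coe_injective (Filter.map_injective inj (congrArg (fun ω : Ultrafilter J =>
    (ω : Filter J)) h))

namespace PreHom

variable {X Y : UltraFamily.{w} C} (f : PreHom X Y)

/-- The ultrafilter on the domain of a representative induced by the one of the target. -/
noncomputable def domUf : Ultrafilter f.dom :=
  restrictUf Y.uf f.dom f.dom_mem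

theorem map_val_domUf : f.domUf.map Subtype.val = Y.uf :=
  map_val_restrictUf _ _ _

theorem map_fn_domUf : f.domUf.map (fun y => f.fn y.1 y.2) = X.uf := by
  refine Ultrafilter.ext fun U => ?_
  rw [Ultrafilter.mem_map, domUf, mem_restrictUf_iff, f.map_eq]
  refine iff_of_eq (congrArg (· ∈ Y.uf) ?_)
  ext y
  simp

theorem toHom_comp_homOfMap_val :
    f.toHom ≫ homOfMap (X := Y) (Y := ⟨f.dom, f.domUf, fun y => Y.fam y.1⟩) Subtype.val
        f.map_val_domUf (fun _ => 𝟙 _) =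
      homOfMap (X := X) (Y := ⟨f.dom, f.domUf, fun y => Y.fam y.1⟩) (fun y => f.fn y.1 y.2)
        f.map_fn_domUf fun y => f.hom y.1 y.2 :=
  PreHom.toHom_eq (Filter.univ_mem' fun y => ⟨⟨trivial, y.2⟩, trivial,
    congrArg (Sigma.mk _) (Category.comp_id _)⟩)

end PreHom

/-- Every morphism becomes total after restriction to a large subset of the target's index set, and
this restriction is an isomorphism. -/
theorem exists_total {X Y : UltraFamily.{w} C} (f : X ⟶ Y) :
    ∃ (I : Type w) (ζ : Ultrafilter I) (j : I → Y.idx) (hj : ζ.map j = Y.uf) (p : I → X.idx)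
      (hp : ζ.map p = X.uf) (k : ∀ i, X.fam (p i) ⟶ Y.fam (j i)),
      IsIso (homOfMap (X := Y) (Y := ⟨I, ζ, fun i => Y.fam (j i)⟩) j hj fun _ => 𝟙 _) ∧
      f ≫ homOfMap (X := Y) (Y := ⟨I, ζ, fun i => Y.fam (j i)⟩) j hj (fun _ => 𝟙 _) =
        homOfMap (X := X) (Y := ⟨I, ζ, fun i => Y.fam (j i)⟩) p hp k := by
  induction f using Quotient.inductionOn with | _ f
  exact ⟨f.dom, f.domUf, Subtype.val, f.map_val_domUf, fun y => f.fn y.1 y.2, f.map_fn_domUf,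
    fun y => f.hom y.1 y.2, isIso_homOfMap_of_injective _ _ _ _ Subtype.val_injective,
    f.toHom_comp_homOfMap_val⟩

/-- If `φ` is natural at an isomorphism `t` and at `f ≫ t`, then it is natural at `f`. -/
theorem naturality_of_comp_isIso {C : Type*} [Category* C] {E : Type*} [Category* E] {G H : C ⥤ E}
    (φ : ∀ X, G.obj X ⟶ H.obj X) {X Y Z : C} {f : X ⟶ Y} {t : Y ⟶ Z} {k : X ⟶ Z} [IsIso t]
    (e : f ≫ t = k) (ht : G.map t ≫ φ Z = φ Y ≫ H.map t)
    (hk : G.map k ≫ φ Z = φ X ≫ H.map k) : G.map f ≫ φ Y = φ X ≫ H.map f := by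
  subst e
  rw [← cancel_mono (H.map t), Category.assoc, ← ht, ← Category.assoc, ← G.map_comp, hk,
    Category.assoc, H.map_comp]

/-- Naturality on the ultracompletion can be checked on total morphisms. -/
theorem naturality_of_total {E : Type*} [Category* E] {G H : UltraFamily.{w} C ⥤ E}
    (φ : ∀ X, G.obj X ⟶ H.obj X)
    (hφ : ∀ (X Y : UltraFamily.{w} C) (f : Y.idx → X.idx) (hf : Y.uf.map f = X.uf)
      (g : ∀ y, X.fam (f y) ⟶ Y.fam y),
      G.map (homOfMap f hf g) ≫ φ Y = φ X ≫ H.map (homOfMap f hf g))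
    {X Y : UltraFamily.{w} C} (f : X ⟶ Y) : G.map f ≫ φ Y = φ X ≫ H.map f := by
  obtain ⟨I, ζ, j, hj, p, hp, k, h, e⟩ := exists_total f
  exact naturality_of_comp_isIso φ e (hφ _ _ _ _ _) (hφ _ _ _ _ _)

/-- Naturality on the ultracompletion of the ultracompletion can be checked on total families of
total morphisms. -/
theorem naturality_of_total_total {E : Type*} [Category* E]
    {G H : UltraFamily.{w} (UltraFamily.{w} C) ⥤ E} (φ : ∀ X, G.obj X ⟶ H.obj X)
    (hφ : ∀ (X Y : UltraFamily.{w} (UltraFamily.{w} C)) (f : Y.idx → X.idx)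
      (hf : Y.uf.map f = X.uf) (f' : ∀ y, (Y.fam y).idx → (X.fam (f y)).idx)
      (hf' : ∀ y, (Y.fam y).uf.map (f' y) = (X.fam (f y)).uf)
      (g : ∀ y x, (X.fam (f y)).fam (f' y x) ⟶ (Y.fam y).fam x),
      G.map (homOfMap f hf fun y => homOfMap (f' y) (hf' y) (g y)) ≫ φ Y =
        φ X ≫ H.map (homOfMap f hf fun y => homOfMap (f' y) (hf' y) (g y)))
    {X Y : UltraFamily.{w} (UltraFamily.{w} C)} (f : X ⟶ Y) : G.map f ≫ φ Y = φ X ≫ H.map f := by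
  refine naturality_of_total φ (fun X Y f hf g => ?_) f
  -- the isomorphism `t` replaces every member of the family `Y` by a restriction on which `g y`
  -- becomes total
  choose I ζ j hj p hp k h e using fun y => exists_total (g y)
  let Y' : UltraFamily.{w} (UltraFamily.{w} C) :=
    ⟨Y.idx, Y.uf, fun y => ⟨I y, ζ y, fun i => (Y.fam y).fam (j y i)⟩⟩
  let t : Y ⟶ Y' := homOfMap (X := Y) (Y := Y') id (Ultrafilter.map_id _) fun y =>
    homOfMap (X := Y.fam y) (Y := Y'.fam y) (j y) (hj y) fun _ => 𝟙 _
  have : IsIso t := by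
    refine ⟨homOfMap (X := Y') (Y := Y) id (Ultrafilter.map_id _) fun y =>
      inv (homOfMap (X := Y.fam y) (Y := Y'.fam y) (j y) (hj y) fun _ => 𝟙 _), ?_, ?_⟩
    · refine (homOfMap_comp _ _ _ _ _ _).trans (homOfMap_congr_of_eq (fun _ => rfl) fun y => ?_)
      exact heq_of_eq (IsIso.hom_inv_id _)
    · refine (homOfMap_comp _ _ _ _ _ _).trans (homOfMap_congr_of_eq (fun _ => rfl) fun y => ?_)
      exact heq_of_eq (IsIso.inv_hom_id _)
  refine naturality_of_comp_isIso φ (t := t) (k := homOfMap (X := X) (Y := Y') f hf fun y =>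
    homOfMap (X := X.fam (f y)) (Y := Y'.fam y) (p y) (hp y) (k y)) ?_ (hφ _ _ _ _ _ _ _)
    (hφ _ _ _ _ _ _ _)
  refine (homOfMap_comp _ _ _ _ _ _).trans (homOfMap_congr_of_eq (fun _ => rfl) fun y => ?_)
  exact heq_of_eq (e y)

end

end UltraFamily

/-! ### The colax algebra of an ultracategory -/

namespace UltraData.IsUltrastructure

variable {A : Type u} [Category.{v} A] {D : UltraData.{w} A}

open UltraFamily

/-- The action of a representative of a morphism of the ultracompletion: restrict along the partial
function, apply the family of morphisms, and undo the restriction to the domain. -/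
noncomputable def actPre (hD : D.IsUltrastructure) {X Y : UltraFamily.{w} A} (f : PreHom X Y) :
    (D.prod X.uf).obj X.fam ⟶ (D.prod Y.uf).obj Y.fam :=
  haveI := hD.isIso_pull Subtype.val Subtype.val_injective f.domUf f.map_val_domUf Y.fam
  D.pull (fun y => f.fn y.1 y.2) f.domUf f.map_fn_domUf X.fam ≫
    D.mapFam f.domUf (fun y => f.hom y.1 y.2) ≫
      inv (D.pull Subtype.val f.domUf f.map_val_domUf Y.fam)

theorem actPre_pull_val (hD : D.IsUltrastructure) {X Y : UltraFamily.{w} A} (f : PreHom X Y) :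
    hD.actPre f ≫ D.pull Subtype.val f.domUf f.map_val_domUf Y.fam =
      D.pull (fun y => f.fn y.1 y.2) f.domUf f.map_fn_domUf X.fam ≫
        D.mapFam f.domUf (fun y => f.hom y.1 y.2) := by
  have := hD.isIso_pull Subtype.val Subtype.val_injective f.domUf f.map_val_domUf Y.fam
  simp [actPre]

/-- If `f` becomes the total morphism with legs `k z : X (p z) ⟶ Y (j z)` after restriction along
`j`, then so does its action. As restriction along an injection is invertible, this determines the
action. -/
theorem actPre_pull (hD : D.IsUltrastructure) {X Y : UltraFamily.{w} A} (f : PreHom X Y)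
    {Z : Type w} (ζ : Ultrafilter Z) (j : Z → Y.idx) (hj : ζ.map j = Y.uf) (p : Z → X.idx)
    (hp : ζ.map p = X.uf) (k : ∀ z, X.fam (p z) ⟶ Y.fam (j z))
    (e : ∀ᶠ z in (ζ : Filter Z), ∃ h : j z ∈ f.dom, f.leg (j z) h = ⟨p z, k z⟩) :
    hD.actPre f ≫ D.pull j ζ hj Y.fam = D.pull p ζ hp X.fam ≫ D.mapFam ζ k := by
  let E : Set Z := {z | ∃ h : j z ∈ f.dom, f.leg (j z) h = ⟨p z, k z⟩}
  let ξ : Ultrafilter E := restrictUf ζ E e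
  have hq : ξ.map Subtype.val = ζ := map_val_restrictUf ζ E e
  let r : E → f.dom := fun z => ⟨j z.1, z.2.1⟩
  have hjq : ξ.map (fun z => j z.1) = Y.uf := by
    rw [← hj, ← hq, Ultrafilter.map_map]; rfl
  have hr : ξ.map r = f.domUf := by
    refine map_injective_of_injective Subtype.val_injective ?_
    rw [f.map_val_domUf, ← hjq, Ultrafilter.map_map]; rfl
  have hpq : ξ.map (fun z => p z.1) = X.uf := by
    rw [← hp, ← hq, Ultrafilter.map_map]; rfl
  have hfr : ξ.map (fun z => f.fn (r z).1 (r z).2) = X.uf := by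
    rw [← f.map_fn_domUf, ← hr, Ultrafilter.map_map]; rfl
  -- it suffices to compare after restriction to the large set `E` on which the legs agree
  have := hD.isIso_pull Subtype.val Subtype.val_injective ξ hq fun z => Y.fam (j z)
  rw [← cancel_mono (D.pull Subtype.val ξ hq fun z => Y.fam (j z)), Category.assoc,
    hD.pull_pull Subtype.val j ξ hq hj hjq, Category.assoc, pull_naturality, ← Category.assoc,
    hD.pull_pull Subtype.val p ξ hq hp hpq, ← hD.pull_pull r Subtype.val ξ hr f.map_val_domUf hjq,
    ← Category.assoc, actPre_pull_val, Category.assoc, pull_naturality, ← Category.assoc,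
    hD.pull_pull r (fun y => f.fn y.1 y.2) ξ hr f.map_fn_domUf hfr]
  exact D.pull_mapFam_congr (fun z => z.2.2) _ _

theorem actPre_eq_of_rel (hD : D.IsUltrastructure) {X Y : UltraFamily.{w} A} {f g : PreHom X Y}
    (r : PreHom.Rel f g) : hD.actPre f = hD.actPre g := by
  have := hD.isIso_pull Subtype.val Subtype.val_injective g.domUf g.map_val_domUf Y.fam
  rw [← cancel_mono (D.pull Subtype.val g.domUf g.map_val_domUf Y.fam), actPre_pull_val]
  refine hD.actPre_pull f _ _ _ _ _ _ ?_
  have : ∀ᶠ y in (g.domUf.map Subtype.val : Filter Y.idx),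
      ∃ (h : y ∈ f.dom) (h' : y ∈ g.dom), f.leg y h = g.leg y h' := by
    have h := g.map_val_domUf
    exact (congrArg (fun ω : Ultrafilter Y.idx => ∀ᶠ y in (ω : Filter Y.idx),
      ∃ (h : y ∈ f.dom) (h' : y ∈ g.dom), f.leg y h = g.leg y h') h).mpr r
  exact Filter.Eventually.mono (Filter.eventually_map.1 this) fun y ⟨h, h', e⟩ => ⟨h, e⟩

theorem actPre_ofMap (hD : D.IsUltrastructure) {X Y : UltraFamily.{w} A} (f : Y.idx → X.idx)
    (hf : Y.uf.map f = X.uf) (g : ∀ y, X.fam (f y) ⟶ Y.fam y) :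
    hD.actPre (PreHom.ofMap f hf g) = D.pull f Y.uf hf X.fam ≫ D.mapFam Y.uf g := by
  have := hD.actPre_pull (PreHom.ofMap f hf g) Y.uf (fun y => y) (Ultrafilter.map_id' _) f hf g
    (Filter.univ_mem' fun y => ⟨trivial, rfl⟩)
  rwa [hD.pull_id, Category.comp_id] at this

/-- After restriction to the domain of the composite, both sides are computed by `actPre_pull`; for
`f` it is applied to the restriction of the partial function of `g`, which need not be injective. -/
theorem actPre_comp (hD : D.IsUltrastructure) {X Y Z : UltraFamily.{w} A} (f : PreHom X Y)
    (g : PreHom Y Z) : hD.actPre (f.comp g) = hD.actPre f ≫ hD.actPre g := by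
  have hi := hD.isIso_pull Subtype.val Subtype.val_injective (f.comp g).domUf
    (f.comp g).map_val_domUf Z.fam
  have hg : (f.comp g).domUf.map (fun z => g.fn z.1 z.2.1) = Y.uf := by
    rw [← g.map_fn_domUf]
    have : (f.comp g).domUf.map (fun z => (⟨z.1, z.2.1⟩ : g.dom)) = g.domUf := by
      refine map_injective_of_injective Subtype.val_injective ?_
      rw [g.map_val_domUf, ← (f.comp g).map_val_domUf, Ultrafilter.map_map]; rfl
    rw [← this, Ultrafilter.map_map]; rfl
  rw [← cancel_mono (D.pull Subtype.val (f.comp g).domUf (f.comp g).map_val_domUf Z.fam),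
    Category.assoc, actPre_pull_val, hD.actPre_pull g (f.comp g).domUf Subtype.val
      (f.comp g).map_val_domUf (fun z => g.fn z.1 z.2.1) hg (fun z => g.hom z.1 z.2.1)
      (Filter.univ_mem' fun z => ⟨z.2.1, rfl⟩), ← Category.assoc,
    hD.actPre_pull f (f.comp g).domUf (fun z => g.fn z.1 z.2.1) hg
      (fun z => f.fn (g.fn z.1 z.2.1) z.2.2) (f.comp g).map_fn_domUf
      (fun z => f.hom (g.fn z.1 z.2.1) z.2.2)
      (Filter.univ_mem' fun z => ⟨z.2.2, rfl⟩), Category.assoc, mapFam_comp]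
  rfl

/-- The action `m : T A ⥤ A` associated with an ultrastructure. -/
noncomputable def action (hD : D.IsUltrastructure) : UltraFamily.{w} A ⥤ A where
  obj X := (D.prod X.uf).obj X.fam
  map {X Y} f := Quotient.lift (s := PreHom.setoid X Y) hD.actPre
    (fun _ _ r => hD.actPre_eq_of_rel r) f
  map_id X := (hD.actPre_ofMap id (Ultrafilter.map_id _) _).trans (by
    rw [mapFam_id, Category.comp_id]
    exact hD.pull_id _ _ _)
  map_comp f g := by
    induction f using Quotient.inductionOn with | _ f
    induction g using Quotient.inductionOn with | _ g
    exact hD.actPre_comp f g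

theorem action_map_homOfMap (hD : D.IsUltrastructure) {X Y : UltraFamily.{w} A}
    (f : Y.idx → X.idx) (hf : Y.uf.map f = X.uf) (g : ∀ y, X.fam (f y) ⟶ Y.fam y) :
    hD.action.map (homOfMap f hf g) = D.pull f Y.uf hf X.fam ≫ D.mapFam Y.uf g :=
  hD.actPre_ofMap f hf g

theorem action_map_homOfMap_id (hD : D.IsUltrastructure) {I : Type w} (μ : Ultrafilter I)
    {M N : I → A} (g : ∀ x, M x ⟶ N x) :
    hD.action.map (homOfMap (X := ⟨I, μ, M⟩) (Y := ⟨I, μ, N⟩) id (Ultrafilter.map_id _) g) =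
      D.mapFam μ g :=
  (hD.action_map_homOfMap _ _ _).trans ((congrArg (· ≫ _) (hD.pull_id _ _ _)).trans
    (Category.id_comp _))

/-- The action of a reindexing morphism is a restriction. -/
theorem action_map_reindex (hD : D.IsUltrastructure) {I : Type w} (μ : Ultrafilter I)
    (X : UltraFamily.{w} A) (f : I → X.idx) (hf : μ.map f = X.uf) :
    hD.action.map (homOfMap (X := X) (Y := ⟨I, μ, fun i => X.fam (f i)⟩) f hf fun _ => 𝟙 _) =
      D.pull f μ hf X.fam :=
  (hD.action_map_homOfMap _ _ _).trans ((congrArg (_ ≫ ·) (D.mapFam_id _ _)).trans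
    (Category.comp_id _))

/-- Naturality of the structure maps at a total family of total morphisms. -/
theorem assocMap_total_naturality (hD : D.IsUltrastructure) {S S' : Type w} {T : S → Type w}
    {T' : S' → Type w} {μ : Ultrafilter S} {μ' : Ultrafilter S'} {ν : ∀ s, Ultrafilter (T s)}
    {ν' : ∀ s, Ultrafilter (T' s)} {M : (Σ s, T s) → A} {N : (Σ s, T' s) → A} (f : S' → S)
    (hf : μ'.map f = μ) (f' : ∀ s, T' s → T (f s)) (hf' : ∀ s, (ν' s).map (f' s) = ν (f s))
    (g : ∀ s t, M ⟨f s, f' s t⟩ ⟶ N ⟨s, t⟩) :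
    (D.pull (fun p : Σ s, T' s => (⟨f p.1, f' p.1 p.2⟩ : Σ s, T s)) (sigmaUf μ' ν')
        (map_sigmaUf_sigmaUf f hf f' hf') M ≫ D.mapFam (sigmaUf μ' ν') fun p => g p.1 p.2) ≫
        D.assocMap μ' ν' N =
      D.assocMap μ ν M ≫ D.pull f μ' hf (fun s => (D.prod (ν s)).obj fun t => M ⟨s, t⟩) ≫
        D.mapFam μ' fun s =>
          D.pull (f' s) (ν' s) (hf' s) (fun t => M ⟨f s, t⟩) ≫ D.mapFam (ν' s) (g s) := by
  have h₁ : (μ.bind fun s => (ν s).map (Sigma.mk s)) = sigmaUf μ ν := bind_map_mk μ ν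
  have h₂ : (μ'.bind fun s => (ν (f s)).map (Sigma.mk (f s))) = sigmaUf μ ν := by
    rw [← h₁, ← hf]; rfl
  have h₃ : ∀ s, (ν' s).map (fun t => (⟨f s, f' s t⟩ : Σ s, T s)) =
      (ν (f s)).map (Sigma.mk (f s)) := fun s => by
    rw [← hf', Ultrafilter.map_map]; rfl
  have key := hD.pull_assocMap (fun s t => (⟨f s, f' s t⟩ : Σ s, T s)) μ' ν' h₃ h₂
    (map_sigmaUf_sigmaUf f hf f' hf') M
  rw [Category.assoc, assocMap_naturality, ← Category.assoc, key, Category.assoc, mapFam_comp,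
    assocMap, Category.assoc, ← Category.assoc (D.mapFam μ _), pull_naturality,
    Category.assoc (D.pull f μ' hf _), mapFam_comp, ← Category.assoc (D.delta μ _ _ M),
    hD.delta_pull f μ' hf (fun s => (ν s).map (Sigma.mk s)) h₁ h₂]
  refine congrArg (_ ≫ ·) (congrArg (D.mapFam μ') (funext fun s => ?_))
  rw [← Category.assoc, hD.pull_pull (f' s) (Sigma.mk (f s)) (ν' s) (hf' s) rfl (h₃ s)]

/-- The component at `X` of the associator of the colax algebra associated with an
ultrastructure. -/
def assocApp (hD : D.IsUltrastructure) (X : UltraFamily.{w} (UltraFamily.{w} A)) :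
    (mult A ⋙ hD.action).obj X ⟶ (map hD.action ⋙ hD.action).obj X :=
  D.assocMap X.uf (fun x => (X.fam x).uf) (multObj X).fam

theorem action_map_mult_total (hD : D.IsUltrastructure)
    {X Y : UltraFamily.{w} (UltraFamily.{w} A)} (f : Y.idx → X.idx)
    (hf : Y.uf.map f = X.uf) (f' : ∀ y, (Y.fam y).idx → (X.fam (f y)).idx)
    (hf' : ∀ y, (Y.fam y).uf.map (f' y) = (X.fam (f y)).uf)
    (g : ∀ y x, (X.fam (f y)).fam (f' y x) ⟶ (Y.fam y).fam x) :
    (mult A ⋙ hD.action).map (homOfMap f hf fun y => homOfMap (f' y) (hf' y) (g y)) =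
      D.pull (fun p => (⟨f p.1, f' p.1 p.2⟩ : (multObj X).idx)) (multObj Y).uf
        (map_multObj f hf f' hf') (multObj X).fam ≫
        D.mapFam (multObj Y).uf fun p => g p.1 p.2 :=
  (congrArg hD.action.map (multMap_homOfMap f hf f' hf'
    (map_multObj f hf f' hf') g)).trans (hD.action_map_homOfMap _ _ _)

theorem action_map_map_total (hD : D.IsUltrastructure)
    {X Y : UltraFamily.{w} (UltraFamily.{w} A)} (f : Y.idx → X.idx)
    (hf : Y.uf.map f = X.uf) (f' : ∀ y, (Y.fam y).idx → (X.fam (f y)).idx)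
    (hf' : ∀ y, (Y.fam y).uf.map (f' y) = (X.fam (f y)).uf)
    (g : ∀ y x, (X.fam (f y)).fam (f' y x) ⟶ (Y.fam y).fam x) :
    (map hD.action ⋙ hD.action).map (homOfMap f hf fun y => homOfMap (f' y) (hf' y) (g y)) =
      D.pull f Y.uf hf (fun x => (D.prod (X.fam x).uf).obj (X.fam x).fam) ≫
        D.mapFam Y.uf fun y => D.pull (f' y) (Y.fam y).uf (hf' y) (X.fam (f y)).fam ≫
          D.mapFam (Y.fam y).uf (g y) :=
  (hD.action_map_homOfMap (X := (map hD.action).obj X) (Y := (map hD.action).obj Y) f hf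
    fun y => hD.action.map (homOfMap (f' y) (hf' y) (g y))).trans
    (congrArg (_ ≫ ·) (congrArg (D.mapFam Y.uf)
      (funext fun y => hD.action_map_homOfMap (f' y) (hf' y) (g y))))

theorem assocApp_naturality (hD : D.IsUltrastructure)
    {X Y : UltraFamily.{w} (UltraFamily.{w} A)} (f : X ⟶ Y) :
    (mult A ⋙ hD.action).map f ≫ hD.assocApp Y =
      hD.assocApp X ≫ (map hD.action ⋙ hD.action).map f :=
  naturality_of_total_total (G := mult A ⋙ hD.action) (H := map hD.action ⋙ hD.action)
    hD.assocApp (fun X Y f hf f' hf' g => by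
      rw [action_map_mult_total, action_map_map_total]
      exact hD.assocMap_total_naturality (T := fun x => (X.fam x).idx)
        (T' := fun y => (Y.fam y).idx) (ν := fun x => (X.fam x).uf) (ν' := fun y => (Y.fam y).uf)
        (M := (multObj X).fam) (N := (multObj Y).fam) f hf f' hf' g) f

/-- The associativity axiom: both sides are the Fubini transform to the threefold ultraproduct
followed by the restrictions along the inclusions of the sets `T r s`. -/
theorem assocMap_assoc (hD : D.IsUltrastructure) {R : Type w} {S : R → Type w}
    {T : ∀ r, S r → Type w} (l : Ultrafilter R) (μ : ∀ r, Ultrafilter (S r))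
    (ν : ∀ r s, Ultrafilter (T r s)) (M : (Σ p : Σ r, S r, T p.1 p.2) → A)
    (h : (sigmaUf l fun r => sigmaUf (μ r) (ν r)).map
      (fun p => (⟨⟨p.1, p.2.1⟩, p.2.2⟩ : Σ p : Σ r, S r, T p.1 p.2)) =
        sigmaUf (sigmaUf l μ) fun p => ν p.1 p.2) :
    D.pull (fun p : Σ r, Σ s, T r s => (⟨⟨p.1, p.2.1⟩, p.2.2⟩ : Σ p : Σ r, S r, T p.1 p.2))
        (sigmaUf l fun r => sigmaUf (μ r) (ν r)) h M ≫
      D.assocMap l (fun r => sigmaUf (μ r) (ν r)) (fun p => M ⟨⟨p.1, p.2.1⟩, p.2.2⟩) ≫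
        D.mapFam l (fun r => D.assocMap (μ r) (ν r) fun q => M ⟨⟨r, q.1⟩, q.2⟩) =
      D.assocMap (sigmaUf l μ) (fun p => ν p.1 p.2) M ≫
        D.assocMap l μ fun p => (D.prod (ν p.1 p.2)).obj fun t => M ⟨p, t⟩ := by
  let κ : (Σ r, S r) → Ultrafilter (Σ p : Σ r, S r, T p.1 p.2) :=
    fun p => (ν p.1 p.2).map (Sigma.mk p)
  have hκ : (sigmaUf l μ).bind κ = sigmaUf (sigmaUf l μ) fun p => ν p.1 p.2 := rfl
  have hκ' : (l.bind fun r => (μ r).bind fun s => κ ⟨r, s⟩) =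
    sigmaUf (sigmaUf l μ) fun p => ν p.1 p.2 := rfl
  have h₁ := hD.pull_assocMap (T := fun r => Σ s, T r s)
    (fun r q => (⟨⟨r, q.1⟩, q.2⟩ : Σ p : Σ r, S r, T p.1 p.2)) l
    (fun r => sigmaUf (μ r) (ν r)) (κ := fun r => (μ r).bind fun s => κ ⟨r, s⟩)
    (fun r => rfl) hκ' h M
  have h₂ : ∀ r, _ := fun r => hD.pull_assocMap (T := T r)
    (fun s t => (⟨⟨r, s⟩, t⟩ : Σ p : Σ r, S r, T p.1 p.2)) (μ r)
    (ν r) (κ := fun s => κ ⟨r, s⟩) (fun s => rfl) rfl rfl M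
  have h₃ := hD.delta_delta l (fun r => (μ r).map (Sigma.mk r)) κ
    (κ := fun r => (μ r).bind fun s => κ ⟨r, s⟩) (fun r => rfl) hκ' (bind_map_mk l μ) hκ M
  have h₄ : ∀ r, _ := fun r => hD.delta_pull (Sigma.mk r) (μ r) rfl κ
    (ρ := (μ r).bind fun s => κ ⟨r, s⟩) rfl rfl M
  have e₁ : D.assocMap (sigmaUf l μ) (fun p => ν p.1 p.2) M =
    D.delta (sigmaUf l μ) κ hκ M ≫ D.mapFam (sigmaUf l μ) fun p =>
      D.pull (Sigma.mk p) (ν p.1 p.2) rfl M := rfl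
  rw [← Category.assoc, h₁, Category.assoc, mapFam_comp, e₁, Category.assoc,
    assocMap_naturality, assocMap, Category.assoc, mapFam_comp, ← Category.assoc, ← h₃,
    Category.assoc, mapFam_comp]
  refine congrArg (_ ≫ ·) (congrArg (D.mapFam l) (funext fun r => ?_))
  refine (h₂ r).trans ?_
  rw [← Category.assoc]
  exact (congrArg (· ≫ _) (h₄ r)).symm

/-- The normal colax algebra associated with an ultrastructure. -/
noncomputable def toAlgebra (hD : D.IsUltrastructure) : NormalColaxAlgebra.{w} A where
  m := hD.action
  a :=
    { app := hD.assocApp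
      naturality := fun _ _ f => hD.assocApp_naturality f }
  i :=
    { app := fun M => D.eps PUnit.unit fun _ => M
      naturality := fun M N f =>
        (congrArg (· ≫ _) (hD.action_map_homOfMap_id (pure PUnit.unit) fun _ => f)).trans
          (D.eps_naturality PUnit.unit fun _ => f) }
  isIso_i := by
    refine @NatIso.isIso_of_isIso_app _ _ _ _ _ _ _ fun M => ?_
    exact hD.isIso_eps PUnit.unit fun _ => M
  -- the restriction along `∐_* X ≃ X` followed by the associator is a Fubini transform for a
  -- principal ultrafilter, which is inverse to `ε` by `fubini_pure`
  unit_left X := by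
    have h₁ := hD.pull_assocMap (S := PUnit) (T := fun _ => X.idx) (fun _ x => x)
      (pure PUnit.unit) (fun _ => X.uf) (fun _ => Ultrafilter.map_id' _) rfl rfl X.fam
    have h₂ : (D.mapFam (pure PUnit.unit) fun s : PUnit => D.pull (fun x => x) X.uf
        (Ultrafilter.map_id' _) X.fam) = 𝟙 _ :=
      (congrArg (D.mapFam _) (funext fun s => hD.pull_id _ _ _)).trans (D.mapFam_id _ _)
    refine (congrArg (· ≫ _) (hD.action_map_homOfMap _ _ _)).trans ?_
    refine (congrArg (fun k => (_ ≫ k) ≫ _) (D.mapFam_id _ _)).trans ?_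
    refine (congrArg (· ≫ _) (Category.comp_id _)).trans ?_
    refine (Category.assoc _ _ _).symm.trans ((congrArg (· ≫ _) (h₁.trans
      ((congrArg (_ ≫ ·) h₂).trans (Category.comp_id _)))).trans ?_)
    exact hD.delta_pure PUnit.unit (fun _ => X.uf) X.fam rfl
  -- the composite is the restriction along the identity of `X.idx`
  unit_right X := by
    have h₀ : (X.uf.bind fun x => pure x) = X.uf := by
      exact (map_eq_bind _ _).symm.trans (Ultrafilter.map_id _)
    have h₁ := hD.pull_assocMap (S := X.idx) (T := fun _ => PUnit) (fun x _ => x)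
      X.uf (fun _ => pure PUnit.unit) (κ := fun x => pure x) (fun _ => Ultrafilter.map_pure _ _)
      h₀ (map_fst_sigmaUf _ _) X.fam
    refine (congrArg (· ≫ _) (hD.action_map_homOfMap _ _ _)).trans ?_
    refine (congrArg (fun k => (_ ≫ k) ≫ _) (D.mapFam_id _ _)).trans ?_
    refine (congrArg (· ≫ _) (Category.comp_id _)).trans ?_
    refine (Category.assoc _ _ _).symm.trans ((congrArg₂ (· ≫ ·) h₁
      (hD.action_map_homOfMap_id _ _)).trans ?_)
    refine (Category.assoc _ _ _).trans ((congrArg (_ ≫ ·) (D.mapFam_comp _ _ _)).trans ?_)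
    refine Eq.trans ?_ (hD.pull_id X.uf (Ultrafilter.map_id' _) X.fam)
    refine congrArg (_ ≫ ·) (congrArg (D.mapFam X.uf) (funext fun x => ?_))
    exact hD.pull_eps (fun _ => x) PUnit.unit _ X.fam
  assoc X := by
    have h₁ : hD.action.map (multAssoc.hom.app X) =
        D.pull (fun p : (multObj ((map (mult A)).obj X)).idx =>
          (⟨⟨p.1, p.2.1⟩, p.2.2⟩ : (multObj (multObj X)).idx))
          (multObj ((map (mult A)).obj X)).uf rfl (multObj (multObj X)).fam :=
      (hD.action_map_homOfMap (X := multObj (multObj X)) (Y := multObj ((map (mult A)).obj X))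
        (fun p => ⟨⟨p.1, p.2.1⟩, p.2.2⟩) rfl fun _ => 𝟙 _).trans
        ((congrArg (_ ≫ ·) (D.mapFam_id _ _)).trans (Category.comp_id _))
    have h₂ := hD.action_map_homOfMap_id X.uf fun r => hD.assocApp (X.fam r)
    refine (congrArg₂ (· ≫ ·) h₁ (congrArg (hD.assocApp ((map (mult A)).obj X) ≫ ·) h₂)).trans ?_
    exact hD.assocMap_assoc (T := fun r s => ((X.fam r).fam s).idx) X.uf (fun r => (X.fam r).uf)
      (fun r s => ((X.fam r).fam s).uf) (multObj (multObj X)).fam rfl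

end UltraData.IsUltrastructure

/-! ### The ultracategory of a colax algebra -/

theorem eq_map_inv_comp {C : Type*} [Category* C] {E : Type*} [Category* E] (F : C ⥤ E) {X Y : C}
    (e : X ≅ Y) {W : E} {k : F.obj Y ⟶ W} {l : F.obj X ⟶ W} (h : F.map e.hom ≫ k = l) :
    k = F.map e.inv ≫ l := by
  rw [← h, ← Category.assoc, ← F.map_comp, e.inv_hom_id, F.map_id, Category.id_comp]

theorem eq_map_inv {C : Type*} [Category* C] {E : Type*} [Category* E] (F : C ⥤ E) {X Y : C}
    (e : X ≅ Y) {k : F.obj Y ⟶ F.obj X} (h : F.map e.hom ≫ k = 𝟙 _) : k = F.map e.inv :=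
  (eq_map_inv_comp F e h).trans (Category.comp_id _)

/-- The shape shared by the verifications of the ultracategory axioms: `h₁` is naturality of the
associator `a`, and `h₂`, where it is not trivial, is an axiom of the algebra. -/
theorem comp_comp_aux {C : Type*} [Category* C] {X₀ X₁ X₂ X₃ X₄ Y : C} {p : X₀ ⟶ X₁} {a : X₁ ⟶ X₂}
    {q : X₂ ⟶ X₃} {i : X₃ ⟶ X₄} {n : X₁ ⟶ Y} {a' : Y ⟶ X₃} {r : Y ⟶ X₄} (h₁ : n ≫ a' = a ≫ q)
    (h₂ : a' ≫ i = r) : (p ≫ a) ≫ q ≫ i = (p ≫ n) ≫ r := by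
  rw [Category.assoc, ← reassoc_of% h₁, h₂, Category.assoc]

namespace NormalColaxAlgebra

variable {A : Type u} [Category.{v} A] (S : NormalColaxAlgebra.{w} A)

open UltraFamily

theorem map_homOfMap_comp {X Y Z : UltraFamily.{w} A} (f : Y.idx → X.idx) (hf : Y.uf.map f = X.uf)
    (g : ∀ y, X.fam (f y) ⟶ Y.fam y) (f' : Z.idx → Y.idx) (hf' : Z.uf.map f' = Y.uf)
    (g' : ∀ z, Y.fam (f' z) ⟶ Z.fam z) :
    S.m.map (homOfMap f hf g) ≫ S.m.map (homOfMap f' hf' g') =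
      S.m.map (homOfMap (f ∘ f') (by rw [← Ultrafilter.map_map, hf', hf])
        fun z => g (f' z) ≫ g' z) :=
  (S.m.map_comp _ _).symm.trans (congrArg S.m.map (homOfMap_comp _ _ _ _ _ _))

/-- Naturality of the associator at a total family of total morphisms. -/
theorem a_naturality {X Y : UltraFamily.{w} (UltraFamily.{w} A)} (f : Y.idx → X.idx)
    (hf : Y.uf.map f = X.uf) (f' : ∀ y, (Y.fam y).idx → (X.fam (f y)).idx)
    (hf' : ∀ y, (Y.fam y).uf.map (f' y) = (X.fam (f y)).uf)
    (g : ∀ y x, (X.fam (f y)).fam (f' y x) ⟶ (Y.fam y).fam x) :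
    S.m.map (homOfMap (X := multObj X) (Y := multObj Y) (fun p => ⟨f p.1, f' p.1 p.2⟩)
        (map_multObj f hf f' hf') fun p => g p.1 p.2) ≫ S.a.app Y =
      S.a.app X ≫ S.m.map (homOfMap (X := (map S.m).obj X) (Y := (map S.m).obj Y) f hf
        fun y => S.m.map (homOfMap (f' y) (hf' y) (g y))) :=
  (congrArg (fun k => S.m.map k ≫ S.a.app Y) (multMap_homOfMap f hf f' hf'
    (map_multObj f hf f' hf') g).symm).trans
    (S.a.naturality (homOfMap (X := X) (Y := Y) f hf fun y => homOfMap (f' y) (hf' y) (g y)))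

/-- The left unit axiom, solved for the composite of the associator and the unitor. -/
theorem a_unit_left (X : UltraFamily.{w} A) :
    S.a.app ((unit _).obj X) ≫ S.i.app (S.m.obj X) = S.m.map (leftUnit.inv.app X) :=
  eq_map_inv S.m (leftUnit.app X) (S.unit_left X)

/-- The right unit axiom, solved for the composite of the associator and the unitor. -/
theorem a_unit_right (X : UltraFamily.{w} A) :
    S.a.app ((map (unit A)).obj X) ≫ S.m.map ((map₂ S.i).app X) =
      S.m.map (rightUnit.inv.app X) :=
  eq_map_inv S.m (rightUnit.app X) (S.unit_right X)

/-- The associativity axiom, with the coherence isomorphism moved to the other side. -/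
theorem a_assoc (X : UltraFamily.{w} (UltraFamily.{w} (UltraFamily.{w} A))) :
    S.a.app ((map (mult A)).obj X) ≫ S.m.map ((map₂ S.a).app X) =
      S.m.map (multAssoc.inv.app X) ≫ S.a.app ((mult (UltraFamily A)).obj X) ≫
        S.a.app ((map (map S.m)).obj X) :=
  eq_map_inv_comp S.m (multAssoc.app X) (S.assoc X)

theorem ultraData_eps {X : Type w} (x₀ : X) (M : X → A) :
    S.ultraData.eps x₀ M =
      S.m.map (homOfMap (X := ⟨X, pure x₀, M⟩) (Y := (unit A).obj (M x₀)) (fun _ => x₀)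
        (Ultrafilter.map_pure _ _) fun _ => 𝟙 _) ≫ S.i.app (M x₀) :=
  rfl

/-- Restriction along `f` in the associated ultracategory is the action of the morphism of the
ultracompletion given by `f` and identities. -/
theorem ultraData_pull {X Y : Type w} (f : X → Y) (μ : Ultrafilter X) {ρ : Ultrafilter Y}
    (h : μ.map f = ρ) (M : Y → A) :
    S.ultraData.pull f μ h M = S.m.map (homOfMap (X := ⟨Y, ρ, M⟩)
      (Y := ⟨X, μ, fun x => M (f x)⟩) f h fun _ => 𝟙 _) := by
  let Z : UltraFamily.{w} (UltraFamily.{w} A) := ⟨X, μ, fun x => ⟨Y, pure (f x), M⟩⟩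
  -- the maps `ε` split into the actions of `* ↦ f x`, across which the associator is moved by
  -- naturality, and the unitors, which are absorbed by the right unit axiom
  have e₁ : S.ultraData.mapFam μ (fun x => S.ultraData.eps (f x) M) =
      S.m.map (homOfMap (X := (map S.m).obj Z)
        (Y := (map S.m).obj ((map (unit A)).obj ⟨X, μ, fun x => M (f x)⟩)) id
        (Ultrafilter.map_id _) fun x => S.m.map (homOfMap (X := ⟨Y, pure (f x), M⟩)
          (Y := (unit A).obj (M (f x))) (fun _ => f x) (Ultrafilter.map_pure _ _)
            fun _ => 𝟙 _)) ≫
        S.m.map ((map₂ S.i).app ⟨X, μ, fun x => M (f x)⟩) :=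
    (S.ultraData.mapFam_comp μ (fun x => S.m.map (homOfMap (X := ⟨Y, pure (f x), M⟩)
          (Y := (unit A).obj (M (f x))) (fun _ => f x) (Ultrafilter.map_pure _ _)
            fun _ => 𝟙 _)) fun x => S.i.app (M (f x))).symm
  have e₂ := S.a_naturality (X := Z) (Y := (map (unit A)).obj ⟨X, μ, fun x => M (f x)⟩) id
    (Ultrafilter.map_id _) (fun x _ => f x) (fun x => Ultrafilter.map_pure _ _) fun _ _ => 𝟙 _
  have e₃ := S.a_unit_right ⟨X, μ, fun x => M (f x)⟩
  refine (congrArg (_ ≫ ·) e₁).trans ((comp_comp_aux e₂ e₃).trans ?_)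
  refine (congrArg (· ≫ _) (S.map_homOfMap_comp _ _ _ _ _ _)).trans
    ((S.map_homOfMap_comp _ _ _ _ _ _).trans (congrArg S.m.map ?_))
  refine homOfMap_congr_of_eq (fun _ => rfl) fun _ => heq_of_eq ?_
  exact (congrArg (· ≫ _) (Category.id_comp _)).trans (Category.comp_id _)

theorem ultraData_pull_mapFam {X Y : UltraFamily.{w} A} (f : Y.idx → X.idx)
    (hf : Y.uf.map f = X.uf) (g : ∀ y, X.fam (f y) ⟶ Y.fam y) :
    S.ultraData.pull f Y.uf hf X.fam ≫ S.ultraData.mapFam Y.uf g =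
      S.m.map (homOfMap f hf g) := by
  rw [ultraData_pull]
  refine (S.map_homOfMap_comp _ _ _ _ _ _).trans (congrArg S.m.map ?_)
  exact homOfMap_congr_of_eq (fun _ => rfl) fun _ => heq_of_eq (Category.id_comp _)

/-- `ε` is invertible since `* ↦ x₀` is an injection, hence gives an isomorphism of the
ultracompletion. -/
theorem ultraData_isIso_eps {X : Type w} (x₀ : X) (M : X → A) : IsIso (S.ultraData.eps x₀ M) := by
  have := isIso_homOfMap_of_injective (pure PUnit.unit) ⟨X, pure x₀, M⟩ (fun _ : PUnit => x₀)
    (Ultrafilter.map_pure _ _) fun _ _ _ => rfl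
  have h₁ : IsIso (S.m.map (homOfMap (X := ⟨X, pure x₀, M⟩) (Y := (unit A).obj (M x₀))
      (fun _ => x₀) (Ultrafilter.map_pure _ _) fun _ => 𝟙 _)) :=
    @Functor.map_isIso _ _ _ _ _ _ S.m _ this
  have := S.isIso_i
  have h₂ : IsIso (S.i.app (M x₀)) := inferInstance
  rw [ultraData_eps]
  exact IsIso.comp_isIso' h₁ h₂

/-- The axiom `fubini_pure` for the associated ultrastructure, from the left unit axiom. -/
theorem ultraData_delta_pure {I X : Type w} (s₀ : I) (ν : I → Ultrafilter X) (M : X → A) :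
    S.ultraData.delta (pure s₀) ν (bind_pure_left s₀ ν).symm M ≫
      S.ultraData.eps s₀ (fun s => (S.ultraData.prod (ν s)).obj M) = 𝟙 _ := by
  let Z : UltraFamily.{w} (UltraFamily.{w} A) := ⟨I, pure s₀, fun s => ⟨X, ν s, M⟩⟩
  have e₁ := S.a_naturality (X := Z) (Y := (unit _).obj (⟨X, ν s₀, M⟩ : UltraFamily.{w} A))
    (fun _ => s₀) (Ultrafilter.map_pure _ _) (fun _ x => x) (fun _ => Ultrafilter.map_id' _)
    fun _ _ => 𝟙 _
  have e₂ : S.m.map (homOfMap (X := (map S.m).obj Z)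
      (Y := (map S.m).obj ((unit _).obj (⟨X, ν s₀, M⟩ : UltraFamily.{w} A))) (fun _ => s₀)
      (Ultrafilter.map_pure _ _) fun _ => S.m.map (homOfMap (X := ⟨X, ν s₀, M⟩)
        (Y := ⟨X, ν s₀, M⟩) (fun x => x) (Ultrafilter.map_id' _) fun _ => 𝟙 _)) =
      S.m.map (homOfMap (X := (map S.m).obj Z)
        (Y := (map S.m).obj ((unit _).obj (⟨X, ν s₀, M⟩ : UltraFamily.{w} A))) (fun _ => s₀)
        (Ultrafilter.map_pure _ _) fun _ => 𝟙 _) :=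
    congrArg S.m.map (homOfMap_congr_of_eq (fun _ => rfl) fun _ => heq_of_eq (S.m.map_id _))
  have e₃ := S.a_unit_left ⟨X, ν s₀, M⟩
  refine (comp_comp_aux (e₁.trans (congrArg (_ ≫ ·) e₂)) e₃).trans ?_
  refine (congrArg (· ≫ _) (S.map_homOfMap_comp _ _ _ _ _ _)).trans
    ((S.map_homOfMap_comp _ _ _ _ _ _).trans ?_)
  refine (congrArg S.m.map ?_).trans (S.m.map_id _)
  refine homOfMap_congr_of_eq (fun _ => rfl) fun _ => heq_of_eq ?_
  exact (congrArg (· ≫ _) (Category.id_comp _)).trans (Category.comp_id _)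

/-- The axiom `fubini_fubini` for the associated ultrastructure, from the associativity axiom. -/
theorem ultraData_delta_delta {R I X : Type w} (l : Ultrafilter R) (μ : R → Ultrafilter I)
    (ν : I → Ultrafilter X) (M : X → A) :
    S.ultraData.delta l (fun r => (μ r).bind ν) (bind_bind l μ ν).symm M ≫
        S.ultraData.mapFam l (fun r => S.ultraData.delta (μ r) ν rfl M) =
      S.ultraData.delta (l.bind μ) ν rfl M ≫
        S.ultraData.delta l μ rfl (fun s => (S.ultraData.prod (ν s)).obj M) := by
  let Z : UltraFamily.{w} (UltraFamily.{w} (UltraFamily.{w} A)) :=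
    ⟨R, l, fun r => ⟨I, μ r, fun s => ⟨X, ν s, M⟩⟩⟩
  have e₁ := S.ultraData.mapFam_comp l (fun r => S.m.map (homOfMap
    (X := ⟨X, (μ r).bind ν, M⟩) (Y := multObj ⟨I, μ r, fun s => ⟨X, ν s, M⟩⟩)
    (fun p => p.2) rfl fun _ => 𝟙 _)) fun r => S.a.app ⟨I, μ r, fun s => ⟨X, ν s, M⟩⟩
  have e₂ := S.a_naturality (X := ⟨R, l, fun r => ⟨X, (μ r).bind ν, M⟩⟩)
    (Y := (map (mult A)).obj Z) id (Ultrafilter.map_id _) (fun _ p => p.2) (fun _ => rfl)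
    fun _ _ => 𝟙 _
  have e₃ := S.a_assoc Z
  have e₄ := S.a_naturality (X := ⟨I, l.bind μ, fun s => ⟨X, ν s, M⟩⟩)
    (Y := (mult (UltraFamily A)).obj Z) (fun p => p.2) rfl (fun _ x => x)
    (fun _ => Ultrafilter.map_id' _) fun _ _ => 𝟙 _
  have e₅ : S.m.map (homOfMap (X := ⟨I, l.bind μ, fun s => S.m.obj ⟨X, ν s, M⟩⟩)
      (Y := multObj ⟨R, l, fun r => ⟨I, μ r, fun s => S.m.obj ⟨X, ν s, M⟩⟩⟩) (fun p => p.2) rfl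
      fun p => S.m.map (homOfMap (X := ⟨X, ν p.2, M⟩) (Y := ⟨X, ν p.2, M⟩) (fun x => x)
        (Ultrafilter.map_id' _) fun _ => 𝟙 _)) =
      S.m.map (homOfMap (X := ⟨I, l.bind μ, fun s => S.m.obj ⟨X, ν s, M⟩⟩)
        (Y := multObj ⟨R, l, fun r => ⟨I, μ r, fun s => S.m.obj ⟨X, ν s, M⟩⟩⟩) (fun p => p.2) rfl
        fun _ => 𝟙 _) :=
    congrArg S.m.map (homOfMap_congr_of_eq (fun _ => rfl) fun _ => heq_of_eq (S.m.map_id _))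
  -- both sides are a projection followed by the two associators at `(R × I) × X`
  have l₁ : S.ultraData.delta l (fun r => (μ r).bind ν) (bind_bind l μ ν).symm M ≫
        S.ultraData.mapFam l (fun r => S.ultraData.delta (μ r) ν rfl M) =
      S.m.map (homOfMap (X := ⟨X, (l.bind μ).bind ν, M⟩)
        (Y := multObj ((mult (UltraFamily A)).obj Z)) (fun p => p.2) rfl fun _ => 𝟙 _) ≫
        S.a.app ((mult (UltraFamily A)).obj Z) ≫ S.a.app ((map (map S.m)).obj Z) := by
    refine (congrArg (_ ≫ ·) e₁.symm).trans ((comp_comp_aux e₂ e₃).trans ?_)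
    refine (Category.assoc _ _ _).symm.trans (congrArg (· ≫ _) ?_)
    refine (congrArg (· ≫ _) (S.map_homOfMap_comp _ _ _ _ _ _)).trans
      ((S.map_homOfMap_comp _ _ _ _ _ _).trans (congrArg S.m.map ?_))
    refine homOfMap_congr_of_eq (fun _ => rfl) fun _ => heq_of_eq ?_
    exact (congrArg (· ≫ _) (Category.id_comp _)).trans (Category.comp_id _)
  have l₂ : S.ultraData.delta (l.bind μ) ν rfl M ≫
        S.ultraData.delta l μ rfl (fun s => (S.ultraData.prod (ν s)).obj M) =
      S.m.map (homOfMap (X := ⟨X, (l.bind μ).bind ν, M⟩)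
        (Y := multObj ((mult (UltraFamily A)).obj Z)) (fun p => p.2) rfl fun _ => 𝟙 _) ≫
        S.a.app ((mult (UltraFamily A)).obj Z) ≫ S.a.app ((map (map S.m)).obj Z) := by
    refine (comp_comp_aux (e₄.trans (congrArg (_ ≫ ·) e₅)) rfl).trans (congrArg (· ≫ _) ?_)
    refine (S.map_homOfMap_comp _ _ _ _ _ _).trans (congrArg S.m.map ?_)
    exact homOfMap_congr_of_eq (fun _ => rfl) fun _ => heq_of_eq (Category.id_comp _)
  exact l₁.trans l₂.symm

theorem isUltrastructure_ultraData : S.ultraData.IsUltrastructure where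
  isIso_ε x₀ := @NatIso.isIso_of_isIso_app _ _ _ _ _ _ _ fun M => S.ultraData_isIso_eps x₀ M
  fubini_pure := S.ultraData_delta_pure
  -- the Fubini transform is the restriction along `f`, up to the isomorphisms `ε`
  isIso_fubini {X Y} f inj μ M := by
    have h₁ : IsIso (S.ultraData.pull f μ rfl M) := by
      rw [ultraData_pull]
      have := isIso_homOfMap_of_injective μ ⟨Y, μ.map f, M⟩ f rfl inj
      exact Functor.map_isIso S.m _
    have h₂ : IsIso (S.ultraData.mapFam μ fun x => S.ultraData.eps (f x) M) :=
      S.ultraData.isIso_mapFam μ _ fun x => S.ultraData_isIso_eps (f x) M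
    exact @IsIso.of_isIso_fac_right _ _ _ _ _ _ _ _ h₂ h₁ rfl
  fubini_fubini := S.ultraData_delta_delta

end NormalColaxAlgebra

/-! ### The bijection between algebras and ultrastructures -/

namespace NormalColaxAlgebra

variable {A : Type u} [Category.{v} A] (S : NormalColaxAlgebra.{w} A)

open UltraFamily

/-- The associator of a colax algebra is recovered from the associated Fubini transform. -/
theorem ultraData_assocMap {I : Type w} {T : I → Type w} (μ : Ultrafilter I)
    (ν : ∀ s, Ultrafilter (T s)) (M : (Σ s, T s) → A) :
    S.ultraData.assocMap μ ν M = S.a.app ⟨I, μ, fun s => ⟨T s, ν s, fun t => M ⟨s, t⟩⟩⟩ := by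
  have e₁ : (S.ultraData.mapFam μ fun s => S.ultraData.pull (Sigma.mk (β := T) s) (ν s) rfl M) =
      S.ultraData.mapFam μ fun s => S.m.map (homOfMap
        (X := ⟨Σ s, T s, (ν s).map (Sigma.mk s), M⟩) (Y := ⟨T s, ν s, fun t => M ⟨s, t⟩⟩)
        (Sigma.mk (β := T) s) rfl fun _ => 𝟙 _) :=
    congrArg (fun g => S.ultraData.mapFam μ g)
      (funext fun s => S.ultraData_pull (Sigma.mk (β := T) s) (ν s) rfl M)
  have e₂ := S.a_naturality (X := ⟨I, μ, fun s => ⟨Σ s, T s, (ν s).map (Sigma.mk s), M⟩⟩)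
    (Y := ⟨I, μ, fun s => ⟨T s, ν s, fun t => M ⟨s, t⟩⟩⟩) (fun s => s)
    (Ultrafilter.map_id' _) (fun s => Sigma.mk (β := T) s) (fun _ => rfl) fun s t => 𝟙 (M ⟨s, t⟩)
  -- the projection `I × ∐ T_s → ∐ T_s` and the inclusions of the `T_s` compose to an identity
  refine (congrArg (_ ≫ ·) e₁).trans ((Category.assoc _ _ _).trans
    ((congrArg (_ ≫ ·) e₂.symm).trans ((Category.assoc _ _ _).symm.trans ?_)))
  refine (congrArg (· ≫ _) ((S.map_homOfMap_comp _ _ _ _ _ _).trans ?_)).trans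
    (Category.id_comp _)
  refine (congrArg S.m.map ?_).trans (S.m.map_id _)
  exact homOfMap_congr_of_eq (fun _ => rfl) fun _ => heq_of_eq (Category.id_comp _)

/-- The actions agree, as they agree after restriction to the domain of a representative. -/
theorem action_ultraData_map {X Y : UltraFamily.{w} A} (f : X ⟶ Y) :
    S.isUltrastructure_ultraData.action.map f = S.m.map f := by
  induction f using Quotient.inductionOn with | _ f
  have := S.isUltrastructure_ultraData.isIso_pull Subtype.val Subtype.val_injective f.domUf
    f.map_val_domUf Y.fam
  refine (cancel_mono (S.ultraData.pull Subtype.val f.domUf f.map_val_domUf Y.fam)).1 ?_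
  refine (S.isUltrastructure_ultraData.actPre_pull_val f).trans ?_
  refine (S.ultraData_pull_mapFam (Y := ⟨f.dom, f.domUf, fun y => Y.fam y.1⟩)
    (fun y => f.fn y.1 y.2) f.map_fn_domUf fun y => f.hom y.1 y.2).trans ?_
  refine (congrArg S.m.map f.toHom_comp_homOfMap_val).symm.trans ((S.m.map_comp _ _).trans ?_)
  exact congrArg (_ ≫ ·) (S.ultraData_pull _ _ _ _).symm

variable {S}

/-- Two normal colax algebras with equal values are equal. Equality of morphisms is heterogeneous as
the objects need only be propositionally equal. -/
theorem ext_of_heq {S' : NormalColaxAlgebra.{w} A} (hobj : ∀ X, S.m.obj X = S'.m.obj X)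
    (hmap : ∀ (X Y : UltraFamily.{w} A) (f : X ⟶ Y), HEq (S.m.map f) (S'.m.map f))
    (ha : ∀ X, HEq (S.a.app X) (S'.a.app X)) (hi : ∀ M, HEq (S.i.app M) (S'.i.app M)) :
    S = S' := by
  have hm : S.m = S'.m := Functor.hext hobj hmap
  obtain ⟨m, a, i, _, _, _, _⟩ := S
  obtain ⟨m', a', i', _, _, _, _⟩ := S'
  obtain rfl : m = m' := hm
  obtain rfl : a = a' := NatTrans.ext (funext fun X => eq_of_heq (ha X))
  obtain rfl : i = i' := NatTrans.ext (funext fun M => eq_of_heq (hi M))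
  rfl

variable (S)

theorem toAlgebra_ultraData : S.isUltrastructure_ultraData.toAlgebra = S := by
  refine ext_of_heq (fun _ => rfl) (fun X Y f => heq_of_eq (S.action_ultraData_map f))
    (fun X => heq_of_eq (S.ultraData_assocMap (T := fun x => (X.fam x).idx) X.uf
      (fun x => (X.fam x).uf) (multObj X).fam)) fun M => heq_of_eq ?_
  exact (congrArg (· ≫ S.i.app M) (S.m.map_id _)).trans (Category.id_comp _)

end NormalColaxAlgebra

namespace UltraData

variable {A : Type u} [Category.{v} A]

/-- Two ultrastructure data with equal values are equal. Equality of morphisms is heterogeneous as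
the objects need only be propositionally equal. -/
theorem ext_of_heq {D D' : UltraData.{w} A}
    (hobj : ∀ {X : Type w} (μ : Ultrafilter X) (M : X → A),
      (D.prod μ).obj M = (D'.prod μ).obj M)
    (hmap : ∀ {X : Type w} (μ : Ultrafilter X) (M N : X → A) (f : M ⟶ N),
      HEq ((D.prod μ).map f) ((D'.prod μ).map f))
    (hf : ∀ {S X : Type w} (μ : Ultrafilter S) (ν : S → Ultrafilter X) (ρ : Ultrafilter X)
      (h : ρ = μ.bind ν) (M : X → A),
      HEq ((D.fubini μ ν ρ h).app M) ((D'.fubini μ ν ρ h).app M))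
    (hε : ∀ {X : Type w} (x₀ : X) (M : X → A), HEq ((D.ε x₀).app M) ((D'.ε x₀).app M)) :
    D = D' := by
  have hp : @UltraData.prod _ _ D = @UltraData.prod _ _ D' :=
    funext fun X => funext fun μ => Functor.hext (hobj μ) (hmap μ)
  obtain ⟨p, f, e⟩ := D
  obtain ⟨p', f', e'⟩ := D'
  obtain rfl : @p = @p' := hp
  obtain rfl : @f = @f' := by
    funext S X μ ν ρ h
    exact NatTrans.ext (funext fun M => eq_of_heq (hf μ ν ρ h M))
  obtain rfl : @e = @e' := by
    funext X x₀
    exact NatTrans.ext (funext fun M => eq_of_heq (hε x₀ M))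
  rfl

open UltraFamily

theorem IsUltrastructure.ultraData_toAlgebra {D : UltraData.{w} A} (hD : D.IsUltrastructure) :
    hD.toAlgebra.ultraData = D := by
  refine ext_of_heq (fun _ _ => rfl)
    (fun μ M N f => heq_of_eq (hD.action_map_homOfMap_id μ f)) (fun {S X} μ ν ρ h M => ?_)
    (fun {X} x₀ M => ?_)
  · refine heq_of_eq ?_
    have h₁ := hD.pull_assocMap (T := fun _ => X) (fun (_ : S) (x : X) => x) μ ν (κ := ν)
      (fun _ => Ultrafilter.map_id' _) h.symm h.symm M
    have h₂ : (D.mapFam μ fun s => D.pull (fun x => x) (ν s) (Ultrafilter.map_id' _) M) = 𝟙 _ :=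
      (congrArg (D.mapFam μ) (funext fun s => hD.pull_id _ _ _)).trans (D.mapFam_id _ _)
    refine (congrArg (· ≫ _) (hD.action_map_reindex (multObj ⟨S, μ, fun s => ⟨X, ν s, M⟩⟩).uf
      ⟨X, ρ, M⟩ (fun p => p.2) h.symm)).trans ?_
    exact h₁.trans ((congrArg (_ ≫ ·) h₂).trans (Category.comp_id _))
  · refine heq_of_eq ?_
    refine (congrArg (· ≫ _) (hD.action_map_reindex (pure PUnit.unit) ⟨X, pure x₀, M⟩
      (fun _ => x₀) (Ultrafilter.map_pure _ _))).trans ?_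
    exact hD.pull_eps (fun _ => x₀) PUnit.unit _ M

end UltraData

theorem NormalColaxAlgebra.bijective_ultraData (A : Type u) [Category.{v} A] :
    Function.Bijective fun S : NormalColaxAlgebra.{w} A =>
      (⟨S.ultraData, S.isUltrastructure_ultraData⟩ : Ultrastructure.{w} A) := by
  refine ⟨Function.LeftInverse.injective (g := fun U => U.isUltrastructure.toAlgebra)
    fun S => S.toAlgebra_ultraData, fun ⟨D, hD⟩ => ⟨hD.toAlgebra, ?_⟩⟩
  simp only [hD.ultraData_toAlgebra]


/-! ### Morphisms of algebras and ultrafunctors -/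

section Morphisms

variable {A : Type u} [Category.{v} A] {B : Type u} [Category.{v} B]

theorem left_square_aux {F : A ⥤ B} {X₀ X₁ X₂ : A} {Y₀ Y₁ Y₂ : B} {φ₀ : F.obj X₀ ⟶ Y₀}
    {φ₁ : F.obj X₁ ⟶ Y₁} {p : X₀ ⟶ X₁} {p' : Y₀ ⟶ Y₁} {i : X₁ ⟶ X₂} {i' : Y₁ ⟶ Y₂}
    {k : F.obj X₂ ⟶ Y₂} (h₁ : F.map p ≫ φ₁ = φ₀ ≫ p') (h₂ : φ₁ ≫ i' = F.map i ≫ k) :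
    φ₀ ≫ p' ≫ i' = F.map (p ≫ i) ≫ k := by
  rw [← Category.assoc, ← h₁, Category.assoc, h₂, F.map_comp, Category.assoc]

theorem left_triangle_aux {F : A ⥤ B} {X₀ X₁ X₂ : A} {Y₀ Y₁ : B} {φ₀ : F.obj X₀ ⟶ Y₀}
    {φ₁ : F.obj X₁ ⟶ Y₁} {p : X₀ ⟶ X₁} {p' : Y₀ ⟶ Y₁} {i : X₁ ⟶ X₂} {i' : Y₁ ⟶ F.obj X₂}
    (h₁ : F.map p ≫ φ₁ = φ₀ ≫ p') (h₂ : φ₁ ≫ i' = F.map i) :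
    φ₀ ≫ p' ≫ i' = F.map (p ≫ i) := by
  rw [← Category.assoc, ← h₁, Category.assoc, h₂, F.map_comp]

theorem right_square_aux {F : A ⥤ B} {X₀ X₁ X₂ : A} {Y₀ Y₁ Y₂ : B} {φ₀ : Y₀ ⟶ F.obj X₀}
    {φ₁ : Y₁ ⟶ F.obj X₁} {p : X₀ ⟶ X₁} {p' : Y₀ ⟶ Y₁} {i : X₁ ⟶ X₂} {i' : Y₁ ⟶ Y₂}
    {k : Y₂ ⟶ F.obj X₂} (h₁ : p' ≫ φ₁ = φ₀ ≫ F.map p) (h₂ : φ₁ ≫ F.map i = i' ≫ k) :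
    φ₀ ≫ F.map (p ≫ i) = (p' ≫ i') ≫ k := by
  rw [F.map_comp, ← Category.assoc, ← h₁, Category.assoc, h₂, Category.assoc]

theorem right_triangle_aux {F : A ⥤ B} {X₀ X₁ X₂ : A} {Y₀ Y₁ : B} {φ₀ : Y₀ ⟶ F.obj X₀}
    {φ₁ : Y₁ ⟶ F.obj X₁} {p : X₀ ⟶ X₁} {p' : Y₀ ⟶ Y₁} {i : X₁ ⟶ X₂} {i' : Y₁ ⟶ F.obj X₂}
    (h₁ : p' ≫ φ₁ = φ₀ ≫ F.map p) (h₂ : φ₁ ≫ F.map i = i') :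
    φ₀ ≫ F.map (p ≫ i) = p' ≫ i' := by
  rw [F.map_comp, ← Category.assoc, ← h₁, Category.assoc, h₂]

open UltraFamily

/-! The axioms for left and right ultrafunctors are restated in terms of `mapFam`, `eps` and `delta`,
and imply compatibility with `pull` and `assocMap`. -/

namespace IsLeftUltrastructure

variable {D : UltraData.{w} A} {D' : UltraData.{w} B} {F : A ⥤ B} {σ : LeftFamily D D' F}

theorem mapFam (hσ : IsLeftUltrastructure D D' F σ) {X : Type w} (μ : Ultrafilter X) {M N : X → A}
    (g : ∀ x, M x ⟶ N x) :
    F.map (D.mapFam μ g) ≫ σ μ N = σ μ M ≫ D'.mapFam μ fun x => F.map (g x) :=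
  (hσ.naturality μ g).symm

theorem eps (hσ : IsLeftUltrastructure D D' F σ) {X : Type w} (x₀ : X) (M : X → A) :
    F.map (D.eps x₀ M) = σ (Pure.pure x₀) M ≫ D'.eps x₀ fun x => F.obj (M x) :=
  (hσ.pure x₀ M).symm

theorem delta (hσ : IsLeftUltrastructure D D' F σ) {S X : Type w} (μ : Ultrafilter S)
    (ν : S → Ultrafilter X) {ρ : Ultrafilter X} (h : μ.bind ν = ρ) (M : X → A) :
    F.map (D.delta μ ν h M) ≫ σ μ (fun s => (D.prod (ν s)).obj M) ≫
        D'.mapFam μ (fun s => σ (ν s) M) =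
      σ ρ M ≫ D'.delta μ ν h fun x => F.obj (M x) := by
  subst h
  exact (hσ.bind μ ν M).symm

theorem pull (hσ : IsLeftUltrastructure D D' F σ) {X Y : Type w} (f : X → Y) (μ : Ultrafilter X)
    {ρ : Ultrafilter Y} (h : μ.map f = ρ) (M : Y → A) :
    F.map (D.pull f μ h M) ≫ σ μ (fun x => M (f x)) =
      σ ρ M ≫ D'.pull f μ h fun y => F.obj (M y) := by
  rw [UltraData.pull, UltraData.pull, F.map_comp, Category.assoc, hσ.mapFam]
  simp only [hσ.eps]
  rw [← D'.mapFam_comp, ← Category.assoc (σ μ _), ← Category.assoc (F.map _), hσ.delta,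
    Category.assoc]

theorem assocMap (hσ : IsLeftUltrastructure D D' F σ) {S : Type w} {T : S → Type w}
    (μ : Ultrafilter S) (ν : ∀ s, Ultrafilter (T s)) (M : (Σ s, T s) → A) :
    σ (sigmaUf μ ν) M ≫ D'.assocMap μ ν (fun p => F.obj (M p)) =
      F.map (D.assocMap μ ν M) ≫ σ μ (fun s => (D.prod (ν s)).obj fun t => M ⟨s, t⟩) ≫
        D'.mapFam μ fun s => σ (ν s) fun t => M ⟨s, t⟩ := by
  rw [UltraData.assocMap, UltraData.assocMap, F.map_comp, Category.assoc,
    ← Category.assoc (F.map (D.mapFam _ _)), hσ.mapFam, Category.assoc, D'.mapFam_comp]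
  simp only [hσ.pull]
  rw [← D'.mapFam_comp, ← Category.assoc (σ μ _), ← Category.assoc (F.map _), hσ.delta,
    Category.assoc]

end IsLeftUltrastructure

namespace IsRightUltrastructure

variable {D : UltraData.{w} A} {D' : UltraData.{w} B} {F : A ⥤ B} {σ : RightFamily D D' F}

theorem mapFam (hσ : IsRightUltrastructure D D' F σ) {X : Type w} (μ : Ultrafilter X)
    {M N : X → A} (g : ∀ x, M x ⟶ N x) :
    (D'.mapFam μ fun x => F.map (g x)) ≫ σ μ N = σ μ M ≫ F.map (D.mapFam μ g) :=
  (hσ.naturality μ g).symm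

theorem eps (hσ : IsRightUltrastructure D D' F σ) {X : Type w} (x₀ : X) (M : X → A) :
    σ (Pure.pure x₀) M ≫ F.map (D.eps x₀ M) = D'.eps x₀ fun x => F.obj (M x) :=
  hσ.pure x₀ M

theorem delta (hσ : IsRightUltrastructure D D' F σ) {S X : Type w} (μ : Ultrafilter S)
    (ν : S → Ultrafilter X) {ρ : Ultrafilter X} (h : μ.bind ν = ρ) (M : X → A) :
    σ ρ M ≫ F.map (D.delta μ ν h M) =
      (D'.delta μ ν h fun x => F.obj (M x)) ≫ D'.mapFam μ (fun s => σ (ν s) M) ≫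
        σ μ fun s => (D.prod (ν s)).obj M := by
  subst h
  exact hσ.bind μ ν M

theorem pull (hσ : IsRightUltrastructure D D' F σ) {X Y : Type w} (f : X → Y) (μ : Ultrafilter X)
    {ρ : Ultrafilter Y} (h : μ.map f = ρ) (M : Y → A) :
    (D'.pull f μ h fun y => F.obj (M y)) ≫ σ μ (fun x => M (f x)) =
      σ ρ M ≫ F.map (D.pull f μ h M) := by
  rw [UltraData.pull, UltraData.pull, F.map_comp, ← Category.assoc (σ ρ M), hσ.delta]
  simp only [Category.assoc]
  rw [← hσ.mapFam, ← Category.assoc (D'.mapFam μ _) (D'.mapFam μ _), D'.mapFam_comp]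
  simp only [hσ.eps]

theorem assocMap (hσ : IsRightUltrastructure D D' F σ) {S : Type w} {T : S → Type w}
    (μ : Ultrafilter S) (ν : ∀ s, Ultrafilter (T s)) (M : (Σ s, T s) → A) :
    σ (sigmaUf μ ν) M ≫ F.map (D.assocMap μ ν M) =
      D'.assocMap μ ν (fun p => F.obj (M p)) ≫
        D'.mapFam μ (fun s => σ (ν s) fun t => M ⟨s, t⟩) ≫
          σ μ fun s => (D.prod (ν s)).obj fun t => M ⟨s, t⟩ := by
  rw [UltraData.assocMap, UltraData.assocMap, F.map_comp, ← Category.assoc (σ _ M), hσ.delta]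
  simp only [Category.assoc]
  rw [← hσ.mapFam, ← Category.assoc (D'.mapFam μ _) (D'.mapFam μ _), D'.mapFam_comp,
    ← Category.assoc (D'.mapFam μ _) (D'.mapFam μ _), D'.mapFam_comp]
  simp only [hσ.pull]

end IsRightUltrastructure

variable {S : NormalColaxAlgebra.{w} A} {S' : NormalColaxAlgebra.{w} B} {F : A ⥤ B}

/-- `T F` sends a reindexing morphism to the same reindexing morphism; the components `F (𝟙)` and
`𝟙` are only propositionally equal. -/
theorem UltraFamily.map_reindex (F : A ⥤ B) {X : UltraFamily.{w} A} {I : Type w}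
    (ζ : Ultrafilter I) (j : I → X.idx) (hj : ζ.map j = X.uf) :
    (map F).map (homOfMap (X := X) (Y := ⟨I, ζ, fun i => X.fam (j i)⟩) j hj fun _ => 𝟙 _) =
      homOfMap (X := (map F).obj X) (Y := ⟨I, ζ, fun i => F.obj (X.fam (j i))⟩) j hj
        fun _ => 𝟙 _ :=
  homOfMap_congr_of_eq (X := (map F).obj X) (Y := ⟨I, ζ, fun i => F.obj (X.fam (j i))⟩)
    (hf := hj) (hf' := hj) (fun _ => rfl) fun _ => heq_of_eq (F.map_id _)

theorem LaxMorphism.naturality_reindex (f : LaxMorphism S S' F) {X : UltraFamily.{w} A}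
    {I : Type w} (ζ : Ultrafilter I) (j : I → X.idx) (hj : ζ.map j = X.uf) :
    F.map (S.m.map (homOfMap (X := X) (Y := ⟨I, ζ, fun i => X.fam (j i)⟩) j hj fun _ => 𝟙 _)) ≫
        f.φ.app ⟨I, ζ, fun i => X.fam (j i)⟩ =
      f.φ.app X ≫ S'.m.map (homOfMap (X := (map F).obj X)
        (Y := ⟨I, ζ, fun i => F.obj (X.fam (j i))⟩) j hj fun _ => 𝟙 _) :=
  (f.φ.naturality _).trans (congrArg (fun k => f.φ.app X ≫ S'.m.map k) (map_reindex F ζ j hj))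

theorem ColaxMorphism.naturality_reindex (f : ColaxMorphism S S' F) {X : UltraFamily.{w} A}
    {I : Type w} (ζ : Ultrafilter I) (j : I → X.idx) (hj : ζ.map j = X.uf) :
    S'.m.map (homOfMap (X := (map F).obj X)
        (Y := ⟨I, ζ, fun i => F.obj (X.fam (j i))⟩) j hj fun _ => 𝟙 _) ≫
        f.φ.app ⟨I, ζ, fun i => X.fam (j i)⟩ =
      f.φ.app X ≫ F.map (S.m.map (homOfMap (X := X) (Y := ⟨I, ζ, fun i => X.fam (j i)⟩) j hj
        fun _ => 𝟙 _)) :=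
  (congrArg (fun k => S'.m.map k ≫ f.φ.app ⟨I, ζ, fun i => X.fam (j i)⟩)
    (map_reindex F ζ j hj).symm).trans (f.φ.naturality _)

theorem LaxMorphism.isLeftUltrastructure (f : LaxMorphism S S' F) :
    IsLeftUltrastructure S.ultraData S'.ultraData F f.leftFamily where
  naturality μ M N ψ := (f.φ.naturality ((ofFamily μ).map ψ)).symm
  pure {X} x₀ M := left_triangle_aux (f.naturality_reindex (X := ⟨X, Pure.pure x₀, M⟩)
    (Pure.pure PUnit.unit) (fun _ => x₀) (Ultrafilter.map_pure _ _)) (f.unit (M x₀))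
  bind {I X} μ ν M := left_square_aux (f.naturality_reindex (X := ⟨X, μ.bind ν, M⟩)
    (sigmaUf μ ν) (fun p => p.2) rfl) (f.assoc ⟨I, μ, fun s => ⟨X, ν s, M⟩⟩)

theorem ColaxMorphism.isRightUltrastructure (f : ColaxMorphism S S' F) :
    IsRightUltrastructure S.ultraData S'.ultraData F f.rightFamily where
  naturality μ M N ψ := (f.φ.naturality ((ofFamily μ).map ψ)).symm
  pure {X} x₀ M := right_triangle_aux (f.naturality_reindex (X := ⟨X, Pure.pure x₀, M⟩)
    (Pure.pure PUnit.unit) (fun _ => x₀) (Ultrafilter.map_pure _ _)) (f.unit (M x₀))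
  bind {I X} μ ν M := right_square_aux (f.naturality_reindex (X := ⟨X, μ.bind ν, M⟩)
    (sigmaUf μ ν) (fun p => p.2) rfl) (f.assoc ⟨I, μ, fun s => ⟨X, ν s, M⟩⟩)

/-- For the one-point set, the morphism `* ↦ *` in the definition of `ε` is an identity. -/
theorem NormalColaxAlgebra.ultraData_eps_punit (M : A) :
    S.ultraData.eps PUnit.unit (fun _ => M) = S.i.app M :=
  (congrArg (· ≫ S.i.app M) (S.m.map_id _)).trans (Category.id_comp _)

/-- The components of a left ultrafunctor are natural for total morphisms of the ultracompletion,
which act by a restriction followed by a map of ultraproducts. -/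
theorem IsLeftUltrastructure.naturality_total {σ : LeftFamily S.ultraData S'.ultraData F}
    (hσ : IsLeftUltrastructure S.ultraData S'.ultraData F σ) {X Y : UltraFamily.{w} A}
    (f : Y.idx → X.idx) (hf : Y.uf.map f = X.uf) (g : ∀ y, X.fam (f y) ⟶ Y.fam y) :
    F.map (S.m.map (homOfMap f hf g)) ≫ σ Y.uf Y.fam =
      σ X.uf X.fam ≫ S'.m.map (homOfMap (X := (UltraFamily.map F).obj X)
        (Y := (UltraFamily.map F).obj Y) f hf fun y => F.map (g y)) := by
  have h := S'.ultraData_pull_mapFam (X := (UltraFamily.map F).obj X)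
    (Y := (UltraFamily.map F).obj Y) f hf fun y => F.map (g y)
  have h₁ := hσ.pull f Y.uf hf X.fam
  have h₂ := hσ.mapFam Y.uf g
  have e := S.ultraData_pull_mapFam f hf g
  exact (congrArg (fun k => F.map k ≫ σ Y.uf Y.fam) e.symm).trans
    ((left_square_aux h₁ h₂.symm).symm.trans (congrArg (σ X.uf X.fam ≫ ·) h))

/-- The components of a right ultrafunctor are natural for total morphisms of the ultracompletion,
which act by a restriction followed by a map of ultraproducts. -/
theorem IsRightUltrastructure.naturality_total {σ : RightFamily S.ultraData S'.ultraData F}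
    (hσ : IsRightUltrastructure S.ultraData S'.ultraData F σ) {X Y : UltraFamily.{w} A}
    (f : Y.idx → X.idx) (hf : Y.uf.map f = X.uf) (g : ∀ y, X.fam (f y) ⟶ Y.fam y) :
    S'.m.map (homOfMap (X := (UltraFamily.map F).obj X)
        (Y := (UltraFamily.map F).obj Y) f hf fun y => F.map (g y)) ≫ σ Y.uf Y.fam =
      σ X.uf X.fam ≫ F.map (S.m.map (homOfMap f hf g)) := by
  have h := S'.ultraData_pull_mapFam (X := (UltraFamily.map F).obj X)
    (Y := (UltraFamily.map F).obj Y) f hf fun y => F.map (g y)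
  have h₁ := hσ.pull f Y.uf hf X.fam
  have h₂ := hσ.mapFam Y.uf g
  have e := S.ultraData_pull_mapFam f hf g
  exact (congrArg (· ≫ σ Y.uf Y.fam) h.symm).trans
    ((right_square_aux h₁ h₂.symm).symm.trans (congrArg (fun k => σ X.uf X.fam ≫ F.map k) e))

/-- The lax morphism of algebras with the same components as a given left ultrafunctor. -/
def LaxMorphism.ofLeft (σ : LeftUltrastructure S.ultraData S'.ultraData F) :
    LaxMorphism S S' F where
  φ :=
    { app := fun X => σ.σ X.uf X.fam
      naturality := fun X Y k => naturality_of_total (G := S.m ⋙ F) (H := map F ⋙ S'.m)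
        (fun X => σ.σ X.uf X.fam) (fun X Y f hf g => σ.isLeft.naturality_total f hf g) k }
  unit M := by
    have h := σ.isLeft.eps PUnit.unit fun _ => M
    rw [S.ultraData_eps_punit] at h
    exact ((congrArg (_ ≫ ·) (S'.ultraData_eps_punit (F.obj M))).symm.trans h.symm)
  assoc X := by
    have h := σ.isLeft.assocMap (T := fun x => (X.fam x).idx) X.uf (fun x => (X.fam x).uf)
      (multObj X).fam
    rw [S.ultraData_assocMap] at h
    exact (congrArg (_ ≫ ·) (S'.ultraData_assocMap _ _ _)).symm.trans h

/-- The colax morphism of algebras with the same components as a given right ultrafunctor. -/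
def ColaxMorphism.ofRight (σ : RightUltrastructure S.ultraData S'.ultraData F) :
    ColaxMorphism S S' F where
  φ :=
    { app := fun X => σ.σ X.uf X.fam
      naturality := fun X Y k => naturality_of_total (G := map F ⋙ S'.m) (H := S.m ⋙ F)
        (fun X => σ.σ X.uf X.fam) (fun X Y f hf g => σ.isRight.naturality_total f hf g) k }
  unit M := by
    have h := σ.isRight.eps PUnit.unit fun _ => M
    rw [S.ultraData_eps_punit] at h
    exact h.trans (S'.ultraData_eps_punit (F.obj M))
  assoc X := by
    have h := σ.isRight.assocMap (T := fun x => (X.fam x).idx) X.uf (fun x => (X.fam x).uf)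
      (multObj X).fam
    rw [S.ultraData_assocMap] at h
    exact h.trans (congrArg (· ≫ _) (S'.ultraData_assocMap _ _ _))

theorem LaxMorphism.bijective_leftFamily : Function.Bijective fun f : LaxMorphism S S' F =>
    (⟨f.leftFamily, f.isLeftUltrastructure⟩ : LeftUltrastructure S.ultraData S'.ultraData F) := by
  refine ⟨fun f g h => ?_, fun σ => ⟨LaxMorphism.ofLeft σ, rfl⟩⟩
  refine LaxMorphism.ext (NatTrans.ext (funext fun X => ?_))
  exact congrArg (fun σ : LeftUltrastructure S.ultraData S'.ultraData F => σ.σ X.uf X.fam) h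

theorem ColaxMorphism.bijective_rightFamily : Function.Bijective fun f : ColaxMorphism S S' F =>
    (⟨f.rightFamily, f.isRightUltrastructure⟩ :
      RightUltrastructure S.ultraData S'.ultraData F) := by
  refine ⟨fun f g h => ?_, fun σ => ⟨ColaxMorphism.ofRight σ, rfl⟩⟩
  refine ColaxMorphism.ext (NatTrans.ext (funext fun X => ?_))
  exact congrArg (fun σ : RightUltrastructure S.ultraData S'.ultraData F => σ.σ X.uf X.fam) h

end Morphisms

/-! ### The isomorphisms of bicategories -/

/-- A map of notions of structure which is bijective on structures on categories and on functors, and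
which reflects the compatibility of natural transformations, induces an isomorphism of
bicategories. -/
theorem CatStructure.Map.isIsomorphism {D : CatStructure.{v, u, v', u'}}
    {E : CatStructure.{v, u, v'', u''}} (M : CatStructure.Map D E)
    (hstr : ∀ (A : Type u) [Category.{v} A], Function.Bijective fun S : D.Str A => M.str S)
    (hhom : ∀ {A B : Type u} [Category.{v} A] [Category.{v} B] (S : D.Str A) (S' : D.Str B)
      (F : A ⥤ B), Function.Bijective fun f : D.Hom S S' F => M.hom f)
    (hhom₂ : ∀ {A B : Type u} [Category.{v} A] [Category.{v} B] {S : D.Str A} {S' : D.Str B}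
      {F G : A ⥤ B} (φ : D.Hom S S' F) (ψ : D.Hom S S' G) (α : F ⟶ G),
      E.Hom₂ (M.hom φ) (M.hom ψ) α → D.Hom₂ φ ψ α) :
    M.toStrictPseudofunctor.IsIsomorphism := by
  refine ⟨⟨?_, ?_⟩, fun X Y => ⟨?_, ?_⟩, fun X Y f g => ⟨?_, ?_⟩⟩
  · rintro ⟨A, S⟩ ⟨A', S'⟩ h
    obtain ⟨rfl, h₁, h₂⟩ := CatStructure.Obj.mk.inj h
    obtain rfl := eq_of_heq h₁
    obtain rfl := (hstr A).1 (eq_of_heq h₂)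
    rfl
  · rintro ⟨A, T⟩
    obtain ⟨S, rfl⟩ := (hstr A).2 T
    exact ⟨⟨A, S⟩, rfl⟩
  · rintro ⟨F, s⟩ ⟨F', s'⟩ h
    obtain ⟨h₁, h₂⟩ := CatStructure.Cell₁.mk.inj h
    obtain rfl : F = F' := h₁
    obtain rfl := (hhom X.str Y.str F).1 (eq_of_heq h₂)
    rfl
  · rintro ⟨F, t⟩
    obtain ⟨s, rfl⟩ := (hhom X.str Y.str F).2 t
    exact ⟨⟨F, s⟩, rfl⟩
  · intro α β h
    exact CatStructure.Cell₂.ext (congrArg (fun γ : M.toStrictPseudofunctor.map f ⟶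
      M.toStrictPseudofunctor.map g => CatStructure.Cell₂.natTrans γ) h)
  · rintro ⟨α, h⟩
    exact ⟨⟨α, hhom₂ _ _ _ h⟩, rfl⟩

theorem mainTheorem1 :
    ∃ (h₀ : ∀ (A : Type u) [Category.{v} A] (S : NormalColaxAlgebra.{w} A),
        S.ultraData.IsUltrastructure)
      (h₁ : ∀ (A B : Type u) [Category.{v} A] [Category.{v} B] (S : NormalColaxAlgebra.{w} A)
        (S' : NormalColaxAlgebra.{w} B) (F : A ⥤ B) (f : LaxMorphism S S' F),
        IsLeftUltrastructure S.ultraData S'.ultraData F f.leftFamily)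
      (h₂ : ∀ (A B : Type u) [Category.{v} A] [Category.{v} B] (S : NormalColaxAlgebra.{w} A)
        (S' : NormalColaxAlgebra.{w} B) (F : A ⥤ B) (f : ColaxMorphism S S' F),
        IsRightUltrastructure S.ultraData S'.ultraData F f.rightFamily),
      (∀ (A : Type u) [Category.{v} A],
        Function.Bijective fun S : NormalColaxAlgebra.{w} A =>
          (⟨S.ultraData, h₀ A S⟩ : Ultrastructure.{w} A)) ∧
      (laxToLeft h₀ h₁).toStrictPseudofunctor.IsIsomorphism ∧
      (colaxToRight h₀ h₂).toStrictPseudofunctor.IsIsomorphism ∧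
      (pseudoToUltra h₀ h₁).toStrictPseudofunctor.IsIsomorphism := by
  refine ⟨fun A _ S => S.isUltrastructure_ultraData,
    fun _ _ _ _ _ _ _ f => f.isLeftUltrastructure,
    fun _ _ _ _ _ _ _ f => f.isRightUltrastructure,
    fun A _ => NormalColaxAlgebra.bijective_ultraData A, ?_, ?_, ?_⟩
  · exact CatStructure.Map.isIsomorphism _ (fun A _ => NormalColaxAlgebra.bijective_ultraData A)
      (fun _ _ _ => LaxMorphism.bijective_leftFamily) fun _ _ _ h X => h X.uf X.fam
  · exact CatStructure.Map.isIsomorphism _ (fun A _ => NormalColaxAlgebra.bijective_ultraData A)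
      (fun _ _ _ => ColaxMorphism.bijective_rightFamily) fun _ _ _ h X => h X.uf X.fam
  · refine CatStructure.Map.isIsomorphism _ (fun A _ => NormalColaxAlgebra.bijective_ultraData A)
      (fun S S' F => ⟨fun f g h => ?_, fun σ => ?_⟩) fun _ _ _ h X => h X.uf X.fam
    · exact Subtype.ext (LaxMorphism.bijective_leftFamily.1 (congrArg Subtype.val h))
    · exact ⟨⟨LaxMorphism.ofLeft σ.1, fun X => σ.2 X.uf X.fam⟩, rfl⟩
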